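/- Let $k\ge 0$ be fixed and let $\Gamma$ be a sentence of the two-variable fragment of first-order logic (function-free, constant-free, two variable symbols that may be re-quantified) over a finite vocabulary consisting of predicates of arbitrary arity together with binary predicates $\le, Pred_1,\dots,Pred_k$. The axiom $Linear(\le,Pred_1,\dots,Pred_k)$ requires that $\le$ is interpreted as a linear (total) order of the domain and that, for each $s$, $Pred_s(x,y)$ holds exactly when $x$ is the $s$-th predecessor of $y$ in this order (the first predecessor being the immediate one, and the $s$-th predecessor being the predecessor of the $(s-1)$-th predecessor). For weights $w,\bar w$ on the predicates (including $\le$ and the $Pred_s$), let $$\mathsf{WFOMC}(n,w,\bar w)=\sum_{\omega}\ \prod_{l\in\omega} w(\mathsf{pred}(l))\prod_{l\in\mathcal H_n\setminus\omega}\bar w(\mathsf{pred}(l)),$$ where $\mathcal H_n$ is the set of all ground atoms over the domain $[n]=\{1,\dots,n\}$, $\mathsf{pred}(l)$ is the predicate of the atom $l$, and $\omega$ ranges over the subsets of $\mathcal H_n$ that satisfy $\Gamma\wedge Linear(\le,Pred_1,\dots,Pred_k)$. Then $\Gamma\wedge Linear(\le,Pred_1,\dots,Pred_k)$ is domain-liftable,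 i.e. its weighted model count is computable in time polynomial in the domain size. Precisely: there is a random-access-machine program (index registers with addition and subtraction; number registers with addition, subtraction and multiplication; branching on index registers only; integer constants only), depending only on the vocabulary and on $\Gamma$, which for every $n\ge 1$ and all weights, given $n$ and $w,\bar w$ as input, outputs $\mathsf{WFOMC}(n,w,\bar w)$, such that (a) for all real weights it executes at most $T(n)$ instructions, for a polynomial $T$ independent of the weights; and (b) for any fixed rational weights its running time in the logarithmic-cost measure (each operation is charged the bit lengths of the numbers and addresses it handles) is bounded by a polynomial in $n$. -/

import Mathlib

namespace WFOMC

/-! ### First-order formulas and weighted first-order model counting -/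

section Logic

variable {P : Type}

/-- Function-free first-order formulas over predicate symbols `P` with arities `ar`, whose
variables are taken from `X`. The `d`-variable fragment is obtained with `X = Fin d`; a variable
may be quantified repeatedly. -/
inductive Formula (ar : P → ℕ) (X : Type) : Type
  | atom (p : P) (t : Fin (ar p) → X) : Formula ar X
  | and (α β : Formula ar X) : Formula ar X
  | or (α β : Formula ar X) : Formula ar X
  | not (α : Formula ar X) : Formula ar X
  | imp (α β : Formula ar X) : Formula ar X
  | iff (α β : Formula ar X) : Formula ar X
  | ex (x : X) (α : Formula ar X) : Formula ar X
  | all (x : X) (α : Formula ar X) : Formula ar X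

/-- Two-variable formulas. -/
abbrev FO2 (ar : P → ℕ) : Type := Formula ar (Fin 2)

/-- The set of free variables. -/
def Formula.free {ar : P → ℕ} {X : Type} : Formula ar X → Set X
  | .atom _ t => Set.range t
  | .and α β => α.free ∪ β.free
  | .or α β => α.free ∪ β.free
  | .not α => α.free
  | .imp α β => α.free ∪ β.free
  | .iff α β => α.free ∪ β.free
  | .ex x α => α.free \ {x}
  | .all x α => α.free \ {x}

/-- A sentence is a formula all of whose variables are bound. -/
def Formula.IsSentence {ar : P → ℕ} {X : Type} (α : Formula ar X) : Prop := α.free = ∅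

/-- The Herbrand base: all ground atoms over a domain of size `n`. -/
abbrev GroundAtom (ar : P → ℕ) (n : ℕ) : Type := Σ p : P, (Fin (ar p) → Fin n)

/-- A possible world is a set of ground atoms, namely the true ones. -/
abbrev World (ar : P → ℕ) (n : ℕ) : Type := Finset (GroundAtom ar n)

/-- Truth of a formula in a world under an assignment of the variables. -/
def Formula.Holds {ar : P → ℕ} {X : Type} [DecidableEq X] {n : ℕ} (ω : World ar n) :
    Formula ar X → (X → Fin n) → Prop
  | .atom p t, v => (⟨p, fun i => v (t i)⟩ : GroundAtom ar n) ∈ ω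
  | .and α β, v => α.Holds ω v ∧ β.Holds ω v
  | .or α β, v => α.Holds ω v ∨ β.Holds ω v
  | .not α, v => ¬ α.Holds ω v
  | .imp α β, v => α.Holds ω v → β.Holds ω v
  | .iff α β, v => (α.Holds ω v ↔ β.Holds ω v)
  | .ex x α, v => ∃ a : Fin n, α.Holds ω (Function.update v x a)
  | .all x α, v => ∀ a : Fin n, α.Holds ω (Function.update v x a)

/-- A world satisfies a sentence (the assignment is irrelevant when nothing is free). -/
def Models {ar : P → ℕ} {X : Type} [DecidableEq X] {n : ℕ} (ω : World ar n)
    (α : Formula ar X) : Prop :=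
  ∀ v : X → Fin n, α.Holds ω v

open Classical in
/-- The weight of a possible world: `w p` for every true ground atom with predicate `p`, and
`wbar p` for every false one. -/
noncomputable def worldWeight [Fintype P] {R : Type} [CommRing R] {ar : P → ℕ} {n : ℕ}
    (w wbar : P → R) (ω : World ar n) : R :=
  (∏ l ∈ ω, w l.1) * ∏ l ∈ ωᶜ, wbar l.1

open Classical in
/-- The weighted model count of a condition `Γ` on worlds over the domain of size `n`. -/
noncomputable def wfomc [Fintype P] {R : Type} [CommRing R] {ar : P → ℕ} (n : ℕ)
    (Γ : World ar n → Prop) (w wbar : P → R) : R :=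
  ∑ ω ∈ Finset.univ.filter Γ, worldWeight w wbar ω

end Logic

/-! ### The general linear order axiom -/

/-- Predicate symbols: `m` ordinary ones, the order predicate, and the predecessor predicates,
where `pred s` stands for the `(s+1)`-st predecessor relation. -/
inductive Sym (m k : ℕ) : Type
  | user (i : Fin m) : Sym m k
  | le : Sym m k
  | pred (s : Fin k) : Sym m k
  deriving DecidableEq, Fintype

/-- Ordinary symbols have prescribed arities; order and predecessor symbols are binary. -/
def arity {m : ℕ} (k : ℕ) (ar : Fin m → ℕ) : Sym m k → ℕ
  | .user i => ar i
  | .le => 2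
  | .pred _ => 2

/-- `x` is the immediate predecessor of `y` in the order `r`. -/
def IsPred {D : Type} (r : D → D → Prop) (x y : D) : Prop :=
  r x y ∧ x ≠ y ∧ ∀ z, r x z → r z y → z = x ∨ z = y

/-- `x` is the `s`-th predecessor of `y`: the predecessor of the `(s-1)`-st predecessor of `y`. -/
def IsKthPred {D : Type} (r : D → D → Prop) : ℕ → D → D → Prop
  | 0, x, y => x = y
  | s + 1, x, y => ∃ z, IsPred r x z ∧ IsKthPred r s z y

/-- The axiom `Linear(≤, Pred_1, …, Pred_k)`: the order predicate is interpreted as some linear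
(total) order of the domain, and each `Pred_s` as its `s`-th predecessor relation. -/
def Linear {m k : ℕ} {ar : Fin m → ℕ} {n : ℕ} (ω : World (arity k ar) n) : Prop :=
  let r : Fin n → Fin n → Prop := fun a b => (⟨.le, ![a, b]⟩ : GroundAtom (arity k ar) n) ∈ ω
  (∀ a b, r a b ∨ r b a) ∧
  (∀ a b, r a b → r b a → a = b) ∧
  (∀ a b c, r a b → r b c → r a c) ∧
  ∀ (s : Fin k) (a b : Fin n),
    (⟨.pred s, ![a, b]⟩ : GroundAtom (arity k ar) n) ∈ ω ↔ IsKthPred r (s + 1) a b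

/-! ### A random access machine

The machine has an index memory holding natural numbers and a number memory holding elements of
a ring, both with indirect addressing. Index registers can only be added and subtracted; number
registers can only be added, subtracted and multiplied; control depends on index registers
alone, and the only constants in a program are integers. -/

/-- A memory state. -/
structure State (R : Type) where
  /-- index memory -/
  idx : ℕ → ℕ
  /-- number memory -/
  num : ℕ → R

/-- Elementary instructions, with `I` the index memory and `V` the number memory. -/
inductive Instr : Type
  /-- `I[a] := c` -/
  | idxConst (a c : ℕ)
  /-- `I[a] := I[b] + I[c]` -/
  | idxAdd (a b c : ℕ)
  /-- `I[a] := max (I[b] - I[c]) 0` -/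
  | idxSub (a b c : ℕ)
  /-- `I[a] := I[I[b]]` -/
  | idxLoad (a b : ℕ)
  /-- `I[I[a]] := I[b]` -/
  | idxStore (a b : ℕ)
  /-- `V[a] := z` -/
  | numConst (a : ℕ) (z : ℤ)
  /-- `V[a] := V[b] + V[c]` -/
  | numAdd (a b c : ℕ)
  /-- `V[a] := V[b] - V[c]` -/
  | numSub (a b c : ℕ)
  /-- `V[a] := V[b] * V[c]` -/
  | numMul (a b c : ℕ)
  /-- `V[a] := V[I[b]]` -/
  | numLoad (a b : ℕ)
  /-- `V[I[a]] := V[b]` -/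
  | numStore (a b : ℕ)

section Machine

variable {R : Type} [CommRing R]

/-- Write a value to an index register. -/
def State.setIdx (s : State R) (a c : ℕ) : State R := ⟨Function.update s.idx a c, s.num⟩

/-- Write a value to a number register. -/
def State.setNum (s : State R) (a : ℕ) (x : R) : State R := ⟨s.idx, Function.update s.num a x⟩

/-- The effect of an instruction. -/
def Instr.run : Instr → State R → State R
  | .idxConst a c, s => s.setIdx a c
  | .idxAdd a b c, s => s.setIdx a (s.idx b + s.idx c)
  | .idxSub a b c, s => s.setIdx a (s.idx b - s.idx c)
  | .idxLoad a b, s => s.setIdx a (s.idx (s.idx b))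
  | .idxStore a b, s => s.setIdx (s.idx a) (s.idx b)
  | .numConst a z, s => s.setNum a (z : R)
  | .numAdd a b c, s => s.setNum a (s.num b + s.num c)
  | .numSub a b c, s => s.setNum a (s.num b - s.num c)
  | .numMul a b c, s => s.setNum a (s.num b * s.num c)
  | .numLoad a b, s => s.setNum a (s.num (s.idx b))
  | .numStore a b, s => s.setNum (s.idx a) (s.num b)

/-- The cost of an instruction: one, plus the sizes of the data and addresses it handles.
`size` measures index values and `nsize` measures ring elements. -/
def Instr.cost (size : ℕ → ℕ) (nsize : R → ℕ) : Instr → State R → ℕ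
  | .idxConst _ c, _ => 1 + size c
  | .idxAdd _ b c, s => 1 + size (s.idx b) + size (s.idx c)
  | .idxSub _ b c, s => 1 + size (s.idx b) + size (s.idx c)
  | .idxLoad _ b, s => 1 + size (s.idx b) + size (s.idx (s.idx b))
  | .idxStore a b, s => 1 + size (s.idx a) + size (s.idx b)
  | .numConst _ z, _ => 1 + nsize (z : R)
  | .numAdd _ b c, s => 1 + nsize (s.num b) + nsize (s.num c)
  | .numSub _ b c, s => 1 + nsize (s.num b) + nsize (s.num c)
  | .numMul _ b c, s => 1 + nsize (s.num b) + nsize (s.num c)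
  | .numLoad _ b, s => 1 + size (s.idx b) + nsize (s.num (s.idx b))
  | .numStore a b, s => 1 + size (s.idx a) + nsize (s.num b)

end Machine

/-- Programs. -/
inductive Prog : Type
  /-- one instruction -/
  | instr (i : Instr)
  /-- first `p`, then `q` -/
  | seq (p q : Prog)
  /-- if `I[a] ≠ 0` then `p` else `q` -/
  | ite (a : ℕ) (p q : Prog)
  /-- while `I[a] ≠ 0` do `p` -/
  | loop (a : ℕ) (p : Prog)

/-- `Exec size nsize p s c s'`: program `p`, started in state `s`, halts in state `s'` at total
cost `c`. -/
inductive Exec {R : Type} [CommRing R] (size : ℕ → ℕ) (nsize : R → ℕ) :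
    Prog → State R → ℕ → State R → Prop
  | instr (i : Instr) (s : State R) :
      Exec size nsize (.instr i) s (i.cost size nsize s) (i.run s)
  | seq {p q : Prog} {s s' s'' : State R} {c d : ℕ} :
      Exec size nsize p s c s' → Exec size nsize q s' d s'' →
      Exec size nsize (.seq p q) s (c + d) s''
  | ite_true {a : ℕ} {p q : Prog} {s s' : State R} {c : ℕ} :
      s.idx a ≠ 0 → Exec size nsize p s c s' →
      Exec size nsize (.ite a p q) s (1 + size (s.idx a) + c) s'
  | ite_false {a : ℕ} {p q : Prog} {s s' : State R} {c : ℕ} :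
      s.idx a = 0 → Exec size nsize q s c s' →
      Exec size nsize (.ite a p q) s (1 + size (s.idx a) + c) s'
  | loop_step {a : ℕ} {p : Prog} {s s' s'' : State R} {c d : ℕ} :
      s.idx a ≠ 0 → Exec size nsize p s c s' → Exec size nsize (.loop a p) s' d s'' →
      Exec size nsize (.loop a p) s (1 + size (s.idx a) + c + d) s''
  | loop_done {a : ℕ} {p : Prog} {s : State R} :
      s.idx a = 0 → Exec size nsize (.loop a p) s (1 + size (s.idx a)) s

/-- Unit cost: every instruction and every test costs one. -/
abbrev UnitExec {R : Type} [CommRing R] : Prog → State R → ℕ → State R → Prop :=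
  Exec (fun _ => 0) (fun _ => 0)

/-- The number of bits of a rational number: those of its numerator and its denominator. -/
def ratBits (q : ℚ) : ℕ := Nat.size q.num.natAbs + Nat.size q.den

/-- Logarithmic (bit) cost over the rationals: every operation is charged the bit lengths of the
data and addresses that it handles. -/
abbrev BitExec : Prog → State ℚ → ℕ → State ℚ → Prop :=
  Exec Nat.size ratBits

/-- The entry of `w` at the `j`-th symbol in the enumeration: ordinary symbols, order symbol,
predecessor symbols (and zero beyond them). -/
def entry {m k : ℕ} {R : Type} [CommRing R] (w : Sym m k → R) (j : ℕ) : R :=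
  if h : j < m then w (.user ⟨j, h⟩)
  else if j = m then w .le
  else if h : j - (m + 1) < k then w (.pred ⟨j - (m + 1), h⟩)
  else 0

/-- The input state: `I[0] = n`, and `V[2j]`, `V[2j+1]` hold the weights `w`, `wbar` of the
`j`-th symbol; everything else is zero. -/
def input {m k : ℕ} {R : Type} [CommRing R] (n : ℕ) (w wbar : Sym m k → R) : State R where
  idx j := if j = 0 then n else 0
  num j := if j % 2 = 0 then entry w (j / 2) else entry wbar (j / 2)

/-! ### Domain-liftability -/

/-- `Γ` together with `Linear(≤, Pred_1, …, Pred_k)`, as a condition on worlds. -/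
def WithLinear {m k : ℕ} {ar : Fin m → ℕ} (Γ : FO2 (arity k ar)) (n : ℕ)
    (ω : World (arity k ar) n) : Prop :=
  Models ω Γ ∧ Linear ω

/-- The sentence `Γ ∧ Linear(≤, Pred_1, …, Pred_k)` is domain-liftable: some program, depending
only on the sentence, computes the weighted model count (in `V[0]`) from the domain size and the
weights in time polynomial in the domain size. For real weights, time is the number of
instructions, ring operations on reals being single instructions; for rational weights, it is
moreover bounded in the logarithmic-cost (bit) sense, where the polynomial may depend on the fixed
weights. -/
def DomainLiftable {m k : ℕ} {ar : Fin m → ℕ} (Γ : FO2 (arity k ar)) : Prop :=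
  ∃ prog : Prog,
    (∃ T : Polynomial ℕ, ∀ (w wbar : Sym m k → ℝ) (n : ℕ), 1 ≤ n →
      ∃ (c : ℕ) (s : State ℝ), UnitExec prog (input n w wbar) c s ∧ c ≤ T.eval n ∧
        s.num 0 = wfomc n (WithLinear Γ n) w wbar) ∧
    (∀ w wbar : Sym m k → ℚ, ∃ T : Polynomial ℕ, ∀ n : ℕ, 1 ≤ n →
      ∃ (c : ℕ) (s : State ℚ), BitExec prog (input n w wbar) c s ∧ c ≤ T.eval n ∧
        s.num 0 = wfomc n (WithLinear Γ n) w wbar)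

end WFOMC

/-! Relabelling the domain preserves both `Γ` and the weights, and a finite linear order has exactly
one increasing enumeration. Hence the count is `n!` times the count of worlds in which the order is
the natural one of `Fin n` (`wfomc_withLinear`).

Quantifiers are removed by a signed form of Skolemization. The truth value of an existential
subformula is guessed at every element, and wrong guesses cancel against labels of weight `-1`
(`sum_flagSign`). The indicator of `Γ` thus becomes a signed sum over labelings of the domain by a
fixed finite set, with constraints on pairs of elements only (`exists_models_eq_sum`). Such
constraints see only atoms that mention at most two elements; every other atom is free and
contributes a factor `w p + wbar p`. Once the nullary atoms, the one-element atoms (cells) and the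
labels are fixed, the two-element atoms can be summed separately for each pair. The predecessor
predicates enter a pair through its distance alone, and distances beyond `k` need not be
distinguished. What remains is a sum over words of length `n` in which every two letters interact,
depending on their distance capped at `k + 1` (`exists_wfomc_eq`, `chainSum`).

Such a sum is a dynamic program. The factor for appending a letter depends on the last `k + 1`
letters and, for all earlier ones, only on how often each letter occurs. There are polynomially many
such states. A state, together with the number of remaining steps, is coded as an integer in base `n
+ 3`, and the dynamic program turns into a recurrence with shifted arguments
(`shiftRec_eq_sum_chainSum`).

The tables are written by a machine that fills a stream, each entry being a fixed integer
combination of products of inputs and earlier entries (`exists_stream_program`). To control bit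
lengths, number subtraction is avoided and every multiplication has a factor from a set of small
elements, so that sizes grow linearly with the number of steps (`Run.num_mem`) and a polynomial step
count gives a polynomial bit cost (`Run.exec`). Program and step bound are uniform in the ring. They
are used over the reals with a trivial notion of size, and over the rationals with one that tracks a
common denominator (`domainLiftable_of_program`). -/

namespace WFOMC

/-! ### Tame executions -/

section Tame

variable {R : Type} [CommRing R]

/-- A filtration of a ring by subsets that grow slowly under addition and multiplication. -/
structure SizeFiltration (R : Type) [CommRing R] where
  /-- `mem b x` says that `x` has size at most `b` -/
  mem : ℕ → R → Prop
  mono : ∀ {b c : ℕ} {x : R}, b ≤ c → mem b x → mem c x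
  add : ∀ {b : ℕ} {x y : R}, mem b x → mem b y → mem (b + 1) (x + y)
  mul : ∀ {b c : ℕ} {x y : R}, mem b x → mem c y → mem (b + c) (x * y)
  int : ∀ z : ℤ, ∃ b, mem b (z : R)

/-- An instruction is tame if it multiplies only by elements of `S` and loads only constants
from `S`. -/
def Instr.Tame (S : R → Prop) : Instr → State R → Prop
  | .numConst _ z, _ => S (z : R)
  | .numMul _ b c, s => S (s.num b) ∨ S (s.num c)
  | .numSub _ _ _, _ => False
  | _, _ => True

/-- Terminating executions with tame instructions only, counting instructions and tests. -/
inductive Run (S : R → Prop) : Prog → State R → ℕ → State R → Prop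
  | instr (i : Instr) (s : State R) : i.Tame S s → Run S (.instr i) s 1 (i.run s)
  | seq {p q : Prog} {s s' s'' : State R} {c d : ℕ} :
      Run S p s c s' → Run S q s' d s'' → Run S (.seq p q) s (c + d) s''
  | ite_true {a : ℕ} {p q : Prog} {s s' : State R} {c : ℕ} :
      s.idx a ≠ 0 → Run S p s c s' → Run S (.ite a p q) s (1 + c) s'
  | ite_false {a : ℕ} {p q : Prog} {s s' : State R} {c : ℕ} :
      s.idx a = 0 → Run S q s c s' → Run S (.ite a p q) s (1 + c) s'
  | loop_step {a : ℕ} {p : Prog} {s s' s'' : State R} {c d : ℕ} :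
      s.idx a ≠ 0 → Run S p s c s' → Run S (.loop a p) s' d s'' →
      Run S (.loop a p) s (1 + c + d) s''
  | loop_done {a : ℕ} {p : Prog} {s : State R} :
      s.idx a = 0 → Run S (.loop a p) s 1 s

/-- The largest index constant of a program. -/
def Prog.maxConst : Prog → ℕ
  | .instr (.idxConst _ c) => c
  | .instr _ => 0
  | .seq p q => max p.maxConst q.maxConst
  | .ite _ p q => max p.maxConst q.maxConst
  | .loop _ p => p.maxConst

/-- An instruction at most doubles the largest index value, the worst case being a sum of two
registers; constants are absorbed by `A`. Bit lengths of indices and addresses therefore grow by at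
most one per step. -/
theorem Run.idx_le {S : R → Prop} {p : Prog} {s s' : State R} {c : ℕ} (h : Run S p s c s') :
    ∀ {A : ℕ}, p.maxConst ≤ A → (∀ a, s.idx a ≤ A) → ∀ a, s'.idx a ≤ A * 2 ^ c := by
  induction h with
  | instr i s hi =>
    clear hi
    intro A hA hs a
    have hsa := hs a
    cases i <;> simp only [Instr.run, State.setIdx, State.setNum, Function.update_apply,
      Prog.maxConst] at hA ⊢
    case idxConst => split <;> omega
    case idxAdd _ b c => have := hs b; have := hs c; split <;> omega
    case idxSub _ b c => have := hs b; split <;> omega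
    case idxLoad _ b => have := hs (s.idx b); split <;> omega
    case idxStore _ b => have := hs b; split <;> omega
    all_goals omega
  | seq _ _ ih₁ ih₂ =>
    intro A hA hs a
    rw [Prog.maxConst, max_le_iff] at hA
    rw [pow_add, ← mul_assoc]
    exact ih₂ (hA.2.trans (Nat.le_mul_of_pos_right _ (by positivity))) (ih₁ hA.1 hs) a
  | ite_true _ _ ih =>
    intro A hA hs a
    rw [Prog.maxConst, max_le_iff] at hA
    refine (ih hA.1 hs a).trans (Nat.mul_le_mul_left _ (Nat.pow_le_pow_right (by simp) ?_))
    omega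
  | ite_false _ _ ih =>
    intro A hA hs a
    rw [Prog.maxConst, max_le_iff] at hA
    refine (ih hA.2 hs a).trans (Nat.mul_le_mul_left _ (Nat.pow_le_pow_right (by simp) ?_))
    omega
  | loop_step _ _ _ ih₁ ih₂ =>
    intro A hA hs a
    refine (ih₂ (A := A * 2 ^ _) (le_trans (by exact hA)
      (Nat.le_mul_of_pos_right _ (by positivity))) (ih₁ hA hs) a).trans ?_
    rw [mul_assoc, ← pow_add]
    refine Nat.mul_le_mul_left _ (Nat.pow_le_pow_right (by simp) ?_)
    omega
  | loop_done _ =>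
    intro A hA hs a
    exact (hs a).trans (Nat.le_mul_of_pos_right _ (by positivity))

/-- An addition raises the size by one and a tame multiplication by at most `b`, because one factor
has size `b`. Unrestricted multiplication could double the size at each step; tameness keeps the
growth linear in `c`. -/
theorem Run.num_mem (𝓕 : SizeFiltration R) {b : ℕ} {p : Prog} {s s' : State R} {c : ℕ}
    (h : Run (𝓕.mem b) p s c s') :
    ∀ {B : ℕ}, (∀ a, 𝓕.mem B (s.num a)) → ∀ a, 𝓕.mem (B + c * (b + 1)) (s'.num a) := by
  induction h with
  | instr i s hi =>
    intro B hs a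
    have hsa := 𝓕.mono (c := B + 1 * (b + 1)) (by omega) (hs a)
    cases i <;> simp only [Instr.run, State.setIdx, State.setNum, Function.update_apply,
      Instr.Tame] at hi ⊢
    case numConst => split; exacts [𝓕.mono (by omega) hi, hsa]
    case numAdd _ x y =>
      split; exacts [𝓕.mono (by omega) (𝓕.add (hs x) (hs y)), hsa]
    case numMul _ x y =>
      split
      · rcases hi with hi | hi
        · exact 𝓕.mono (by omega) (𝓕.mul hi (hs y))
        · exact 𝓕.mono (by omega) (𝓕.mul (hs x) hi)
      · exact hsa
    case numLoad _ x => split; exacts [𝓕.mono (by omega) (hs _), hsa]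
    case numStore _ x => split; exacts [𝓕.mono (by omega) (hs _), hsa]
    all_goals exact hsa
  | seq _ _ ih₁ ih₂ =>
    intro B hs a
    exact 𝓕.mono (by ring_nf; omega) (ih₂ (ih₁ hs) a)
  | ite_true _ _ ih => intro B hs a; exact 𝓕.mono (by ring_nf; omega) (ih hs a)
  | ite_false _ _ ih => intro B hs a; exact 𝓕.mono (by ring_nf; omega) (ih hs a)
  | loop_step _ _ _ ih₁ ih₂ =>
    intro B hs a
    exact 𝓕.mono (by ring_nf; omega) (ih₂ (ih₁ hs) a)
  | loop_done _ => intro B hs a; exact 𝓕.mono (by omega) (hs a)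

/-- The cost of a tame execution, for arbitrary measures of index values and numbers. -/
theorem Run.exec (𝓕 : SizeFiltration R) {size : ℕ → ℕ} {nsize : R → ℕ} {b : ℕ} {p : Prog}
    {s s' : State R} {c : ℕ} (h : Run (𝓕.mem b) p s c s') {σ : ℕ} :
    ∀ {A B : ℕ}, p.maxConst ≤ A → (∀ a, s.idx a ≤ A) → (∀ a, 𝓕.mem B (s.num a)) →
      (∀ x ≤ A * 2 ^ c, size x ≤ σ) → (∀ x, 𝓕.mem (B + c * (b + 1)) x → nsize x ≤ σ) →
      ∃ c' ≤ c * (1 + 2 * σ), Exec size nsize p s c' s' := by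
  induction h with
  | instr i s hi =>
    intro A B hA hs hn hsize hnsize
    -- No instruction is charged for more than two values, hence the factor `1 + 2 * σ`.
    refine ⟨_, ?_, Exec.instr i s⟩
    have h1 : ∀ a, size (s.idx a) ≤ σ := fun a => hsize _ ((hs a).trans (by omega))
    have h2 : ∀ a, nsize (s.num a) ≤ σ := fun a => hnsize _ (𝓕.mono (by omega) (hn a))
    cases i <;> simp only [Instr.cost, Prog.maxConst] at hA ⊢
    case idxConst a c => have := hsize c (by omega); omega
    case numConst a z =>
      have := hnsize z (𝓕.mono (by omega) (show 𝓕.mem b (z : R) from hi)); omega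
    case idxAdd a b c => have := h1 b; have := h1 c; omega
    case idxSub a b c => have := h1 b; have := h1 c; omega
    case idxLoad a b => have := h1 b; have := h1 (s.idx b); omega
    case idxStore a b => have := h1 b; have := h1 a; omega
    case numAdd a b c => have := h2 b; have := h2 c; omega
    case numSub a b c => have := h2 b; have := h2 c; omega
    case numMul a b c => have := h2 b; have := h2 c; omega
    case numLoad a b => have := h1 b; have := h2 (s.idx b); omega
    case numStore a b => have := h1 a; have := h2 b; omega
  | @seq p q s s' s'' c d h₁ h₂ ih₁ ih₂ =>
    intro A B hA hs hn hsize hnsize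
    rw [Prog.maxConst, max_le_iff] at hA
    obtain ⟨c₁, hc₁, e₁⟩ := ih₁ hA.1 hs hn
      (fun x hx => hsize x (hx.trans (Nat.mul_le_mul_left _
        (Nat.pow_le_pow_right (by simp) (by omega)))))
      (fun x hx => hnsize x (𝓕.mono (by ring_nf; omega) hx))
    -- The second program starts from the bounds reached after `c` steps; running it for `d` more
    -- steps lands on the bounds for `c + d`, for which `σ` was assumed to suffice.
    obtain ⟨c₂, hc₂, e₂⟩ := ih₂ (hA.2.trans (Nat.le_mul_of_pos_right _ (by positivity)))
      (h₁.idx_le hA.1 hs) (h₁.num_mem 𝓕 hn)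
      (fun x hx => hsize x (by rwa [pow_add, ← mul_assoc]))
      (fun x hx => hnsize x (𝓕.mono (by ring_nf; omega) hx))
    exact ⟨_, by rw [add_mul]; omega, e₁.seq e₂⟩
  | @ite_true a p q s s' c h h₁ ih =>
    intro A B hA hs hn hsize hnsize
    rw [Prog.maxConst, max_le_iff] at hA
    obtain ⟨c₁, hc₁, e₁⟩ := ih hA.1 hs hn
      (fun x hx => hsize x (hx.trans (Nat.mul_le_mul_left _
        (Nat.pow_le_pow_right (by simp) (by omega)))))
      (fun x hx => hnsize x (𝓕.mono (by ring_nf; omega) hx))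
    have := hsize (s.idx a) ((hs a).trans (Nat.le_mul_of_pos_right _ (by positivity)))
    exact ⟨_, by rw [add_mul]; omega, e₁.ite_true h⟩
  | @ite_false a p q s s' c h h₁ ih =>
    intro A B hA hs hn hsize hnsize
    rw [Prog.maxConst, max_le_iff] at hA
    obtain ⟨c₁, hc₁, e₁⟩ := ih hA.2 hs hn
      (fun x hx => hsize x (hx.trans (Nat.mul_le_mul_left _
        (Nat.pow_le_pow_right (by simp) (by omega)))))
      (fun x hx => hnsize x (𝓕.mono (by ring_nf; omega) hx))
    have := hsize (s.idx a) ((hs a).trans (Nat.le_mul_of_pos_right _ (by positivity)))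
    exact ⟨_, by rw [add_mul]; omega, e₁.ite_false h⟩
  | @loop_step a p s s' s'' c d h h₁ h₂ ih₁ ih₂ =>
    intro A B hA hs hn hsize hnsize
    obtain ⟨c₁, hc₁, e₁⟩ := ih₁ hA hs hn
      (fun x hx => hsize x (hx.trans (Nat.mul_le_mul_left _
        (Nat.pow_le_pow_right (by simp) (by omega)))))
      (fun x hx => hnsize x (𝓕.mono (by ring_nf; omega) hx))
    obtain ⟨c₂, hc₂, e₂⟩ := ih₂ (A := A * 2 ^ c)
      (le_trans (by exact hA) (Nat.le_mul_of_pos_right _ (by positivity)))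
      (h₁.idx_le hA hs) (h₁.num_mem 𝓕 hn)
      (fun x hx => hsize x (hx.trans (by
        rw [mul_assoc, ← pow_add]
        exact Nat.mul_le_mul_left _ (Nat.pow_le_pow_right (by simp) (by omega)))))
      (fun x hx => hnsize x (𝓕.mono (by ring_nf; omega) hx))
    have := hsize (s.idx a) ((hs a).trans (Nat.le_mul_of_pos_right _ (by positivity)))
    exact ⟨_, by rw [add_mul, add_mul]; omega, e₁.loop_step h e₂⟩
  | @loop_done a p s h =>
    intro A B hA hs hn hsize hnsize
    have := hsize (s.idx a) ((hs a).trans (Nat.le_mul_of_pos_right _ (by positivity)))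
    exact ⟨_, by omega, Exec.loop_done h⟩

/-- A loop that counts the register `r` down. -/
theorem Run.loop_count {S : R → Prop} {r N C : ℕ} {p : Prog} (Inv : ℕ → State R → Prop)
    (hbody : ∀ i s, i < N → Inv i s → s.idx r = N - i →
      ∃ c ≤ C, ∃ s', Run S p s c s' ∧ Inv (i + 1) s' ∧ s'.idx r = N - (i + 1))
    {s : State R} (hs : Inv 0 s) (hr : s.idx r = N) :
    ∃ c ≤ N * (C + 1) + 1, ∃ s', Run S (.loop r p) s c s' ∧ Inv N s' ∧ s'.idx r = 0 := by
  suffices H : ∀ j i s, i + j = N → Inv i s → s.idx r = N - i →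
      ∃ c ≤ j * (C + 1) + 1, ∃ s', Run S (.loop r p) s c s' ∧ Inv N s' ∧ s'.idx r = 0 from
    H N 0 s (by omega) hs (by omega)
  intro j
  induction j with
  | zero =>
    intro i s hi hs hr
    obtain rfl : i = N := by omega
    exact ⟨1, by omega, s, .loop_done (by omega), hs, by omega⟩
  | succ j ih =>
    intro i s hi hs hr
    obtain ⟨c, hc, s', h, hs', hr'⟩ := hbody i s (by omega) hs hr
    obtain ⟨d, hd, s'', h', hs'', hr''⟩ := ih (i + 1) s' (by omega) hs' hr'
    exact ⟨1 + c + d, by rw [add_mul]; omega, s'', .loop_step (by omega) h h', hs'', hr''⟩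

end Tame

end WFOMC

namespace WFOMC

/-! ### Index expressions -/

/-- Index expressions in the domain size and a running position. -/
inductive IExpr : Type
  | size
  | pos
  | const (c : ℕ)
  | add (e f : IExpr)
  | sub (e f : IExpr)
  | mul (e f : IExpr)
  /-- the sum of the numbers below the value of `e` -/
  | tri (e : IExpr)

namespace IExpr

/-- The value of an index expression. -/
def eval (n x : ℕ) : IExpr → ℕ
  | size => n
  | pos => x
  | const c => c
  | add e f => e.eval n x + f.eval n x
  | sub e f => e.eval n x - f.eval n x
  | mul e f => e.eval n x * f.eval n x
  | tri e => ∑ i ∈ Finset.range (e.eval n x), i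

/-- Powers of an index expression. -/
def pow (e : IExpr) : ℕ → IExpr
  | 0 => const 1
  | j + 1 => mul (e.pow j) e

@[simp] theorem eval_pow (n x : ℕ) (e : IExpr) (j : ℕ) : (e.pow j).eval n x = e.eval n x ^ j := by
  induction j with
  | zero => rfl
  | succ j ih => rw [pow, eval, ih, pow_succ]

open Polynomial in
/-- A bound for the value of an index expression. -/
noncomputable def bound : IExpr → ℕ[X]
  | size => X
  | pos => X
  | const c => C c
  | add e f => e.bound + f.bound
  | sub e _ => e.bound
  | mul e f => e.bound * f.bound
  | tri e => e.bound * e.bound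

theorem eval_le_bound {n x u : ℕ} (hn : n ≤ u) (hx : x ≤ u) (e : IExpr) :
    e.eval n x ≤ e.bound.eval u := by
  induction e with
  | size => simpa [eval, bound]
  | pos => simpa [eval, bound]
  | const c => simp [eval, bound]
  | add e f ihe ihf => simpa [eval, bound] using add_le_add ihe ihf
  | sub e f ihe ihf => exact (Nat.sub_le _ _).trans ihe
  | mul e f ihe ihf => simpa [eval, bound] using Nat.mul_le_mul ihe ihf
  | tri e ih =>
    simp only [eval, bound, Polynomial.eval_mul]
    refine le_trans ?_ (Nat.mul_le_mul ih ih)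
    refine (Finset.sum_le_card_nsmul _ _ (e.eval n x) fun i hi => ?_).trans (by simp)
    exact (Finset.mem_range.1 hi).le

/-- Code that evaluates an index expression into register `a`, given the domain size in register
`0` and the position in register `1`. -/
def compile : IExpr → ℕ → Prog
  | size, a => .seq (.instr (.idxConst (a + 1) 0)) (.instr (.idxAdd a 0 (a + 1)))
  | pos, a => .seq (.instr (.idxConst (a + 1) 0)) (.instr (.idxAdd a 1 (a + 1)))
  | const c, a => .instr (.idxConst a c)
  | add e f, a => .seq (e.compile a) (.seq (f.compile (a + 1)) (.instr (.idxAdd a a (a + 1))))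
  | sub e f, a => .seq (e.compile a) (.seq (f.compile (a + 1)) (.instr (.idxSub a a (a + 1))))
  | mul e f, a => .seq (e.compile a) (.seq (f.compile (a + 1))
      (.seq (.instr (.idxConst (a + 2) 0)) (.seq (.instr (.idxConst (a + 3) 1))
        (.seq (.loop (a + 1) (.seq (.instr (.idxAdd (a + 2) (a + 2) a))
          (.instr (.idxSub (a + 1) (a + 1) (a + 3)))))
          (.instr (.idxAdd a (a + 2) (a + 1)))))))
  | tri e, a => .seq (e.compile a)
      (.seq (.instr (.idxConst (a + 1) 0)) (.seq (.instr (.idxConst (a + 2) 1))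
        (.seq (.loop a (.seq (.instr (.idxSub a a (a + 2)))
          (.instr (.idxAdd (a + 1) (a + 1) a))))
          (.instr (.idxAdd a (a + 1) a)))))

open Polynomial in
/-- A bound for the number of steps taken by `compile`. -/
noncomputable def cost : IExpr → ℕ[X]
  | size => 2
  | pos => 2
  | const _ => 1
  | add e f => e.cost + f.cost + 1
  | sub e f => e.cost + f.cost + 1
  | mul e f => e.cost + f.cost + f.bound * 3 + 4
  | tri e => e.cost + e.bound * 3 + 4

/-- Registers below `a` survive, so a second operand can be evaluated at `a + 1` without destroying
the first. There is no move instruction: copying means adding a register known to be zero, such as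
the exhausted counter of a loop. -/
theorem run_compile {R : Type} [CommRing R] (S : R → Prop) (e : IExpr) :
    ∀ {a : ℕ}, 2 ≤ a → ∀ (s : State R) {u : ℕ}, s.idx 0 ≤ u → s.idx 1 ≤ u →
      ∃ c ≤ e.cost.eval u, ∃ s', Run S (e.compile a) s c s' ∧ s'.num = s.num ∧
        s'.idx a = e.eval (s.idx 0) (s.idx 1) ∧ ∀ r < a, s'.idx r = s.idx r := by
  induction e with
  | size =>
    intro a ha s u h0 h1
    refine ⟨_, ?_, _, .seq (.instr _ _ trivial) (.instr _ _ trivial), rfl, ?_, fun r hr => ?_⟩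
    · simp [cost]
    · simp [Instr.run, State.setIdx, eval]
    · simp [Instr.run, State.setIdx, hr.ne, show r ≠ a + 1 by omega]
  | pos =>
    intro a ha s u h0 h1
    refine ⟨_, ?_, _, .seq (.instr _ _ trivial) (.instr _ _ trivial), rfl, ?_, fun r hr => ?_⟩
    · simp [cost]
    · simp [Instr.run, State.setIdx, eval, Function.update_of_ne (show 1 ≠ a + 1 by omega)]
    · simp [Instr.run, State.setIdx, hr.ne, show r ≠ a + 1 by omega]
  | const c =>
    intro a ha s u h0 h1
    refine ⟨_, ?_, _, .instr _ _ trivial, rfl, ?_, fun r hr => ?_⟩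
    · simp [cost]
    · simp [Instr.run, State.setIdx, eval]
    · simp [Instr.run, State.setIdx, hr.ne]
  | add e f ihe ihf =>
    intro a ha s u h0 h1
    obtain ⟨c, hc, s₁, r₁, n₁, v₁, k₁⟩ := ihe ha s h0 h1
    obtain ⟨d, hd, s₂, r₂, n₂, v₂, k₂⟩ := ihf (a := a + 1) (by omega) s₁ (u := u)
      (by rwa [k₁ 0 (by omega)]) (by rwa [k₁ 1 (by omega)])
    rw [k₁ 0 (by omega), k₁ 1 (by omega)] at v₂
    refine ⟨_, ?_, _, .seq r₁ (.seq r₂ (.instr _ _ trivial)), ?_, ?_, fun r hr => ?_⟩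
    · simp only [cost, Polynomial.eval_add, Polynomial.eval_one]; omega
    · simp [Instr.run, State.setIdx, n₁, n₂]
    · simp [Instr.run, State.setIdx, eval, v₂, k₂ a (by omega), v₁]
    · simp [Instr.run, State.setIdx, hr.ne, k₂ r (by omega), k₁ r hr]
  | sub e f ihe ihf =>
    intro a ha s u h0 h1
    obtain ⟨c, hc, s₁, r₁, n₁, v₁, k₁⟩ := ihe ha s h0 h1
    obtain ⟨d, hd, s₂, r₂, n₂, v₂, k₂⟩ := ihf (a := a + 1) (by omega) s₁ (u := u)
      (by rwa [k₁ 0 (by omega)]) (by rwa [k₁ 1 (by omega)])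
    rw [k₁ 0 (by omega), k₁ 1 (by omega)] at v₂
    refine ⟨_, ?_, _, .seq r₁ (.seq r₂ (.instr _ _ trivial)), ?_, ?_, fun r hr => ?_⟩
    · simp only [cost, Polynomial.eval_add, Polynomial.eval_one]; omega
    · simp [Instr.run, State.setIdx, n₁, n₂]
    · simp [Instr.run, State.setIdx, eval, v₂, k₂ a (by omega), v₁]
    · simp [Instr.run, State.setIdx, hr.ne, k₂ r (by omega), k₁ r hr]
  | mul e f ihe ihf =>
    intro a ha s u h0 h1
    obtain ⟨c, hc, s₁, r₁, n₁, v₁, k₁⟩ := ihe ha s h0 h1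
    obtain ⟨d, hd, s₂, r₂, n₂, v₂, k₂⟩ := ihf (a := a + 1) (by omega) s₁ (u := u)
      (by rwa [k₁ 0 (by omega)]) (by rwa [k₁ 1 (by omega)])
    rw [k₁ 0 (by omega), k₁ 1 (by omega)] at v₂
    set s₃ : State R := ((s₂.setIdx (a + 2) 0).setIdx (a + 3) 1) with hs₃
    -- Multiplication by repeated addition: after `i` rounds register `a + 2` holds `i` copies of
    -- the first operand, while `a + 1` counts down from the second.
    obtain ⟨k, hk, s₄, r₄, ⟨v₄, w₄, n₄, k₄, -⟩, z₄⟩ := Run.loop_count (S := S) (r := a + 1)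
      (N := f.eval (s.idx 0) (s.idx 1)) (C := 2)
      (p := .seq (.instr (.idxAdd (a + 2) (a + 2) a)) (.instr (.idxSub (a + 1) (a + 1) (a + 3))))
      (fun i t => t.idx a = e.eval (s.idx 0) (s.idx 1) ∧
        t.idx (a + 2) = i * e.eval (s.idx 0) (s.idx 1) ∧ t.num = s.num ∧
        (∀ r < a, t.idx r = s.idx r) ∧ t.idx (a + 3) = 1)
      (by
        rintro i t hi ⟨t1, t2, t3, t4, t5⟩ ht
        refine ⟨2, le_rfl, _, .seq (.instr (.idxAdd _ _ _) _ trivial)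
          (.instr (.idxSub _ _ _) _ trivial), ⟨?_, ?_, ?_, ?_, ?_⟩,
          ?_⟩
        · simp [Instr.run, State.setIdx, t1]
        · simp [Instr.run, State.setIdx, t1, t2, add_mul]
        · simpa [Instr.run, State.setIdx]
        · intro r hr
          simp [Instr.run, State.setIdx, t4 r hr, show r ≠ a + 1 by omega,
            show r ≠ a + 2 by omega]
        · simp [Instr.run, State.setIdx, t5]
        · simp [Instr.run, State.setIdx, t5, ht]; omega)
      (s := s₃)
      (by
        refine ⟨?_, ?_, ?_, ?_, ?_⟩
        · simp [hs₃, State.setIdx, k₂ a (by omega), v₁]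
        · simp [hs₃, State.setIdx]
        · simp [hs₃, State.setIdx, n₁, n₂]
        · intro r hr
          simp [hs₃, State.setIdx, k₂ r (by omega), k₁ r hr, show r ≠ a + 2 by omega,
            show r ≠ a + 3 by omega]
        · simp [hs₃, State.setIdx])
      (by simp [hs₃, State.setIdx, v₂])
    refine ⟨_, ?_, _, .seq r₁ (.seq r₂ (.seq (.instr _ _ trivial) (.seq (.instr _ _ trivial)
      (.seq r₄ (.instr _ _ trivial))))), ?_, ?_, fun r hr => ?_⟩
    · have := eval_le_bound h0 h1 f
      simp only [cost, Polynomial.eval_add, Polynomial.eval_mul, Polynomial.eval_ofNat]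
      omega
    · simpa [Instr.run, State.setIdx]
    · simp [Instr.run, State.setIdx, w₄, z₄, eval, mul_comm]
    · simp [Instr.run, State.setIdx, hr.ne, k₄ r hr]
  | tri e ihe =>
    intro a ha s u h0 h1
    obtain ⟨c, hc, s₁, r₁, n₁, v₁, k₁⟩ := ihe ha s h0 h1
    set N := e.eval (s.idx 0) (s.idx 1) with hN
    set s₃ : State R := ((s₁.setIdx (a + 1) 0).setIdx (a + 2) 1) with hs₃
    -- The invariant is that the accumulator plus the triangular number of the remaining counter
    -- stays constant. The counter is lowered before it is added, so the sum runs over the numbers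
    -- strictly below `N`.
    obtain ⟨k, hk, s₄, r₄, ⟨w₄, n₄, k₄, -⟩, z₄⟩ := Run.loop_count (S := S) (r := a)
      (N := N) (C := 2)
      (p := .seq (.instr (.idxSub a a (a + 2))) (.instr (.idxAdd (a + 1) (a + 1) a)))
      (fun i t => t.idx (a + 1) + ∑ j ∈ Finset.range (N - i), j = ∑ j ∈ Finset.range N, j ∧
        t.num = s.num ∧ (∀ r < a, t.idx r = s.idx r) ∧ t.idx (a + 2) = 1)
      (by
        rintro i t hi ⟨t2, t3, t4, t5⟩ ht
        refine ⟨2, le_rfl, _, .seq (.instr (.idxSub _ _ _) _ trivial)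
          (.instr (.idxAdd _ _ _) _ trivial), ⟨?_, ?_, ?_, ?_⟩,
          ?_⟩
        · obtain ⟨q, hq⟩ : ∃ q, N - i = q + 1 := ⟨N - i - 1, by omega⟩
          rw [hq, Finset.sum_range_succ] at t2
          rw [hq] at ht
          simp only [Instr.run, State.setIdx, Function.update_self, ht, t5,
            show N - (i + 1) = q by omega, Function.update_of_ne (show a + 1 ≠ a by omega)]
          omega
        · simpa [Instr.run, State.setIdx]
        · intro r hr
          simp [Instr.run, State.setIdx, t4 r hr, show r ≠ a + 1 by omega, hr.ne]
        · simp [Instr.run, State.setIdx, t5]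
        · simp [Instr.run, State.setIdx, t5, ht]; omega)
      (s := s₃)
      (by
        refine ⟨?_, ?_, ?_, ?_⟩
        · simp [hs₃, State.setIdx]
        · simp [hs₃, State.setIdx, n₁]
        · intro r hr
          simp [hs₃, State.setIdx, k₁ r hr, show r ≠ a + 1 by omega, show r ≠ a + 2 by omega]
        · simp [hs₃, State.setIdx])
      (by simp [hs₃, State.setIdx, v₁])
    refine ⟨_, ?_, _, .seq r₁ (.seq (.instr _ _ trivial) (.seq (.instr _ _ trivial)
      (.seq r₄ (.instr _ _ trivial)))), ?_, ?_, fun r hr => ?_⟩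
    · have := eval_le_bound h0 h1 e
      simp only [cost, Polynomial.eval_add, Polynomial.eval_mul, Polynomial.eval_ofNat]
      omega
    · simpa [Instr.run, State.setIdx]
    · simp [Instr.run, State.setIdx, z₄, eval] at w₄ ⊢
      omega
    · simp [Instr.run, State.setIdx, hr.ne, k₄ r hr]

end IExpr

end WFOMC

namespace WFOMC

/-! ### Programs that write a stream of numbers -/

/-- A factor of a product: an input number, or an earlier entry of the stream. -/
inductive Src : Type
  | weight (j : ℕ)
  | read (e : IExpr)

/-- A block of stream entries: their number, and each of them as a sum of integer multiples of
products. -/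
structure Seg where
  /-- the number of entries -/
  len : IExpr
  /-- the sum that defines an entry -/
  rhs : List (ℤ × List Src)

section Semantics

variable {R : Type} [CommRing R]

/-- The value of a factor at position `x` of the stream `F`. -/
def Src.val (V F : ℕ → R) (n x : ℕ) : Src → R
  | .weight j => V j
  | .read e => F (e.eval n x)

/-- The factor refers to one of the `q` inputs or to an entry before position `x`. -/
def Src.Legal (q n x : ℕ) : Src → Prop
  | .weight j => j < q
  | .read e => e.eval n x < x

/-- The value of a product with coefficient. -/
def termVal (V F : ℕ → R) (n x : ℕ) (t : ℤ × List Src) : R :=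
  t.1 * (t.2.map (Src.val V F n x)).prod

/-- The value of a sum of products. -/
def rhsVal (V F : ℕ → R) (n x : ℕ) (l : List (ℤ × List Src)) : R :=
  (l.map (termVal V F n x)).sum

/-- A product is legal if its factors are, and all but the first of them lie in `S`. -/
structure TermLegal (S : R → Prop) (q : ℕ) (V F : ℕ → R) (n x : ℕ) (t : ℤ × List Src) : Prop where
  coeff : S (t.1 : R)
  tail : ∀ a ∈ t.2.tail, S (a.val V F n x)
  legal : ∀ a ∈ t.2, a.Legal q n x

/-- The stream `F` satisfies the equations of a block that starts at position `x`. -/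
def SegValid (S : R → Prop) (q : ℕ) (V F : ℕ → R) (n x : ℕ) (σ : Seg) : Prop :=
  ∀ i < σ.len.eval n x, (∀ t ∈ σ.rhs, TermLegal S q V F n (x + i) t) ∧
    F (x + i) = rhsVal V F n (x + i) σ.rhs

/-- The position after a list of blocks that starts at position `x`. -/
def endPos (n : ℕ) : ℕ → List Seg → ℕ
  | x, [] => x
  | x, σ :: l => endPos n (x + σ.len.eval n x) l

/-- The stream satisfies the equations of a list of blocks. -/
def SegsValid (S : R → Prop) (q : ℕ) (V F : ℕ → R) (n : ℕ) : ℕ → List Seg → Prop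
  | _, [] => True
  | x, σ :: l => SegValid S q V F n x σ ∧ SegsValid S q V F n (x + σ.len.eval n x) l

theorem le_endPos (n x : ℕ) (l : List Seg) : x ≤ endPos n x l := by
  induction l generalizing x with
  | nil => exact le_rfl
  | cons σ l ih => exact (Nat.le_add_right _ _).trans (ih _)

theorem endPos_append (n x : ℕ) (l l' : List Seg) :
    endPos n x (l ++ l') = endPos n (endPos n x l) l' := by
  induction l generalizing x with
  | nil => rfl
  | cons σ l ih => exact ih _

theorem segsValid_append {S : R → Prop} {q : ℕ} {V F : ℕ → R} {n x : ℕ} {l l' : List Seg} :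
    SegsValid S q V F n x (l ++ l') ↔
      SegsValid S q V F n x l ∧ SegsValid S q V F n (endPos n x l) l' := by
  induction l generalizing x with
  | nil => simp [SegsValid, endPos]
  | cons σ l ih => simp only [List.cons_append, SegsValid, endPos, ih, and_assoc]

/-- The state after the first `x` entries of the stream have been written. -/
structure Filled (q : ℕ) (V F : ℕ → R) (n x : ℕ) (s : State R) : Prop where
  size : s.idx 0 = n
  pos : s.idx 1 = x
  weights : ∀ j < q, s.num j = V j
  stream : ∀ a < x, s.num (q + 3 + a) = F a

end Semantics

/-- Code that multiplies the number register `q + 1` by a factor. -/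
def Src.code (q : ℕ) : Src → Prog
  | .weight j => .instr (.numMul (q + 1) (q + 1) j)
  | .read e => .seq ((IExpr.add e (.const (q + 3))).compile 3)
      (.seq (.instr (.numLoad (q + 2) 3)) (.instr (.numMul (q + 1) (q + 1) (q + 2))))

/-- Code that multiplies the number register `q + 1` by a list of factors and continues. -/
def srcsCode (q : ℕ) : List Src → Prog → Prog
  | [], k => k
  | a :: l, k => .seq (a.code q) (srcsCode q l k)

/-- Code that adds a list of products to the number register `q` and continues. -/
def termsCode (q : ℕ) : List (ℤ × List Src) → Prog → Prog
  | [], k => k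
  | t :: l, k => .seq (.instr (.numConst (q + 1) t.1))
      (srcsCode q t.2 (.seq (.instr (.numAdd q q (q + 1))) (termsCode q l k)))

/-- Code that stores the number register `q` as the next entry of the stream. -/
def pushCode (q : ℕ) : Prog :=
  .seq ((IExpr.add .pos (.const (q + 3))).compile 3) (.seq (.instr (.numStore 3 q))
    (.seq (.instr (.idxConst 3 1)) (.seq (.instr (.idxAdd 1 1 3)) (.instr (.idxSub 2 2 3)))))

/-- Code that writes a block of the stream. -/
def Seg.code (q : ℕ) (σ : Seg) : Prog :=
  .seq (σ.len.compile 3) (.seq (.instr (.idxConst 4 0)) (.seq (.instr (.idxAdd 2 3 4))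
    (.loop 2 (.seq (.instr (.numConst q 0)) (termsCode q σ.rhs (pushCode q))))))

/-- Code that writes a list of blocks and continues. -/
def segsCode (q : ℕ) : List Seg → Prog → Prog
  | [], k => k
  | σ :: l, k => .seq (σ.code q) (segsCode q l k)

/-- Code that moves the last entry of the stream to the number register `0`. -/
def outputCode (q : ℕ) : Prog :=
  .seq ((IExpr.add .pos (.const (q + 2))).compile 3) (.seq (.instr (.numLoad (q + 2) 3))
    (.seq (.instr (.numConst (q + 1) 0)) (.instr (.numAdd 0 (q + 1) (q + 2)))))

open Polynomial

/-- A bound for the number of steps of `Src.code`. -/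
noncomputable def Src.cost (q : ℕ) : Src → ℕ[X]
  | .weight _ => 1
  | .read e => (IExpr.add e (.const (q + 3))).cost + 2

/-- A bound for the number of steps of `termsCode` before its continuation. -/
noncomputable def termsCost (q : ℕ) (l : List (ℤ × List Src)) : ℕ[X] :=
  (l.map fun t => (t.2.map (Src.cost q)).sum + 2).sum

/-- A bound for the number of steps of `Seg.code`. -/
noncomputable def Seg.cost (q : ℕ) (σ : Seg) : ℕ[X] :=
  σ.len.cost + 3 +
    σ.len.bound * (termsCost q σ.rhs + (IExpr.add .pos (.const (q + 3))).cost + 6)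

/-- The number registers `q`, `q + 1`, `q + 2` are scratch space (running sum, running product,
loaded factor) between the inputs and the stream, so writing to them does no harm. -/
theorem Filled.congr {R : Type} {q n x : ℕ} {V F : ℕ → R} {s s' : State R}
    (h : Filled q V F n x s) (h0 : s'.idx 0 = s.idx 0)
    (h1 : s'.idx 1 = s.idx 1) (hw : ∀ j < q, s'.num j = s.num j)
    (hs : ∀ a ≥ q + 3, s'.num a = s.num a) : Filled q V F n x s' where
  size := h0.trans h.size
  pos := h1.trans h.pos
  weights j hj := (hw j hj).trans (h.weights j hj)
  stream a ha := (hs _ (by omega)).trans (h.stream a ha)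

section Correctness

variable {R : Type} [CommRing R] {S : R → Prop} {q n x u : ℕ} {V F : ℕ → R} {s : State R}

theorem Src.run_code (a : Src) (h : Filled q V F n x s) (hn : n ≤ u) (hx : x ≤ u)
    (hl : a.Legal q n x) (hS : S (s.num (q + 1)) ∨ S (a.val V F n x)) :
    ∃ c ≤ (a.cost q).eval u, ∃ s', Run S (a.code q) s c s' ∧ Filled q V F n x s' ∧
      s'.num q = s.num q ∧ s'.num (q + 1) = s.num (q + 1) * a.val V F n x ∧
      s'.idx 2 = s.idx 2 := by
  cases a with
  | weight j =>
    simp only [Src.Legal, Src.val] at hl hS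
    refine ⟨1, by simp [Src.cost], _, .instr _ _ (by rwa [Instr.Tame, h.weights j hl]),
      h.congr rfl rfl (fun i hi => ?_) (fun i hi => ?_), ?_, ?_, rfl⟩
    · simp [Instr.run, State.setNum, show i ≠ q + 1 by omega]
    · simp [Instr.run, State.setNum, show i ≠ q + 1 by omega]
    · simp [Instr.run, State.setNum]
    · simp [Instr.run, State.setNum, Src.val, h.weights j hl]
  | read e =>
    simp only [Src.Legal, Src.val] at hl hS
    obtain ⟨c, hc, s₁, r₁, n₁, v₁, k₁⟩ := IExpr.run_compile S (IExpr.add e (.const (q + 3)))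
      (a := 3) (by omega) s (u := u) (by rwa [h.size]) (by rwa [h.pos])
    have hv : s₁.num (s₁.idx 3) = F (e.eval n x) := by
      rw [v₁, n₁, h.size, h.pos, ← h.stream _ hl]
      simp only [IExpr.eval]
      congr 1
      omega
    refine ⟨_, ?_, _, .seq r₁ (.seq (.instr (.numLoad _ _) _ trivial) (.instr _ _ ?_)),
      h.congr ?_ ?_ (fun i hi => ?_) (fun i hi => ?_), ?_, ?_, ?_⟩
    · simp only [Src.cost, Polynomial.eval_add, Polynomial.eval_ofNat]; omega
    · simp only [Instr.Tame, Instr.run, State.setNum, Function.update_self, hv]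
      rwa [Function.update_of_ne (by omega), n₁]
    · simp [Instr.run, State.setNum, k₁]
    · simp [Instr.run, State.setNum, k₁]
    · simp [Instr.run, State.setNum, show i ≠ q + 1 by omega, show i ≠ q + 2 by omega, n₁]
    · simp [Instr.run, State.setNum, show i ≠ q + 1 by omega, show i ≠ q + 2 by omega, n₁]
    · simp [Instr.run, State.setNum, n₁]
    · simp [Instr.run, State.setNum, Src.val, hv, n₁]
    · simp [Instr.run, State.setNum, k₁]

/-- The hypothesis with two cases is what tameness requires. The product register starts with a
small coefficient, so the first factor may be large; from then on the register itself may be large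
and each further factor has to be small. -/
theorem run_srcsCode (l : List Src) (hn : n ≤ u) (hx : x ≤ u) : ∀ {s : State R},
    Filled q V F n x s → (∀ a ∈ l, a.Legal q n x) →
    ((S (s.num (q + 1)) ∧ ∀ a ∈ l.tail, S (a.val V F n x)) ∨ ∀ a ∈ l, S (a.val V F n x)) →
    ∃ c ≤ ((l.map (Src.cost q)).sum).eval u, ∃ s', (∀ k d s'', Run S k s' d s'' →
      Run S (srcsCode q l k) s (c + d) s'') ∧ Filled q V F n x s' ∧
      s'.num q = s.num q ∧
      s'.num (q + 1) = s.num (q + 1) * (l.map (Src.val V F n x)).prod ∧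
      s'.idx 2 = s.idx 2 := by
  induction l with
  | nil =>
    intro s h _ _
    exact ⟨0, by simp, s, fun k d s'' hk => by simpa [srcsCode], h, rfl, by simp, rfl⟩
  | cons a l ih =>
    intro s h hl hS
    obtain ⟨c, hc, s₁, r₁, f₁, a₁, v₁, i₁⟩ := a.run_code (S := S) h hn hx
      (hl a List.mem_cons_self)
      (hS.imp (·.1) fun H => H a List.mem_cons_self)
    obtain ⟨d, hd, s₂, r₂, f₂, a₂, v₂, i₂⟩ := ih f₁
      (fun b hb => hl b (List.mem_cons_of_mem _ hb))
      (.inr (hS.elim (·.2) fun H b hb => H b (List.mem_cons_of_mem _ hb)))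
    refine ⟨c + d, ?_, s₂, fun k e s'' hk => ?_, f₂, a₂.trans a₁, ?_, i₂.trans i₁⟩
    · simp only [List.map_cons, List.sum_cons, Polynomial.eval_add]; omega
    · rw [add_assoc]; exact .seq r₁ (r₂ k e s'' hk)
    · rw [v₂, v₁, List.map_cons, List.prod_cons, mul_assoc]

theorem run_termsCode (l : List (ℤ × List Src)) (hn : n ≤ u) (hx : x ≤ u) : ∀ {s : State R},
    Filled q V F n x s → (∀ t ∈ l, TermLegal S q V F n x t) →
    ∃ c ≤ (termsCost q l).eval u, ∃ s', (∀ k d s'', Run S k s' d s'' →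
      Run S (termsCode q l k) s (c + d) s'') ∧ Filled q V F n x s' ∧
      s'.num q = s.num q + rhsVal V F n x l ∧ s'.idx 2 = s.idx 2 := by
  induction l with
  | nil =>
    intro s h _
    exact ⟨0, by simp, s, fun k d s'' hk => by simpa [termsCode], h, by simp [rhsVal], rfl⟩
  | cons t l ih =>
    intro s h hl
    have ht := hl t List.mem_cons_self
    obtain ⟨c, hc, s₁, r₁, f₁, a₁, v₁, i₁⟩ := run_srcsCode (S := S) (V := V) (F := F) t.2 hn hx
      (s := s.setNum (q + 1) t.1)
      (h.congr rfl rfl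
        (fun i hi => by simp [State.setNum, show i ≠ q + 1 by omega])
        (fun i hi => by simp [State.setNum, show i ≠ q + 1 by omega])) ht.legal
      (.inl ⟨by simpa [State.setNum] using ht.coeff, ht.tail⟩)
    obtain ⟨d, hd, s₂, r₂, f₂, a₂, i₂⟩ := ih (s := s₁.setNum q (s₁.num q + s₁.num (q + 1)))
      (f₁.congr rfl rfl
        (fun i hi => by simp [State.setNum, show i ≠ q by omega])
        (fun i hi => by simp [State.setNum, show i ≠ q by omega]))
      (fun b hb => hl b (List.mem_cons_of_mem _ hb))
    refine ⟨1 + (c + (1 + d)), ?_, s₂, fun k e s'' hk => ?_, f₂, ?_, i₂.trans i₁⟩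
    · simp only [termsCost, List.map_cons, List.sum_cons, Polynomial.eval_add,
        Polynomial.eval_ofNat] at hd ⊢
      omega
    · have := Run.seq (Run.instr (S := S) (.numConst (q + 1) t.1) s ht.coeff)
        (r₁ _ _ _ (.seq (.instr (.numAdd q q (q + 1)) s₁ trivial) (r₂ k e s'' hk)))
      rw [termsCode]
      convert this using 1
      omega
    · rw [a₂]
      simp only [State.setNum, Function.update_self, a₁, v₁, rhsVal, List.map_cons, List.sum_cons,
        termVal, Function.update_of_ne (show q ≠ q + 1 by omega)]
      ring

theorem run_pushCode (h : Filled q V F n x s) (hn : n ≤ u) (hx : x ≤ u) (hq : s.num q = F x) :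
    ∃ c ≤ (IExpr.add .pos (.const (q + 3))).cost.eval u + 4, ∃ s', Run S (pushCode q) s c s' ∧
      Filled q V F n (x + 1) s' ∧ s'.idx 2 = s.idx 2 - 1 := by
  obtain ⟨c, hc, s₁, r₁, n₁, v₁, k₁⟩ := IExpr.run_compile S (IExpr.add .pos (.const (q + 3)))
    (a := 3) (by omega) s (u := u) (by rwa [h.size]) (by rwa [h.pos])
  rw [h.size, h.pos] at v₁
  simp only [IExpr.eval] at v₁
  refine ⟨_, ?_, _, .seq r₁ (.seq (.instr (.numStore _ _) _ trivial)
    (.seq (.instr (.idxConst _ _) _ trivial) (.seq (.instr (.idxAdd _ _ _) _ trivial)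
      (.instr (.idxSub _ _ _) _ trivial)))), ⟨?_, ?_, fun j hj => ?_, fun a ha => ?_⟩, ?_⟩
  · omega
  · simp [Instr.run, State.setNum, State.setIdx, k₁, h.size]
  · simp [Instr.run, State.setNum, State.setIdx, k₁, h.pos]
  · simp [Instr.run, State.setNum, State.setIdx, v₁, n₁,
      Function.update_of_ne (show j ≠ x + (q + 3) by omega), h.weights j hj]
  · rcases Nat.lt_succ_iff_lt_or_eq.1 ha with ha | rfl
    · simp [Instr.run, State.setNum, State.setIdx, v₁, n₁,
        Function.update_of_ne (show q + 3 + a ≠ x + (q + 3) by omega), h.stream a ha]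
    · simp [Instr.run, State.setNum, State.setIdx, v₁, n₁, add_comm a, hq]
  · simp [Instr.run, State.setNum, State.setIdx, k₁]

theorem Seg.run_code (σ : Seg) (h0 : S 0) (h : Filled q V F n x s) (hn : n ≤ u)
    (hx : x + σ.len.eval n x ≤ u) (hv : SegValid S q V F n x σ) :
    ∃ c ≤ (σ.cost q).eval u, ∃ s', Run S (σ.code q) s c s' ∧
      Filled q V F n (x + σ.len.eval n x) s' := by
  obtain ⟨c, hc, s₁, r₁, n₁, v₁, k₁⟩ := IExpr.run_compile S σ.len
    (a := 3) (by omega) s (u := u) (by rwa [h.size]) (by rw [h.pos]; omega)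
  rw [h.size, h.pos] at v₁
  set s₂ := (s₁.setIdx 4 0).setIdx 2 (s₁.idx 3) with hs₂
  obtain ⟨d, hd, s₃, r₃, f₃, -⟩ := Run.loop_count (S := S) (r := 2) (N := σ.len.eval n x)
    (C := (termsCost q σ.rhs + (IExpr.add .pos (.const (q + 3))).cost + 5).eval u)
    (p := .seq (.instr (.numConst q 0)) (termsCode q σ.rhs (pushCode q)))
    (fun i s => Filled q V F n (x + i) s) (s := s₂)
    (by
      intro i s hi hs hr
      obtain ⟨c, hc, s₁, r₁, f₁, v₁, i₁⟩ := run_termsCode (S := S) (V := V) (F := F) σ.rhs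
        hn (x := x + i) (u := u) (by omega) (s := s.setNum q ((0 : ℤ) : R))
        (hs.congr rfl rfl
          (fun j hj => by simp [State.setNum, show j ≠ q by omega])
          (fun j hj => by simp [State.setNum, show j ≠ q by omega]))
        (hv i hi).1
      obtain ⟨d, hd, s₂, r₂, f₂, i₂⟩ := run_pushCode (S := S) f₁ hn (by omega)
        (by rw [v₁, (hv i hi).2]; simp [State.setNum])
      refine ⟨1 + (c + d), ?_, s₂, .seq (.instr (.numConst q 0) s (by simpa [Instr.Tame]))
        (r₁ _ _ _ r₂), f₂, ?_⟩
      · simp only [Polynomial.eval_add, Polynomial.eval_ofNat]; omega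
      · rw [i₂, i₁]; simp only [State.setNum]; omega)
    (h.congr (by simp [hs₂, State.setIdx, k₁]) (by simp [hs₂, State.setIdx, k₁])
      (fun i hi => by simp [hs₂, State.setIdx, n₁])
      (fun i hi => by simp [hs₂, State.setIdx, n₁]))
    (by simp [hs₂, State.setIdx, v₁])
  have hs₂' : s₂ = Instr.run (.idxAdd 2 3 4) (Instr.run (.idxConst 4 0) s₁) := by
    simp [hs₂, Instr.run, State.setIdx]
  refine ⟨_, ?_, s₃, .seq r₁ (.seq (.instr (.idxConst 4 0) _ trivial)
    (.seq (.instr (.idxAdd 2 3 4) _ trivial) (hs₂' ▸ r₃))), f₃⟩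
  have hb := Nat.mul_le_mul_right
    ((termsCost q σ.rhs + (IExpr.add .pos (.const (q + 3))).cost + 6).eval u)
    (IExpr.eval_le_bound hn (by omega : x ≤ u) σ.len)
  simp only [Seg.cost, Polynomial.eval_add, Polynomial.eval_mul, Polynomial.eval_ofNat] at hb hd ⊢
  simp only [add_assoc, Nat.reduceAdd] at *
  omega

theorem run_outputCode (h0 : S 0) (h : Filled q V F n (x + 1) s) (hn : n ≤ u) (hx : x + 1 ≤ u) :
    ∃ c ≤ (IExpr.add .pos (.const (q + 2))).cost.eval u + 3, ∃ s', Run S (outputCode q) s c s' ∧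
      s'.num 0 = F x := by
  -- The position register points one past the last entry, hence `q + 2` in place of `q + 3`.
  obtain ⟨c, hc, s₁, r₁, n₁, v₁, k₁⟩ := IExpr.run_compile S (IExpr.add .pos (.const (q + 2)))
    (a := 3) (by omega) s (u := u) (by rwa [h.size]) (by rwa [h.pos])
  rw [h.size, h.pos] at v₁
  simp only [IExpr.eval] at v₁
  refine ⟨_, ?_, _, .seq r₁ (.seq (.instr (.numLoad _ _) _ trivial)
    (.seq (.instr (.numConst _ _) _ (by simpa [Instr.Tame])) (.instr (.numAdd _ _ _) _ trivial))),
    ?_⟩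
  · omega
  · simp [Instr.run, State.setNum, v₁, n₁, ← h.stream x (by omega),
      show x + 1 + (q + 2) = q + 3 + x by omega]

end Correctness

/-- If `P` bounds the current position, then `P + σ.len.bound.comp P` bounds it after the block `σ`.
The list is fixed, so iterating gives polynomials that depend on neither the ring nor the stream. -/
theorem run_segsCode (q : ℕ) (l : List Seg) : ∀ P : ℕ[X], (∀ n, n ≤ P.eval n) →
    ∃ P' T : ℕ[X], (∀ n, n ≤ P'.eval n) ∧
      ∀ {R : Type} [CommRing R] {S : R → Prop} {n x : ℕ} {V F : ℕ → R} {s : State R}, S 0 →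
        x ≤ P.eval n → Filled q V F n x s → SegsValid S q V F n x l →
        ∃ c ≤ T.eval n, ∃ s', (∀ k d s'', Run S k s' d s'' →
          Run S (segsCode q l k) s (c + d) s'') ∧
          Filled q V F n (endPos n x l) s' ∧ endPos n x l ≤ P'.eval n := by
  induction l with
  | nil =>
    intro P hP
    exact ⟨P, 0, hP, fun _ hx hs _ => ⟨0, by simp, _, fun k d s'' h => by simpa [segsCode],
      hs, hx⟩⟩
  | cons σ l ih =>
    intro P hP
    have hQ : ∀ n, (P + σ.len.bound.comp P).eval n = P.eval n + σ.len.bound.eval (P.eval n) := by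
      simp
    obtain ⟨P', T, hP', H⟩ := ih (P + σ.len.bound.comp P) (fun n => by
      rw [hQ]; exact (hP n).trans (Nat.le_add_right _ _))
    refine ⟨P', (σ.cost q).comp (P + σ.len.bound.comp P) + T, hP', ?_⟩
    intro R _ S n x V F s h0 hx hs hl
    have hx' : x + σ.len.eval n x ≤ (P + σ.len.bound.comp P).eval n := by
      rw [hQ]; exact add_le_add hx (IExpr.eval_le_bound (hP n) hx σ.len)
    obtain ⟨c, hc, s₁, r₁, f₁⟩ := σ.run_code h0 hs
      (u := (P + σ.len.bound.comp P).eval n)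
      (by rw [hQ]; exact (hP n).trans (Nat.le_add_right _ _)) hx' hl.1
    obtain ⟨d, hd, s₂, r₂, f₂, b₂⟩ := H h0 hx' f₁ hl.2
    refine ⟨c + d, ?_, s₂, fun k e s'' hk => ?_, f₂, b₂⟩
    · rw [Polynomial.eval_add, Polynomial.eval_comp]; omega
    · rw [add_assoc]; exact .seq r₁ (r₂ k e s'' hk)

/-- For every list of blocks some program computes the last entry of the stream. -/
theorem exists_stream_program (q : ℕ) (l : List Seg) : ∃ (prog : Prog) (T : ℕ[X]),
    ∀ {R : Type} [CommRing R] {S : R → Prop} {n x : ℕ} {F : ℕ → R} {s : State R}, S 0 →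
      s.idx 0 = n → s.idx 1 = 0 → SegsValid S q s.num F n 0 l → endPos n 0 l = x + 1 →
      ∃ c ≤ T.eval n, ∃ s', Run S prog s c s' ∧ s'.num 0 = F x := by
  obtain ⟨P, T, hP, H⟩ := run_segsCode q l X (by simp)
  refine ⟨segsCode q l (outputCode q),
    T + ((IExpr.add .pos (.const (q + 2))).cost.comp P + 3), ?_⟩
  intro R _ S n x F s h0 hs0 hs1 hl hx
  obtain ⟨c, hc, s₁, r₁, f₁, b₁⟩ := H (x := 0) (V := s.num) h0 (by simp)
    ⟨hs0, hs1, fun _ _ => rfl, by simp⟩ hl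
  rw [hx] at f₁ b₁
  obtain ⟨d, hd, s₂, r₂, v₂⟩ := run_outputCode h0 f₁ (hP n) b₁
  refine ⟨c + d, ?_, s₂, r₁ _ _ _ r₂, v₂⟩
  simp only [Polynomial.eval_add, Polynomial.eval_comp, Polynomial.eval_ofNat]
  omega

end WFOMC

namespace WFOMC

/-! ### Recurrences over counter vectors -/

section Stream

variable {R : Type} [CommRing R]

/-- Legal factors refer only to earlier positions, so the equations of a list of blocks involve no
entry beyond its end. This allows a stream to be redefined there when further blocks are appended.
-/
theorem SegsValid.congr {S : R → Prop} {q : ℕ} {V F F' : ℕ → R} {n x : ℕ} {l : List Seg}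
    (h : SegsValid S q V F n x l) (hF : ∀ a < endPos n x l, F' a = F a) :
    SegsValid S q V F' n x l := by
  induction l generalizing x with
  | nil => trivial
  | cons σ l ih =>
    refine ⟨fun i hi => ?_, ih h.2 hF⟩
    obtain ⟨h₁, h₂⟩ := h.1 i hi
    have hend : x + σ.len.eval n x ≤ endPos n x (σ :: l) := le_endPos n _ l
    have hval : ∀ t ∈ σ.rhs, ∀ a ∈ t.2, a.val V F' n (x + i) = a.val V F n (x + i) := by
      intro t ht a ha
      have := (h₁ t ht).legal a ha
      cases a with
      | weight j => rfl
      | read e => exact hF _ (lt_of_lt_of_le this (by omega))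
    refine ⟨fun t ht => ⟨(h₁ t ht).coeff, fun a ha => ?_, (h₁ t ht).legal⟩, ?_⟩
    · rw [hval t ht a (List.mem_of_mem_tail ha)]
      exact (h₁ t ht).tail a ha
    · rw [hF _ (by omega), h₂, rhsVal, rhsVal]
      congr 1
      refine List.map_congr_left fun t ht => ?_
      rw [termVal, termVal, List.map_congr_left (hval t ht)]

/-- Integer polynomials in the inputs. -/
abbrev InputPoly : Type := List (ℤ × List ℕ)

/-- The value of an integer polynomial in the inputs. -/
def InputPoly.val (V : ℕ → R) (f : InputPoly) : R := (f.map fun t => (t.1 : R) * (t.2.map V).prod).sum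

/-- The coefficients of the polynomial and the inputs that it uses lie in `S`. -/
def InputPoly.Good (S : R → Prop) (q : ℕ) (V : ℕ → R) (f : InputPoly) : Prop :=
  ∀ t ∈ f, S (t.1 : R) ∧ ∀ j ∈ t.2, j < q ∧ S (V j)

/-- The polynomial as a sum of products. -/
def InputPoly.terms (f : InputPoly) : List (ℤ × List Src) :=
  f.map fun t => (t.1, t.2.map Src.weight)

/-- The product of the polynomial with an entry of the stream, as a sum of products. -/
def InputPoly.mulTerms (f : InputPoly) (e : IExpr) : List (ℤ × List Src) :=
  f.map fun t => (t.1, .read e :: t.2.map Src.weight)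

theorem InputPoly.rhsVal_terms (f : InputPoly) (V F : ℕ → R) (n x : ℕ) :
    rhsVal V F n x f.terms = f.val V := by
  simp [rhsVal, InputPoly.terms, InputPoly.val, termVal, Function.comp_def, Src.val]

theorem InputPoly.rhsVal_mulTerms (f : InputPoly) (e : IExpr) (V F : ℕ → R) (n x : ℕ) :
    rhsVal V F n x (f.mulTerms e) = f.val V * F (e.eval n x) := by
  simp only [rhsVal, InputPoly.mulTerms, InputPoly.val, termVal, List.map_map, Function.comp_def,
    Src.val, List.map_cons, List.prod_cons, ← List.sum_map_mul_right]
  congr 1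
  refine List.map_congr_left fun t _ => ?_
  ring

theorem InputPoly.Good.terms {S : R → Prop} {q : ℕ} {V F : ℕ → R} {f : InputPoly}
    (h : f.Good S q V) (n x : ℕ) : ∀ t ∈ f.terms, TermLegal S q V F n x t := by
  intro t ht
  obtain ⟨t', ht', rfl⟩ := List.mem_map.1 ht
  refine ⟨(h t' ht').1, fun a ha => ?_, fun a ha => ?_⟩
  · obtain ⟨j, hj, rfl⟩ := List.mem_map.1 (List.mem_of_mem_tail ha)
    exact ((h t' ht').2 j hj).2
  · obtain ⟨j, hj, rfl⟩ := List.mem_map.1 ha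
    exact ((h t' ht').2 j hj).1

theorem InputPoly.Good.mulTerms {S : R → Prop} {q : ℕ} {V F : ℕ → R} {f : InputPoly}
    (h : f.Good S q V) {e : IExpr} {n x : ℕ} (he : e.eval n x < x) :
    ∀ t ∈ f.mulTerms e, TermLegal S q V F n x t := by
  intro t ht
  obtain ⟨t', ht', rfl⟩ := List.mem_map.1 ht
  refine ⟨(h t' ht').1, fun a ha => ?_, fun a ha => ?_⟩
  · obtain ⟨j, hj, rfl⟩ := List.mem_map.1 ha
    exact ((h t' ht').2 j hj).2
  · rcases List.mem_cons.1 ha with rfl | ha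
    · exact he
    · obtain ⟨j, hj, rfl⟩ := List.mem_map.1 ha
      exact ((h t' ht').2 j hj).1

/-- The product of `α` with the powers of the `ρ j` given by the first `d` digits of `X` in
base `M`. -/
def rate (M d : ℕ) (α : R) (ρ : ℕ → R) (X : ℕ) : R :=
  α * ∏ j ∈ Finset.range d, ρ j ^ (X / M ^ j % M)

theorem rate_zero (M d : ℕ) (α : R) (ρ : ℕ → R) : rate M d α ρ 0 = α := by
  simp [rate]

/-- Since `M ^ j + i < M ^ (j + 1)`, adding `M ^ j` raises digit `j` by one without a carry, and all
higher digits are zero. A table of rates can thus be filled with one multiplication by some `ρ j`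
per entry; digit `d` is the step counter and carries no factor. -/
theorem rate_add (M d : ℕ) (α : R) (ρ : ℕ → R) {i j : ℕ} (hM : 0 < M)
    (h : M ^ j + i < M ^ (j + 1)) :
    rate M d α ρ (M ^ j + i) = (if j < d then ρ j else 1) * rate M d α ρ i := by
  have key : ∀ j', ρ j' ^ ((M ^ j + i) / M ^ j' % M) =
      (if j' = j then ρ j' else 1) * ρ j' ^ (i / M ^ j' % M) := by
    intro j'
    rcases lt_trichotomy j' j with hj | rfl | hj
    · rw [if_neg hj.ne, one_mul]
      obtain ⟨k, rfl⟩ : ∃ k, j = j' + 1 + k := ⟨j - j' - 1, by omega⟩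
      rw [pow_add, pow_succ, mul_assoc, Nat.mul_add_div (by positivity), Nat.mul_add_mod]
    · rw [if_pos rfl, ← pow_succ']
      have h1 : (M ^ j' + i) / M ^ j' = i / M ^ j' + 1 := by
        rw [Nat.add_div_left _ (by positivity)]
      have h2 : (M ^ j' + i) / M ^ j' < M := Nat.div_lt_of_lt_mul (by rwa [← pow_succ])
      rw [Nat.mod_eq_of_lt h2, h1, Nat.mod_eq_of_lt (by omega)]
    · rw [if_neg hj.ne', one_mul]
      have : M ^ (j + 1) ≤ M ^ j' := Nat.pow_le_pow_right hM hj
      rw [Nat.div_eq_of_lt (by omega), Nat.div_eq_of_lt (by omega)]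
  simp only [rate, key, Finset.prod_mul_distrib, Finset.prod_ite_eq', Finset.mem_range]
  ring

/-- The base of the counter vectors, as an index expression. -/
def baseExpr : IExpr := .add .size (.const 3)

/-- Blocks for the values of `rate`. -/
def rateSegs (d : ℕ) (α : InputPoly) (ρ : ℕ → InputPoly) : List Seg :=
  ⟨.const 1, α.terms⟩ :: (List.range (d + 1)).map fun j =>
    ⟨.sub (baseExpr.pow (j + 1)) (baseExpr.pow j),
      InputPoly.mulTerms (if j < d then ρ j else [(1, [])]) (.sub .pos (baseExpr.pow j))⟩

@[simp] theorem eval_baseExpr (n x : ℕ) : baseExpr.eval n x = n + 3 := rfl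

/-- The block lengths `(n + 3) ^ (j + 1) - (n + 3) ^ j` telescope, with the single entry before them
supplying the first unit. -/
theorem endPos_powSegs (n x : ℕ) (f : ℕ → List (ℤ × List Src)) (k : ℕ) :
    endPos n (x + 1) ((List.range k).map fun j =>
      ⟨.sub (baseExpr.pow (j + 1)) (baseExpr.pow j), f j⟩) = x + (n + 3) ^ k := by
  induction k with
  | zero => simp [endPos]
  | succ k ih =>
    rw [List.range_succ, List.map_append, endPos_append, ih]
    have := Nat.pow_le_pow_right (show 0 < n + 3 by omega) (show k ≤ k + 1 by omega)
    simp only [List.map_cons, List.map_nil, endPos, IExpr.eval, IExpr.eval_pow, eval_baseExpr]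
    omega

theorem endPos_rateSegs (n x d : ℕ) (α : InputPoly) (ρ : ℕ → InputPoly) :
    endPos n x (rateSegs d α ρ) = x + (n + 3) ^ (d + 1) :=
  endPos_powSegs n x _ _

theorem segsValid_rateSegs {S : R → Prop} {q n x d : ℕ} {V F : ℕ → R} {α : InputPoly}
    {ρ : ℕ → InputPoly} (h1 : S 1) (hα : α.Good S q V) (hρ : ∀ j < d, (ρ j).Good S q V)
    (hF : ∀ i < (n + 3) ^ (d + 1),
      F (x + i) = rate (n + 3) d (α.val V) (fun j => (ρ j).val V) i) :
    SegsValid S q V F n x (rateSegs d α ρ) := by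
  refine ⟨fun i hi => ⟨hα.terms _ _, ?_⟩, ?_⟩
  · simp only [IExpr.eval] at hi
    obtain rfl : i = 0 := by omega
    rw [hF 0 (by positivity), rate_zero, InputPoly.rhsVal_terms]
  · have H : ∀ k ≤ d + 1, SegsValid S q V F n (x + 1) ((List.range k).map fun j =>
        ⟨.sub (baseExpr.pow (j + 1)) (baseExpr.pow j),
          InputPoly.mulTerms (if j < d then ρ j else [(1, [])]) (.sub .pos (baseExpr.pow j))⟩) := by
      intro k
      induction k with
      | zero => exact fun _ => trivial
      | succ k ih =>
        intro hk
        have hp := Nat.pow_le_pow_right (show 0 < n + 3 by omega) (show k ≤ k + 1 by omega)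
        have hp' := Nat.pow_le_pow_right (show 0 < n + 3 by omega) hk
        have hpos : 0 < (n + 3) ^ k := by positivity
        rw [List.range_succ, List.map_append, segsValid_append, endPos_powSegs]
        refine ⟨ih (by omega), fun i hi => ⟨InputPoly.Good.mulTerms ?_ ?_, ?_⟩, trivial⟩
        · split_ifs with hkd
          · exact hρ k hkd
          · intro t ht
            obtain rfl := List.mem_singleton.1 ht
            exact ⟨by simpa, by simp⟩
        · simp only [IExpr.eval, IExpr.eval_pow, eval_baseExpr]; omega
        · simp only [IExpr.eval, IExpr.eval_pow, eval_baseExpr] at hi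
          rw [InputPoly.rhsVal_mulTerms]
          simp only [IExpr.eval, IExpr.eval_pow, eval_baseExpr]
          rw [show x + (n + 3) ^ k + i - (n + 3) ^ k = x + i by omega, add_assoc,
            hF _ (by omega), hF _ (by omega), rate_add _ _ _ _ (by omega) (by omega)]
          congr 1
          split_ifs with hkd
          · rfl
          · simp [InputPoly.val]
    exact H (d + 1) le_rfl

/-- The solution of a recurrence whose arguments are shifted by `dp e - (L + dm e)`. -/
def shiftRec (L ε : ℕ) (r : ℕ → ℕ → R) (dp dm : ℕ → ℕ) (X : ℕ) : R :=
  if X < L then 1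
  else ∑ e ∈ Finset.range ε, r e X *
    if _ : X + dp e - (L + dm e) < X then shiftRec L ε r dp dm (X + dp e - (L + dm e)) else 0
termination_by X

theorem shiftRec_of_lt {L ε : ℕ} {r : ℕ → ℕ → R} {dp dm : ℕ → ℕ} {X : ℕ} (h : X < L) :
    shiftRec L ε r dp dm X = 1 := by
  rw [shiftRec, if_pos h]

/-- As `dp e < L`, every shifted argument is smaller than `X`, also when the subtraction truncates.
The guard that makes the recursion terminate is then always satisfied. -/
theorem shiftRec_of_le {L ε : ℕ} {r : ℕ → ℕ → R} {dp dm : ℕ → ℕ} {X : ℕ} (h : L ≤ X)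
    (hL : 0 < L) (hd : ∀ e < ε, dp e < L) :
    shiftRec L ε r dp dm X =
      ∑ e ∈ Finset.range ε, r e X * shiftRec L ε r dp dm (X + dp e - (L + dm e)) := by
  rw [shiftRec, if_neg (by omega)]
  refine Finset.sum_congr rfl fun e he => ?_
  rw [dif_pos]
  have := hd e (Finset.mem_range.1 he)
  omega

/-- The sum of the place values of a list of counters, as an index expression. -/
def codeExpr : List ℕ → IExpr
  | [] => .const 0
  | j :: l => .add (baseExpr.pow j) (codeExpr l)

/-- The sum of the place values of a list of counters. -/
def codeSum (n : ℕ) (l : List ℕ) : ℕ := (l.map fun j => (n + 3) ^ j).sum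

theorem eval_codeExpr (n x : ℕ) (l : List ℕ) : (codeExpr l).eval n x = codeSum n l := by
  induction l with
  | nil => rfl
  | cons j l ih => simp [codeExpr, IExpr.eval, ih, codeSum]

end Stream

end WFOMC

namespace WFOMC

/-! ### A program for recurrences over counter vectors -/

section Counter

variable {R : Type} [CommRing R]

/-- The table of all values of `rate`. -/
def tableSegs (d : ℕ) (α : ℕ → InputPoly) (ρ : ℕ → ℕ → InputPoly) (ε : ℕ) : List Seg :=
  (List.range ε).flatMap fun e => rateSegs d (α e) (ρ e)

theorem tableSegs_succ (d : ℕ) (α : ℕ → InputPoly) (ρ : ℕ → ℕ → InputPoly) (ε : ℕ) :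
    tableSegs d α ρ (ε + 1) = tableSegs d α ρ ε ++ rateSegs d (α ε) (ρ ε) := by
  simp [tableSegs, List.range_succ]

theorem endPos_tableSegs (n d : ℕ) (α : ℕ → InputPoly) (ρ : ℕ → ℕ → InputPoly) (ε : ℕ) :
    endPos n 0 (tableSegs d α ρ ε) = ε * (n + 3) ^ (d + 1) := by
  induction ε with
  | zero => simp [tableSegs, endPos]
  | succ ε ih => rw [tableSegs_succ, endPos_append, ih, endPos_rateSegs, add_mul, one_mul]

theorem segsValid_tableSegs {S : R → Prop} {q n d ε : ℕ} {V F : ℕ → R} {α : ℕ → InputPoly}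
    {ρ : ℕ → ℕ → InputPoly} (h1 : S 1) (hα : ∀ e < ε, (α e).Good S q V)
    (hρ : ∀ e < ε, ∀ j < d, (ρ e j).Good S q V)
    (hF : ∀ e < ε, ∀ i < (n + 3) ^ (d + 1), F (e * (n + 3) ^ (d + 1) + i) =
      rate (n + 3) d ((α e).val V) (fun j => (ρ e j).val V) i) :
    SegsValid S q V F n 0 (tableSegs d α ρ ε) := by
  induction ε with
  | zero => trivial
  | succ ε ih =>
    rw [tableSegs_succ, segsValid_append, endPos_tableSegs]
    exact ⟨ih (fun e he => hα e (by omega)) (fun e he => hρ e (by omega))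
      (fun e he => hF e (by omega)),
      segsValid_rateSegs h1 (hα ε (by omega)) (hρ ε (by omega)) (hF ε (by omega))⟩

/-- The start of the table of the recurrence. -/
def startExpr (d ε : ℕ) : IExpr := .mul (.const ε) (baseExpr.pow (d + 1))

/-- The position of the entry of the recurrence that a shift refers to. -/
def shiftExpr (d ε : ℕ) (plus minus : List ℕ) : IExpr :=
  .add (startExpr d ε) (.sub (.add (.sub .pos (startExpr d ε)) (codeExpr plus))
    (.add (baseExpr.pow d) (codeExpr minus)))

/-- The position of the coefficient of a shift. -/
def coeffExpr (d ε e : ℕ) : IExpr :=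
  .add (.mul (.const e) (baseExpr.pow (d + 1))) (.sub .pos (startExpr d ε))

/-- Blocks for the recurrence. -/
def recSegs (d ε : ℕ) (plus minus : ℕ → List ℕ) : List Seg :=
  [⟨baseExpr.pow d, [(1, [])]⟩,
    ⟨.sub (baseExpr.pow (d + 1)) (baseExpr.pow d), (List.range ε).map fun e =>
      (1, [.read (shiftExpr d ε (plus e) (minus e)), .read (coeffExpr d ε e)])⟩]

theorem endPos_recSegs (n x d ε : ℕ) (plus minus : ℕ → List ℕ) :
    endPos n x (recSegs d ε plus minus) = x + (n + 3) ^ (d + 1) := by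
  have := Nat.pow_le_pow_right (show 0 < n + 3 by omega) (show d ≤ d + 1 by omega)
  simp only [recSegs, endPos, IExpr.eval, IExpr.eval_pow, eval_baseExpr]
  omega

/-- In each product the entry of the recurrence, which can be large, is read first and the
coefficient, which lies in `S`, second. This is the order that a tame product demands. -/
theorem segsValid_recSegs {S : R → Prop} {q n d ε : ℕ} {V F : ℕ → R} {r : ℕ → ℕ → R}
    {plus minus : ℕ → List ℕ} (h1 : S 1)
    (hplus : ∀ e < ε, codeSum n (plus e) < (n + 3) ^ d)
    (hr : ∀ e < ε, ∀ i < (n + 3) ^ (d + 1), F (e * (n + 3) ^ (d + 1) + i) = r e i ∧ S (r e i))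
    (hF : ∀ i < (n + 3) ^ (d + 1), F (ε * (n + 3) ^ (d + 1) + i) = shiftRec ((n + 3) ^ d) ε r
      (fun e => codeSum n (plus e)) (fun e => codeSum n (minus e)) i) :
    SegsValid S q V F n (ε * (n + 3) ^ (d + 1)) (recSegs d ε plus minus) := by
  have hp := Nat.pow_le_pow_right (show 0 < n + 3 by omega) (show d ≤ d + 1 by omega)
  have hpos : 0 < (n + 3) ^ d := by positivity
  refine ⟨fun i hi => ⟨?_, ?_⟩, fun i hi => ⟨?_, ?_⟩, trivial⟩
  · intro t ht
    obtain rfl := List.mem_singleton.1 ht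
    exact ⟨by simpa, by simp, by simp⟩
  · simp only [IExpr.eval_pow, eval_baseExpr] at hi
    rw [hF i (by omega), shiftRec_of_lt hi]
    simp [rhsVal, termVal]
  all_goals
    simp only [IExpr.eval_pow, eval_baseExpr, IExpr.eval] at hi
    simp only [IExpr.eval_pow, eval_baseExpr]
    rw [add_assoc]
    set X := (n + 3) ^ d + i with hX
    set N := (n + 3) ^ (d + 1) with hN
  · intro t ht
    obtain ⟨e, he, rfl⟩ := List.mem_map.1 ht
    rw [List.mem_range] at he
    have hc := hplus e he
    have hlt : (e + 1) * N ≤ ε * N := Nat.mul_le_mul_right _ he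
    refine ⟨by simpa, ?_, ?_⟩
    · simp only [List.tail_cons, List.mem_singleton, forall_eq, Src.val, coeffExpr, startExpr,
        IExpr.eval, IExpr.eval_pow, eval_baseExpr, ← hN, Nat.add_sub_cancel_left]
      rw [(hr e he X (by omega)).1]
      exact (hr e he X (by omega)).2
    · simp only [List.mem_cons, List.not_mem_nil, or_false, forall_eq_or_imp, forall_eq,
        Src.Legal, coeffExpr, shiftExpr, startExpr, IExpr.eval, IExpr.eval_pow, eval_baseExpr,
        ← hN, Nat.add_sub_cancel_left, eval_codeExpr]
      rw [add_mul, one_mul] at hlt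
      exact ⟨by omega, by omega⟩
  · rw [hF X (by omega), shiftRec_of_le (by omega) hpos (fun e he => hplus e he), rhsVal,
      List.map_map]
    change _ = ∑ e ∈ Finset.range ε, _
    refine Finset.sum_congr rfl fun e he => ?_
    rw [Finset.mem_range] at he
    have hc := hplus e he
    simp only [Function.comp_def, termVal, List.map_cons, List.map_nil, List.prod_cons,
      List.prod_nil, Src.val, coeffExpr, shiftExpr, startExpr, IExpr.eval, IExpr.eval_pow,
      eval_baseExpr, ← hN, Nat.add_sub_cancel_left, eval_codeExpr]
    rw [(hr e he X (by omega)).1, hF _ (by omega)]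
    push_cast
    ring

/-- Blocks that multiply an entry of the stream by the factorial of the domain size. -/
def factorialSegs (e : IExpr) : List Seg :=
  [⟨.const 1, []⟩, ⟨.size, [(1, [.read (.sub .pos (.const 1))]), (1, [])]⟩,
    ⟨.const 1, [(1, [.read e])]⟩,
    ⟨.size, [(1, [.read (.sub .pos (.const 1)),
      .read (.sub .pos (.add .size (.const 1)))])]⟩]

theorem endPos_factorialSegs (n x : ℕ) (e : IExpr) :
    endPos n x (factorialSegs e) = x + (2 * n + 1) + 1 := by
  simp only [factorialSegs, endPos, IExpr.eval]
  omega

/-- The blocks write `0, 1, …, n`, then a copy of the chosen entry, then its products with `1, 2, …,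
n` in turn. The multiplier is always found `n + 1` positions back, and these integers are the small
factors. -/
theorem segsValid_factorialSegs {S : R → Prop} {q n x : ℕ} {V F : ℕ → R} {e : IExpr}
    (h1 : S 1) (hS : ∀ i ≤ n, S (i : R)) (he : ∃ y < x, ∀ x', e.eval n x' = y ∧ F y = F (x + n + 1))
    (hF₁ : ∀ i ≤ n, F (x + i) = i) (hF₂ : ∀ i ≤ n, F (x + n + 1 + i) = F (x + n + 1) * i.factorial) :
    SegsValid S q V F n x (factorialSegs e) := by
  obtain ⟨y, hy, hxy⟩ := he
  refine ⟨fun i hi => ⟨by simp, ?_⟩, fun i hi => ⟨?_, ?_⟩, fun i hi => ⟨?_, ?_⟩,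
    fun i hi => ⟨?_, ?_⟩, trivial⟩ <;> simp only [IExpr.eval] at hi ⊢
  · obtain rfl : i = 0 := by omega
    rw [hF₁ 0 (by omega)]
    simp [rhsVal]
  · simp only [List.mem_cons, List.not_mem_nil, or_false, forall_eq_or_imp, forall_eq]
    refine ⟨⟨by simpa, by simp, ?_⟩, ⟨by simpa, by simp, by simp⟩⟩
    simp only [List.mem_cons, List.not_mem_nil, or_false, forall_eq, Src.Legal, IExpr.eval]
    omega
  · rw [add_assoc, hF₁ _ (by omega)]
    simp only [rhsVal, termVal, List.map_cons, List.map_nil, Src.val, IExpr.eval, List.prod_cons,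
      List.prod_nil, List.sum_cons, List.sum_nil]
    rw [show x + (1 + i) - 1 = x + i by omega, hF₁ _ (by omega)]
    push_cast
    ring
  · simp only [List.mem_cons, List.not_mem_nil, or_false, forall_eq]
    refine ⟨by simpa, by simp, ?_⟩
    simp only [List.mem_cons, List.not_mem_nil, or_false, forall_eq, Src.Legal, (hxy _).1]
    omega
  · obtain rfl : i = 0 := by omega
    simp only [rhsVal, termVal, List.map_cons, List.map_nil, Src.val, List.prod_cons,
      List.prod_nil, List.sum_cons, List.sum_nil, (hxy _).1, (hxy 0).2]
    rw [show x + 1 + n + 0 = x + n + 1 by omega]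
    push_cast
    ring
  · simp only [List.mem_cons, List.not_mem_nil, or_false, forall_eq]
    refine ⟨by simpa, ?_, ?_⟩
    · simp only [List.tail_cons, List.mem_singleton, forall_eq, Src.val, IExpr.eval]
      rw [show x + 1 + n + 1 + i - (n + 1) = x + (i + 1) by omega, hF₁ _ (by omega)]
      exact hS _ (by omega)
    · simp only [List.mem_cons, List.not_mem_nil, or_false, forall_eq_or_imp, forall_eq, Src.Legal,
        IExpr.eval]
      omega
  · simp only [rhsVal, termVal, List.map_cons, List.map_nil, Src.val, IExpr.eval, List.prod_cons,
      List.prod_nil, List.sum_cons, List.sum_nil]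
    rw [show x + 1 + n + 1 + i - (n + 1) = x + (i + 1) by omega, hF₁ _ (by omega),
      show x + 1 + n + 1 + i = x + n + 1 + (i + 1) by omega, hF₂ _ (by omega),
      show x + n + 1 + (i + 1) - 1 = x + n + 1 + i by omega, hF₂ _ (by omega), Nat.factorial_succ]
    push_cast
    ring

/-- Blocks that multiply the last entry of the stream by powers of polynomials. -/
def powerSegs (f : ℕ → InputPoly) (b : ℕ → IExpr) (π : ℕ) : List Seg :=
  (List.range π).map fun p => ⟨b p, (f p).mulTerms (.sub .pos (.const 1))⟩

theorem exists_valid_powerSegs {S : R → Prop} {q n x π : ℕ} {V F : ℕ → R} {l : List Seg}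
    {f : ℕ → InputPoly} {b : ℕ → IExpr} {β : ℕ → ℕ} (hb : ∀ p < π, ∀ x, (b p).eval n x = β p)
    (hf : ∀ p < π, (f p).Good S q V) (hl : SegsValid S q V F n 0 l) (hx : endPos n 0 l = x + 1) :
    ∃ F' x', SegsValid S q V F' n 0 (l ++ powerSegs f b π) ∧
      endPos n 0 (l ++ powerSegs f b π) = x' + 1 ∧
      F' x' = F x * ∏ p ∈ Finset.range π, (f p).val V ^ β p := by
  induction π with
  | zero => exact ⟨F, x, by simpa [powerSegs], by simpa [powerSegs], by simp⟩
  | succ π ih =>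
    obtain ⟨F₁, y, h₁, h₂, h₃⟩ := ih (fun p hp => hb p (by omega)) (fun p hp => hf p (by omega))
    have hsucc : l ++ powerSegs f b (π + 1) = (l ++ powerSegs f b π) ++
        [⟨b π, (f π).mulTerms (.sub .pos (.const 1))⟩] := by
      simp [powerSegs, List.range_succ]
    -- Past `y` the stream is replaced by a geometric progression with ratio `(f π).val V`; the
    -- equations up to `y` are unaffected.
    set F₂ : ℕ → R := fun a => if a ≤ y then F₁ a else F₁ y * (f π).val V ^ (a - y) with hF₂
    have hF₂y : ∀ i, F₂ (y + i) = F₁ y * (f π).val V ^ i := by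
      intro i
      rcases i with - | i
      · simp [hF₂]
      · simp only [hF₂]
        rw [if_neg (by omega), Nat.add_sub_cancel_left]
    refine ⟨F₂, y + β π, ?_, ?_, ?_⟩
    · rw [hsucc, segsValid_append, h₂]
      refine ⟨h₁.congr fun a ha => ?_, fun i hi => ⟨(hf π (by omega)).mulTerms ?_, ?_⟩, trivial⟩
      · simp only [hF₂]
        rw [if_pos (by omega)]
      · simp only [IExpr.eval]; omega
      · rw [InputPoly.rhsVal_mulTerms]
        simp only [IExpr.eval]
        rw [show y + 1 + i - 1 = y + i by omega, add_assoc, hF₂y, hF₂y]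
        ring
    · rw [hsucc, endPos_append, h₂]
      simp only [endPos, hb π (by omega)]
      omega
    · rw [hF₂y, h₃, Finset.prod_range_succ, mul_assoc]

open Polynomial in
/-- A program for a recurrence over counter vectors, multiplied by a factorial and by powers of
polynomials. -/
theorem exists_counter_program (q ε d π j₀ : ℕ) (hj₀ : j₀ < d) (α : ℕ → InputPoly)
    (ρ : ℕ → ℕ → InputPoly) (plus minus : ℕ → List ℕ) (f : ℕ → InputPoly) (b : ℕ → IExpr)
    (β : ℕ → ℕ → ℕ) (hb : ∀ p < π, ∀ n x, (b p).eval n x = β p n)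
    (hplus : ∀ n, ∀ e < ε, codeSum n (plus e) < (n + 3) ^ d) :
    ∃ (prog : Prog) (T : ℕ[X]), ∀ {R : Type} [CommRing R] {S : R → Prop} {n : ℕ} {s : State R},
      s.idx 0 = n → s.idx 1 = 0 → S 0 → S 1 → (∀ i ≤ n, S (i : R)) →
      (∀ e < ε, (α e).Good S q s.num) → (∀ e < ε, ∀ j < d, (ρ e j).Good S q s.num) →
      (∀ p < π, (f p).Good S q s.num) →
      (∀ e < ε, ∀ i < (n + 3) ^ (d + 1),
        S (rate (n + 3) d ((α e).val s.num) (fun j => (ρ e j).val s.num) i)) →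
      ∃ c ≤ T.eval n, ∃ s', Run S prog s c s' ∧ s'.num 0 =
        shiftRec ((n + 3) ^ d) ε
          (fun e => rate (n + 3) d ((α e).val s.num) (fun j => (ρ e j).val s.num))
          (fun e => codeSum n (plus e)) (fun e => codeSum n (minus e))
          ((n + 1) * (n + 3) ^ d + (n + 3) ^ j₀) * n.factorial *
        ∏ p ∈ Finset.range π, (f p).val s.num ^ β p n := by
  set out : IExpr := .add (startExpr d ε) (.add (.mul (.add .size (.const 1)) (baseExpr.pow d))
    (baseExpr.pow j₀)) with hout
  set l := tableSegs d α ρ ε ++ recSegs d ε plus minus ++ factorialSegs out with hldef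
  obtain ⟨prog, T, H⟩ := exists_stream_program q (l ++ powerSegs f b π)
  refine ⟨prog, T, ?_⟩
  intro R _ S n s h0 h1 hS0 hS1 hSn hα hρ hf hr
  set N := (n + 3) ^ (d + 1) with hN
  set r : ℕ → ℕ → R := fun e => rate (n + 3) d ((α e).val s.num) (fun j => (ρ e j).val s.num)
    with hrdef
  set G := shiftRec ((n + 3) ^ d) ε r (fun e => codeSum n (plus e)) (fun e => codeSum n (minus e))
    with hG
  -- The top digit is the number of steps left, one for choosing a parameter and `n` for the
  -- letters; digit `j₀` marks the initial control state.
  set y := (n + 1) * (n + 3) ^ d + (n + 3) ^ j₀ with hy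
  have hyN : y < N := by
    have : (n + 3) ^ j₀ ≤ (n + 3) ^ d := Nat.pow_le_pow_right (by omega) hj₀.le
    have hpos : 0 < (n + 3) ^ d := by positivity
    rw [hN, pow_succ, hy]
    nlinarith
  have hNpos : 0 < N := by positivity
  set c := (ε + 1) * N with hc
  have hc' : c = ε * N + N := by rw [hc, add_mul, one_mul]
  -- Layout of the stream: `ε` tables of rates, the table of the recurrence, the integers up to `n`,
  -- and the partial factorial multiples of the answer.
  set F : ℕ → R := fun a => if a < ε * N then r (a / N) (a % N)
    else if a < c then G (a - ε * N)
    else if a ≤ c + n then ((a - c : ℕ) : R)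
    else G y * (a - (c + n + 1)).factorial with hF
  have hF₁ : ∀ e < ε, ∀ i < N, F (e * N + i) = r e i := by
    intro e he i hi
    have : (e + 1) * N ≤ ε * N := Nat.mul_le_mul_right _ he
    rw [add_mul, one_mul] at this
    simp only [hF]
    rw [if_pos (by omega), mul_comm e, Nat.mul_add_div hNpos, Nat.mul_add_mod,
      Nat.div_eq_of_lt hi, Nat.mod_eq_of_lt hi, add_zero]
  have hF₂ : ∀ i < N, F (ε * N + i) = G i := by
    intro i hi
    simp only [hF]
    rw [if_neg (by omega), if_pos (by omega), Nat.add_sub_cancel_left]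
  have hF₃ : ∀ i ≤ n, F (c + i) = i := by
    intro i hi
    simp only [hF]
    rw [if_neg (by omega), if_neg (by omega), if_pos (by omega), Nat.add_sub_cancel_left]
  have hF₄ : ∀ i, F (c + n + 1 + i) = G y * i.factorial := by
    intro i
    simp only [hF]
    rw [if_neg (by omega), if_neg (by omega), if_neg (by omega), Nat.add_sub_cancel_left]
  have hend : endPos n 0 (tableSegs d α ρ ε ++ recSegs d ε plus minus) = c := by
    rw [endPos_append, endPos_tableSegs, endPos_recSegs, hc']
  have hF₅ : F (c + n + 1) = G y := by simpa using hF₄ 0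
  obtain ⟨F', x', h₁, h₂, h₃⟩ := exists_valid_powerSegs (S := S) (q := q) (n := n)
    (x := c + (2 * n + 1)) (V := s.num) (F := F) (l := l) (f := f) (b := b)
    (β := fun p => β p n) (fun p hp x => hb p hp n x) hf
    (by
      rw [hldef, segsValid_append, segsValid_append, hend, endPos_tableSegs]
      refine ⟨⟨segsValid_tableSegs hS1 hα hρ hF₁, segsValid_recSegs (r := r) hS1 (hplus n)
        (fun e he i hi => ⟨hF₁ e he i hi, hr e he i hi⟩) hF₂⟩,
        segsValid_factorialSegs hS1 hSn ⟨ε * N + y, by omega, fun x' => ⟨?_, ?_⟩⟩ hF₃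
          fun i _ => by rw [hF₄, hF₅]⟩
      · simp only [hout, startExpr, IExpr.eval, IExpr.eval_pow, eval_baseExpr, hN, hy]
      · rw [hF₂ y hyN, hF₅])
    (by rw [hldef, endPos_append, hend, endPos_factorialSegs])
  obtain ⟨k, hk, s', hrun, hs'⟩ := H hS0 h0 h1 h₁ h₂
  refine ⟨k, hk, s', hrun, ?_⟩
  rw [hs', h₃, show c + (2 * n + 1) = c + n + 1 + n by omega, hF₄]

end Counter

end WFOMC

namespace WFOMC

/-! ### Sums over sequences with memory -/

section Digits

theorem sum_digits_lt (M : ℕ) (f : ℕ → ℕ) (hf : ∀ i, f i < M) (d : ℕ) :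
    ∑ i ∈ Finset.range d, f i * M ^ i < M ^ d := by
  induction d with
  | zero => simp
  | succ d ih =>
    rw [Finset.sum_range_succ, pow_succ]
    have : (f d + 1) * M ^ d ≤ M * M ^ d := Nat.mul_le_mul_right _ (hf d)
    rw [add_mul, one_mul] at this
    rw [mul_comm (M ^ d)]
    omega

theorem digit_sum (M : ℕ) (f : ℕ → ℕ) (hf : ∀ i, f i < M) {d j : ℕ} (hj : j < d) (t : ℕ) :
    (t * M ^ d + ∑ i ∈ Finset.range d, f i * M ^ i) / M ^ j % M = f j := by
  have hM : 0 < M := (Nat.zero_le _).trans_lt (hf 0)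
  induction d generalizing t with
  | zero => omega
  | succ d ih =>
    -- The leading digit merges with `t`, which is why `t` is arbitrary in the induction.
    have h : t * M ^ (d + 1) + ∑ i ∈ Finset.range (d + 1), f i * M ^ i =
        (t * M + f d) * M ^ d + ∑ i ∈ Finset.range d, f i * M ^ i := by
      rw [Finset.sum_range_succ]
      ring
    rw [h]
    rcases Nat.lt_succ_iff_lt_or_eq.1 hj with hj | rfl
    · exact ih hj _
    · rw [mul_comm _ (M ^ j), Nat.mul_add_div (by positivity),
        Nat.div_eq_of_lt (sum_digits_lt M f hf j), add_zero, mul_comm t, Nat.mul_add_mod,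
        Nat.mod_eq_of_lt (hf j)]

theorem sum_map_eq_sum_count {R : Type} [AddCommMonoid R] {d : ℕ} (g : ℕ → R) (l : List ℕ)
    (hl : ∀ j ∈ l, j < d) : (l.map g).sum = ∑ j ∈ Finset.range d, l.count j • g j := by
  rw [Finset.sum_list_map_count]
  refine Finset.sum_subset (fun j hj => ?_) fun j _ hj => ?_
  · exact Finset.mem_range.2 (hl j (List.mem_toFinset.1 hj))
  · rw [List.count_eq_zero_of_not_mem (fun h => hj (List.mem_toFinset.2 h)), zero_smul]

/-- A list shorter than the base has all multiplicities below it, so the sum of place values has no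
carries and its digits are exactly the multiplicities. -/
theorem rate_code {R : Type} [CommRing R] {n d : ℕ} (α : R) (ρ : ℕ → R) {l : List ℕ}
    (hl : ∀ j ∈ l, j < d) (hn : l.length < n + 3) (t : ℕ) :
    rate (n + 3) d α ρ (t * (n + 3) ^ d + codeSum n l) = α * (l.map ρ).prod := by
  rw [codeSum, sum_map_eq_sum_count (d := d) _ l hl, rate, Finset.prod_list_map_count]
  congr 1
  have : ∀ j ∈ Finset.range d, ρ j ^ ((t * (n + 3) ^ d +
      ∑ j ∈ Finset.range d, l.count j • (n + 3) ^ j) / (n + 3) ^ j % (n + 3)) =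
      ρ j ^ l.count j := by
    intro j hj
    simp only [smul_eq_mul]
    rw [digit_sum (n + 3) (fun j => l.count j) (fun j => List.count_le_length.trans_lt hn)
      (Finset.mem_range.1 hj)]
  rw [Finset.prod_congr rfl this]
  symm
  refine Finset.prod_subset (fun j hj => ?_) fun j _ hj => ?_
  · exact Finset.mem_range.2 (hl j (List.mem_toFinset.1 hj))
  · rw [List.count_eq_zero_of_not_mem (fun h => hj (List.mem_toFinset.2 h)), pow_zero]

theorem codeSum_cons (n j : ℕ) (l : List ℕ) : codeSum n (j :: l) = (n + 3) ^ j + codeSum n l := by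
  simp [codeSum]

theorem codeSum_append (n : ℕ) (l l' : List ℕ) :
    codeSum n (l ++ l') = codeSum n l + codeSum n l' := by
  simp [codeSum]

end Digits

/-! ### Sums over words as iterated extensions of a history -/

section Path

variable {R : Type} [CommRing R] {C : Type}

/-- The weight of the pairs of a new element `c` with the elements of a history, listed from the
most recent one, where `s` elements lie between `c` and the history. -/
def historyWeight (K : ℕ) (r : ℕ → C → C → R) : ℕ → List C → C → R
  | _, [], _ => 1
  | s, x :: h, c => r (min (s + 1) K) x c * historyWeight K r (s + 1) h c

/-- The first `K - s` entries of the history are close enough for their exact distance to matter;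
every later one interacts at the capped distance `K`. The later entries hence matter only through
the multiset they form, which is what makes counters sufficient. -/
theorem historyWeight_eq (K : ℕ) (r : ℕ → C → C → R) (s : ℕ) (h : List C) (c : C) :
    historyWeight K r s h c = (∏ i ∈ Finset.range (K - s),
      (h[i]?).elim 1 fun x => r (s + i + 1) x c) * ((h.drop (K - s)).map fun x => r K x c).prod := by
  induction h generalizing s with
  | nil => simp [historyWeight]
  | cons x h ih =>
    rw [historyWeight, ih]
    rcases lt_or_ge s K with hs | hs
    · obtain ⟨m, rfl⟩ : ∃ m, K = s + 1 + m := ⟨K - s - 1, by omega⟩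
      rw [show s + 1 + m - s = m + 1 by omega, Finset.prod_range_succ', Nat.add_sub_cancel_left,
        min_eq_left (by omega)]
      simp only [List.getElem?_cons_succ, List.getElem?_cons_zero, Option.elim_some,
        List.drop_succ_cons, add_zero, show ∀ i, s + 1 + i + 1 = s + (i + 1) + 1 by omega]
      ring
    · rw [show K - s = 0 by omega, show K - (s + 1) = 0 by omega, min_eq_right (by omega)]
      simp

/-- The total weight of all sequences of length `t` that continue a history. -/
def continuation [Fintype C] (K : ℕ) (u : C → R) (r : ℕ → C → C → R) : ℕ → List C → R
  | 0, _ => 1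
  | t + 1, h => ∑ c, u c * historyWeight K r 0 h c * continuation K u r t (c :: h)

/-- The history has to be general because each new letter joins it. Splitting off the first letter
of a word moves its interactions from the product over pairs into the history weights of the later
letters. -/
theorem continuation_eq [Fintype C] (K : ℕ) (u : C → R) (r : ℕ → C → C → R) (t : ℕ) (h : List C) :
    continuation K u r t h = ∑ c : Fin t → C, ∏ a, (u (c a) * historyWeight K r a h (c a) *
      ∏ i, if i < a then r (min (a - i : ℕ) K) (c i) (c a) else 1) := by
  induction t generalizing h with
  | zero => simp [continuation]
  | succ t ih =>
    rw [continuation, ← (Fin.consEquiv fun _ => C).sum_comp, Fintype.sum_prod_type]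
    refine Finset.sum_congr rfl fun c₀ _ => ?_
    rw [ih, Finset.mul_sum]
    refine Finset.sum_congr rfl fun c _ => ?_
    simp only [Fin.consEquiv, Equiv.coe_fn_mk]
    rw [Fin.prod_univ_succ]
    congr 1
    · simp
    · refine Finset.prod_congr rfl fun a _ => ?_
      rw [Fin.prod_univ_succ]
      simp only [Fin.cons_succ, Fin.cons_zero, Fin.succ_pos, if_true, Fin.succ_lt_succ_iff,
        Fin.val_succ, Fin.val_zero, historyWeight, Nat.add_sub_add_right, Nat.sub_zero]
      ring

/-- The weighted sum over sequences of length `n` in which every pair of entries interacts,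
depending on the distance up to `K`. -/
def chainSum [Fintype C] (K : ℕ) (u : C → R) (r : ℕ → C → C → R) (n : ℕ) : R :=
  ∑ c : Fin n → C, (∏ a, u (c a)) *
    ∏ a : Fin n, ∏ i : Fin n, if i < a then r (min (a - i : ℕ) K) (c i) (c a) else 1

theorem continuation_nil [Fintype C] (K : ℕ) (u : C → R) (r : ℕ → C → C → R) (n : ℕ) :
    continuation K u r n [] = chainSum K u r n := by
  rw [continuation_eq, chainSum]
  refine Finset.sum_congr rfl fun c _ => ?_
  simp only [historyWeight, mul_one, Finset.prod_mul_distrib]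

end Path

end WFOMC

namespace WFOMC

/-! ### Sequence sums as recurrences over counter vectors -/

section Encode

/-- The most recent `k + 1` entries of a history. -/
abbrev Window (k : ℕ) (C : Type) : Type := Fin (k + 1) → Option C

/-- The window of a history. -/
def window (k : ℕ) {C : Type} (h : List C) : Window k C := fun i => h[(i : ℕ)]?

theorem window_cons (k : ℕ) {C : Type} (c : C) (h : List C) :
    window k (c :: h) = Fin.cons (some c) (Fin.init (window k h)) := by
  ext1 i
  refine Fin.cases ?_ (fun i => ?_) i
  · simp [window]
  · simp [window, Fin.init]

/-- Counters: the numbers of entries of each kind before the window, and a control state. -/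
abbrev Counter (k : ℕ) (Z C : Type) : Type := C ⊕ Option (Z × Window k C)

/-- Transitions: choose a parameter, or append an entry. -/
abbrev Transition (k : ℕ) (Z C : Type) : Type := Z ⊕ (Z × Window k C × C)

variable {k : ℕ} {Z C : Type}

/-- The control state in which a transition is possible. -/
def Transition.src : Transition k Z C → Option (Z × Window k C)
  | .inl _ => none
  | .inr (ν, w, _) => some (ν, w)

/-- The counters that a transition increases. -/
def Transition.plus : Transition k Z C → List (Counter k Z C)
  | .inl ν => [.inr (some (ν, window k []))]
  | .inr (ν, w, c) => .inr (some (ν, Fin.cons (some c) (Fin.init w))) ::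
      (w (Fin.last k)).toList.map .inl

/-- The weight of a transition, apart from the entries before the window. -/
def Transition.weight {R : Type} [CommRing R] (g : Z → R) (u : Z → C → R)
    (r : Z → ℕ → C → C → R) : Transition k Z C → R
  | .inl ν => g ν
  | .inr (ν, w, c) => u ν c * ∏ i : Fin (k + 1), (w i).elim 1 fun x => r ν (i + 1) x c

open Classical in
/-- The factor of the weight of a transition for every unit of a counter. -/
noncomputable def Transition.factor {R : Type} [CommRing R] (r : Z → ℕ → C → C → R) :
    Transition k Z C → Counter k Z C → R
  | e, .inr q => if q = e.src then 1 else 0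
  | .inl _, .inl _ => 1
  | .inr (ν, _, c), .inl x => r ν (k + 1) x c

/-- The counters of a history. -/
def historyCounters (k : ℕ) (ν : Z) (h : List C) : List (Counter k Z C) :=
  .inr (some (ν, window k h)) :: (h.drop (k + 1)).map .inl

/-- Appending a letter shifts the window: its oldest entry, if there is one, becomes a counted entry
and the control state changes. The removed control unit is added on the left to avoid truncated
subtraction. -/
theorem codeSum_historyCounters_cons (n : ℕ) (J : Counter k Z C → ℕ) (ν : Z) (c : C) (h : List C) :
    codeSum n ((historyCounters k ν (c :: h)).map J) +
        codeSum n [J (.inr (some (ν, window k h)))] =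
      codeSum n ((historyCounters k ν h).map J) +
        codeSum n ((Transition.plus (.inr (ν, window k h, c))).map J) := by
  -- The last window slot is empty exactly when the history has at most `k` entries, and then
  -- nothing is left to count either.
  have hdrop : h.drop k = ((window k h) (Fin.last k)).toList ++ h.drop (k + 1) := by
    simp only [window, Fin.val_last]
    rcases lt_or_ge k h.length with hk | hk
    · rw [List.drop_eq_getElem_cons hk, List.getElem?_eq_getElem hk]; rfl
    · rw [List.drop_eq_nil_of_le hk, List.drop_eq_nil_of_le (by omega),
        List.getElem?_eq_none hk]; rfl
  simp only [historyCounters, Transition.plus, List.drop_succ_cons, hdrop, List.map_cons,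
    List.map_append, codeSum_cons, codeSum_append, window_cons]
  simp only [codeSum, List.map_nil, List.sum_nil]
  ring

variable {R : Type} [CommRing R]

-- A history carries exactly one control unit. Its factor is `1` if the transition starts in that
-- control state and `0` otherwise, so applicability of a transition is encoded in the rate itself.
open Classical in
theorem prod_factor_historyCounters (r : Z → ℕ → C → C → R) (ν : Z) (h : List C)
    (e : Transition k Z C) :
    ((historyCounters k ν h).map (e.factor r)).prod =
      if some (ν, window k h) = e.src then ((h.drop (k + 1)).map fun x => e.factor r (.inl x)).prod
      else 0 := by
  simp only [historyCounters, List.map_cons, List.prod_cons, List.map_map, Function.comp_def]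
  rw [Transition.factor]
  split_ifs <;> simp [List.map_drop]

/-- The window accounts for the exact distances up to `k + 1` and the counters for everything
farther away, as in `historyWeight_eq`. -/
theorem weight_mul_prod_factor (g : Z → R) (u : Z → C → R) (r : Z → ℕ → C → C → R) (ν : Z)
    (h : List C) (c : C) :
    Transition.weight g u r (.inr (ν, window k h, c)) *
      ((h.drop (k + 1)).map fun x =>
        Transition.factor r (.inr (ν, window k h, c)) (.inl x)).prod =
      u ν c * historyWeight (k + 1) (r ν) 0 h c := by
  rw [historyWeight_eq, Nat.sub_zero, Finset.prod_range, Transition.weight, mul_assoc]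
  simp only [Transition.factor, window, zero_add]

variable [Fintype Z] [Fintype C] {d ε : ℕ}

open Classical in
theorem sum_eq_of_src (ν : Z) (w : Window k C) (f : Transition k Z C → R) :
    (∑ e, if some (ν, w) = Transition.src e then f e else 0) = ∑ c, f (.inr (ν, w, c)) := by
  rw [Fintype.sum_sum_type]
  simp only [Transition.src, reduceCtorEq, if_false, Finset.sum_const_zero, zero_add,
    Fintype.sum_prod_type, Option.some.injEq, Prod.mk.injEq]
  rw [Finset.sum_eq_single ν, Finset.sum_eq_single w]
  · simp
  · intro w' _ hw; simp [hw.symm]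
  · simp
  · intro ν' _ hν; simp [hν.symm]
  · simp

open Classical in
theorem sum_eq_of_src_none (f : Transition k Z C → R) :
    (∑ e, if none = Transition.src e then f e else 0) = ∑ ν, f (.inl ν) := by
  simp [Transition.src]

-- The argument stores the remaining steps `t` in the top digit and the counters below it. A
-- transition subtracts one top unit and one control unit and adds its `plus` counters. The
-- condition `h.length + t ≤ n` keeps every counter below the base throughout.
open Classical in
theorem shiftRec_historyCounters (g : Z → R) (u : Z → C → R) (r : Z → ℕ → C → C → R)
    (n : ℕ) (J : Counter k Z C ≃ Fin d) (E : Transition k Z C ≃ Fin ε)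
    (α : ℕ → R) (ρ : ℕ → ℕ → R) (dp dm : ℕ → ℕ)
    (hα : ∀ e, α (E e) = e.weight g u r) (hρ : ∀ e j, ρ (E e) (J j) = e.factor r j)
    (hdp : ∀ e, dp (E e) = codeSum n (e.plus.map fun j => (J j : ℕ)))
    (hdm : ∀ e : Transition k Z C, dm (E e) = codeSum n [(J (.inr e.src) : ℕ)])
    (hlt : ∀ e < ε, dp e < (n + 3) ^ d) (ν : Z) (t : ℕ) (h : List C) (ht : h.length + t ≤ n) :
    shiftRec ((n + 3) ^ d) ε (fun e => rate (n + 3) d (α e) (ρ e)) dp dm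
      (t * (n + 3) ^ d + codeSum n ((historyCounters k ν h).map fun j => (J j : ℕ))) =
      continuation (k + 1) (u ν) (r ν) t h := by
  have hlen : ∀ h : List C, ((historyCounters k ν h).map fun j => (J j : ℕ)).length ≤
      h.length + 1 := by
    intro h; simp [historyCounters]
  have hlt' : ∀ l : List (Counter k Z C), ∀ j ∈ l.map (fun j => (J j : ℕ)), j < d := by
    intro l j hj
    obtain ⟨j', -, rfl⟩ := List.mem_map.1 hj
    exact (J j').2
  have hpos : 0 < (n + 3) ^ d := by positivity
  induction t generalizing h with
  | zero =>
    rw [zero_mul, zero_add, shiftRec_of_lt, continuation]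
    rw [codeSum, sum_map_eq_sum_count _ _ (hlt' _)]
    exact sum_digits_lt (n + 3) (fun j => List.count j _)
      (fun j => List.count_le_length.trans_lt ((hlen h).trans_lt (by omega))) d
  | succ t ih =>
    rw [shiftRec_of_le (by rw [add_mul, one_mul]; omega) hpos hlt, Finset.sum_range,
      ← E.sum_comp, continuation]
    -- Transitions from other control states would be evaluated at meaningless, possibly truncated
    -- arguments, but their rate is zero.
    have key : ∀ e : Transition k Z C,
        rate (n + 3) d (α (E e)) (ρ (E e)) ((t + 1) * (n + 3) ^ d +
          codeSum n ((historyCounters k ν h).map fun j => (J j : ℕ))) =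
        if some (ν, window k h) = e.src then e.weight g u r *
          ((h.drop (k + 1)).map fun x => e.factor r (.inl x)).prod else 0 := by
      intro e
      rw [rate_code _ _ (hlt' _) ((hlen h).trans_lt (by omega)), List.map_map, hα]
      simp only [Function.comp_def, hρ]
      rw [prod_factor_historyCounters]
      split_ifs <;> simp
    simp only [key, ite_mul, zero_mul]
    rw [sum_eq_of_src]
    refine Finset.sum_congr rfl fun c _ => ?_
    rw [weight_mul_prod_factor, ← ih (c :: h) (by simp only [List.length_cons]; omega), hdp, hdm]
    congr 2
    have := codeSum_historyCounters_cons n (fun j => (J j : ℕ)) ν c h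
    simp only [Transition.src]
    rw [add_mul, one_mul]
    omega

-- The first step leaves the control state `none` by choosing `ν` with weight `g ν` and enters the
-- empty history with `n` steps to go.
open Classical in
theorem shiftRec_eq_sum_chainSum (g : Z → R) (u : Z → C → R) (r : Z → ℕ → C → C → R)
    (n : ℕ) (J : Counter k Z C ≃ Fin d) (E : Transition k Z C ≃ Fin ε)
    (α : ℕ → R) (ρ : ℕ → ℕ → R) (dp dm : ℕ → ℕ)
    (hα : ∀ e, α (E e) = e.weight g u r) (hρ : ∀ e j, ρ (E e) (J j) = e.factor r j)
    (hdp : ∀ e, dp (E e) = codeSum n (e.plus.map fun j => (J j : ℕ)))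
    (hdm : ∀ e : Transition k Z C, dm (E e) = codeSum n [(J (.inr e.src) : ℕ)])
    (hlt : ∀ e < ε, dp e < (n + 3) ^ d) :
    shiftRec ((n + 3) ^ d) ε (fun e => rate (n + 3) d (α e) (ρ e)) dp dm
      ((n + 1) * (n + 3) ^ d + (n + 3) ^ (J (.inr none) : ℕ)) =
      ∑ ν, g ν * chainSum (k + 1) (u ν) (r ν) n := by
  have hpos : 0 < (n + 3) ^ d := by positivity
  have hcode : (n + 3) ^ (J (.inr none) : ℕ) = codeSum n [(J (.inr none) : ℕ)] := by
    simp [codeSum]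
  rw [shiftRec_of_le (by rw [add_mul, one_mul]; omega) hpos hlt, Finset.sum_range, ← E.sum_comp]
  have key : ∀ e : Transition k Z C,
      rate (n + 3) d (α (E e)) (ρ (E e)) ((n + 1) * (n + 3) ^ d +
        (n + 3) ^ (J (.inr none) : ℕ)) =
      if none = e.src then e.weight g u r else 0 := by
    intro e
    rw [hcode, rate_code _ _ (by simp) (by simp), hα]
    simp [hρ, Transition.factor]
  simp only [key, ite_mul, zero_mul]
  rw [sum_eq_of_src_none]
  refine Finset.sum_congr rfl fun ν _ => ?_
  rw [hdp, hdm, ← continuation_nil, ← shiftRec_historyCounters g u r n J E α ρ dp dm hα hρ hdp hdm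
    hlt ν n [] (by simp), Transition.weight]
  congr 2
  simp only [Transition.src, Transition.plus, historyCounters, hcode, List.drop_nil, List.map_nil,
    List.map_cons]
  rw [add_mul, one_mul]
  omega

end Encode

end WFOMC

namespace WFOMC

open Polynomial Filter

/-! ### Programs for sequence sums -/

section Sizes

variable {R : Type} [CommRing R] (𝓕 : SizeFiltration R)

theorem SizeFiltration.eventually {b : ℕ} {x : R} (h : 𝓕.mem b x) :
    ∀ᶠ b in atTop, 𝓕.mem b x :=
  eventually_atTop.2 ⟨b, fun _ hc => 𝓕.mono hc h⟩

theorem SizeFiltration.eventually_int (z : ℤ) : ∀ᶠ b in atTop, 𝓕.mem b (z : R) :=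
  (𝓕.int z).elim fun _ => 𝓕.eventually

theorem SizeFiltration.eventually_add {x y : R} (hx : ∀ᶠ b in atTop, 𝓕.mem b x)
    (hy : ∀ᶠ b in atTop, 𝓕.mem b y) : ∀ᶠ b in atTop, 𝓕.mem b (x + y) := by
  obtain ⟨b, hx, hy⟩ := (hx.and hy).exists
  exact 𝓕.eventually (𝓕.add hx hy)

theorem SizeFiltration.eventually_mul {x y : R} (hx : ∀ᶠ b in atTop, 𝓕.mem b x)
    (hy : ∀ᶠ b in atTop, 𝓕.mem b y) : ∀ᶠ b in atTop, 𝓕.mem b (x * y) := by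
  obtain ⟨b, hx, hy⟩ := (hx.and hy).exists
  exact 𝓕.eventually (𝓕.mul hx hy)

theorem SizeFiltration.mem_pow {b : ℕ} {x : R} (h1 : 𝓕.mem b 1) (hx : 𝓕.mem b x) (k : ℕ) :
    𝓕.mem (b * (k + 1)) (x ^ k) := by
  induction k with
  | zero => simpa
  | succ k ih => rw [pow_succ]; exact 𝓕.mono (by ring_nf; omega) (𝓕.mul ih hx)

theorem SizeFiltration.mem_prod {b c : ℕ} {f : ℕ → R} (h1 : 𝓕.mem b 1) {d : ℕ}
    (hf : ∀ j < d, 𝓕.mem c (f j)) : 𝓕.mem (b + d * c) (∏ j ∈ Finset.range d, f j) := by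
  induction d with
  | zero => simpa
  | succ d ih =>
    rw [Finset.prod_range_succ]
    exact 𝓕.mono (by ring_nf; omega) (𝓕.mul (ih fun j hj => hf j (by omega)) (hf d (by omega)))

/-- The exponents are digits, hence below `n + 3`, and there are only `d` of them; the size stays
linear in `n`. -/
theorem SizeFiltration.mem_rate {b n d : ℕ} {α : R} {ρ : ℕ → R} (h1 : 𝓕.mem b 1)
    (hα : 𝓕.mem b α) (hρ : ∀ j < d, 𝓕.mem b (ρ j)) (X : ℕ) :
    𝓕.mem (b * (d * (n + 3) + 2)) (rate (n + 3) d α ρ X) := by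
  refine 𝓕.mono ?_ (𝓕.mul hα (𝓕.mem_prod (c := b * (n + 3)) h1 fun j hj =>
    𝓕.mono (Nat.mul_le_mul_left _ ?_) (𝓕.mem_pow h1 (hρ j hj) _)))
  · ring_nf; omega
  · exact Nat.mod_lt _ (by omega)

theorem SizeFiltration.mem_nat {b : ℕ} (h0 : 𝓕.mem b 0) (h1 : 𝓕.mem b 1) (i : ℕ) :
    𝓕.mem (b + i) (i : R) := by
  induction i with
  | zero => simpa
  | succ i ih =>
    rw [Nat.cast_succ]
    exact 𝓕.add ih (𝓕.mono (Nat.le_add_right b i) h1)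

theorem InputPoly.eventually_good {q : ℕ} {V : ℕ → R} (hV : ∀ j < q, ∃ b, 𝓕.mem b (V j))
    (f : InputPoly) (hf : ∀ t ∈ f, ∀ j ∈ t.2, j < q) :
    ∀ᶠ b in atTop, f.Good (𝓕.mem b) q V := by
  have hV' : ∀ᶠ b in atTop, ∀ j ∈ Finset.range q, 𝓕.mem b (V j) :=
    (Filter.eventually_all_finset _).2 fun j hj =>
      (hV j (Finset.mem_range.1 hj)).elim fun _ => 𝓕.eventually
  have hc : ∀ l : InputPoly, ∀ᶠ b in atTop, ∀ t ∈ l, 𝓕.mem b (t.1 : R) := by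
    intro l
    induction l with
    | nil => simp
    | cons t l ih => simpa using (𝓕.eventually_int t.1).and ih
  filter_upwards [hV', hc f] with b hb hb'
  exact fun t ht => ⟨hb' t ht, fun j hj => ⟨hf t ht j hj, hb j (Finset.mem_range.2 (hf t ht j hj))⟩⟩

theorem InputPoly.eventually_val {q : ℕ} {V : ℕ → R} (hV : ∀ j < q, ∃ b, 𝓕.mem b (V j))
    (f : InputPoly) (hf : ∀ t ∈ f, ∀ j ∈ t.2, j < q) :
    ∀ᶠ b in atTop, 𝓕.mem b (f.val V) := by
  have hp : ∀ l : List ℕ, (∀ j ∈ l, j < q) → ∀ᶠ b in atTop, 𝓕.mem b (l.map V).prod := by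
    intro l hl
    induction l with
    | nil => simpa using 𝓕.eventually_int 1
    | cons j l ih =>
      rw [List.map_cons, List.prod_cons]
      exact 𝓕.eventually_mul ((hV j (hl j List.mem_cons_self)).elim fun _ => 𝓕.eventually)
        (ih fun i hi => hl i (List.mem_cons_of_mem _ hi))
  induction f with
  | nil => simpa [InputPoly.val] using 𝓕.eventually_int 0
  | cons t f ih =>
    have : InputPoly.val V (t :: f) = t.1 * (t.2.map V).prod + InputPoly.val V f := by
      simp [InputPoly.val]
    rw [this]
    exact 𝓕.eventually_add (𝓕.eventually_mul (𝓕.eventually_int _)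
      (hp t.2 (hf t List.mem_cons_self))) (ih fun s hs => hf s (List.mem_cons_of_mem _ hs))

end Sizes

/-- The list is chosen before the ring. Coefficients can therefore be computed symbolically over the
integers and built into a program that serves every ring and all weights. -/
theorem exists_inputPoly {q : ℕ} (p : MvPolynomial (Fin q) ℤ) : ∃ f : InputPoly,
    (∀ t ∈ f, ∀ j ∈ t.2, j < q) ∧ ∀ {R : Type} [CommRing R] (V : ℕ → R),
      f.val V = MvPolynomial.aeval (fun j : Fin q => V j) p := by
  induction p using MvPolynomial.induction_on with
  | C z => exact ⟨[(z, [])], by simp, fun V => by simp [InputPoly.val]⟩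
  | add p p' h h' =>
    obtain ⟨f, hf, hv⟩ := h
    obtain ⟨f', hf', hv'⟩ := h'
    refine ⟨f ++ f', fun t ht => (List.mem_append.1 ht).elim (hf t) (hf' t), fun V => ?_⟩
    rw [map_add, ← hv, ← hv', InputPoly.val, List.map_append, List.sum_append]
    rfl
  | mul_X p i h =>
    obtain ⟨f, hf, hv⟩ := h
    refine ⟨f.map fun t => (t.1, (i : ℕ) :: t.2), fun t ht => ?_, fun V => ?_⟩
    · obtain ⟨t', ht', rfl⟩ := List.mem_map.1 ht
      intro j hj
      rcases List.mem_cons.1 hj with rfl | hj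
      exacts [i.2, hf t' ht' j hj]
    · rw [map_mul, ← hv, MvPolynomial.aeval_X, InputPoly.val, InputPoly.val,
        ← List.sum_map_mul_right, List.map_map]
      congr 1
      refine List.map_congr_left fun t _ => ?_
      simp only [Function.comp_def, List.map_cons, List.prod_cons]
      ring

/-! ### Compiling the transition system into a program -/

section Programs

variable {k : ℕ} {Z C : Type}

theorem Transition.map_weight {R R' : Type} [CommRing R] [CommRing R'] (φ : R →+* R') (g : Z → R)
    (u : Z → C → R) (r : Z → ℕ → C → C → R) (e : Transition k Z C) :
    φ (e.weight g u r) = e.weight (fun ν => φ (g ν)) (fun ν c => φ (u ν c))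
      (fun ν d x y => φ (r ν d x y)) := by
  rcases e with ν | ⟨ν, w, c⟩
  · rfl
  · simp only [Transition.weight, map_mul, map_prod]
    congr 1
    refine Finset.prod_congr rfl fun i _ => ?_
    cases w i <;> simp

theorem Transition.map_factor {R R' : Type} [CommRing R] [CommRing R'] (φ : R →+* R')
    (r : Z → ℕ → C → C → R) (e : Transition k Z C) (j : Counter k Z C) :
    φ (e.factor r j) = e.factor (fun ν d x y => φ (r ν d x y)) j := by
  rcases j with x | s
  · rcases e with ν | ⟨ν, w, c⟩ <;> simp [Transition.factor]
  · simp [Transition.factor, apply_ite φ]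

/-- A transition raises at most two counters, each of place value at most `(n + 3) ^ (d - 1)`, and
the base exceeds two. This is the condition that makes the recurrence descend. -/
theorem codeSum_plus_lt (n : ℕ) {d : ℕ} (J : Counter k Z C → Fin d) (e : Transition k Z C) :
    codeSum n (e.plus.map fun j => (J j : ℕ)) < (n + 3) ^ d := by
  obtain ⟨d', rfl⟩ : ∃ d', d = d' + 1 := ⟨d - 1, by have := (J (.inr none)).2; omega⟩
  have h : ∀ j, (n + 3) ^ (J j : ℕ) ≤ (n + 3) ^ d' := fun j =>
    Nat.pow_le_pow_right (by omega) (Nat.lt_succ_iff.1 (J j).2)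
  have hpos : 0 < (n + 3) ^ d' := by positivity
  have h2 : codeSum n (e.plus.map fun j => (J j : ℕ)) ≤ 2 * (n + 3) ^ d' := by
    rcases e with ν | ⟨ν, w, c⟩
    · simp only [Transition.plus, codeSum, List.map_cons, List.map_nil, List.sum_cons,
        List.sum_nil]
      have := h (.inr (some (ν, window k [])))
      omega
    · simp only [Transition.plus, codeSum, List.map_cons, List.sum_cons]
      have h₁ := h (.inr (some (ν, Fin.cons (some c) (Fin.init w))))
      cases w (Fin.last k) with
      | none => simp; omega
      | some x => have := h (.inl x); simp; omega
  rw [pow_succ]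
  nlinarith

open Classical in
/-- A program for a weighted sum of sequence sums, multiplied by a factorial and by powers of
polynomials. -/
theorem exists_chain_program (q k π : ℕ) [Fintype Z] [Fintype C] (g : Z → MvPolynomial (Fin q) ℤ)
    (u : Z → C → MvPolynomial (Fin q) ℤ) (r : Z → ℕ → C → C → MvPolynomial (Fin q) ℤ)
    (f : ℕ → MvPolynomial (Fin q) ℤ) (b : ℕ → IExpr) (β : ℕ → ℕ → ℕ)
    (hb : ∀ p < π, ∀ n x, (b p).eval n x = β p n) :
    ∃ (prog : Prog) (T : ℕ[X]), ∀ {R : Type} [CommRing R] (𝓕 : SizeFiltration R) (V : ℕ → R),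
      (∀ j < q, ∃ b, 𝓕.mem b (V j)) → ∀ φ : MvPolynomial (Fin q) ℤ →+* R,
      (∀ p, φ p = MvPolynomial.aeval (fun j : Fin q => V j) p) →
      ∃ B : ℕ[X], ∀ (n : ℕ) (s : State R), s.idx 0 = n → s.idx 1 = 0 → s.num = V →
        ∃ c ≤ T.eval n, ∃ s', Run (𝓕.mem (B.eval n)) prog s c s' ∧ s'.num 0 =
          (∑ ν, φ (g ν) * chainSum (k + 1) (fun c => φ (u ν c)) (fun d x y => φ (r ν d x y)) n) *
            n.factorial * ∏ p ∈ Finset.range π, φ (f p) ^ β p n := by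
  choose P hPq hPv using fun p : MvPolynomial (Fin q) ℤ => exists_inputPoly p
  obtain ⟨d, ⟨J⟩⟩ := Finite.exists_equiv_fin (Counter k Z C)
  obtain ⟨ε, ⟨E⟩⟩ := Finite.exists_equiv_fin (Transition k Z C)
  -- Here and below, values outside the index ranges are arbitrary defaults.
  set α : ℕ → InputPoly := fun e => if h : e < ε then P ((E.symm ⟨e, h⟩).weight g u r) else []
    with hα
  set ρ : ℕ → ℕ → InputPoly := fun e j => if h : e < ε ∧ j < d then
    P ((E.symm ⟨e, h.1⟩).factor r (J.symm ⟨j, h.2⟩)) else [] with hρ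
  set plus : ℕ → List ℕ := fun e => if h : e < ε then
    ((E.symm ⟨e, h⟩).plus).map fun j => (J j : ℕ) else [] with hplus
  set minus : ℕ → List ℕ := fun e => if h : e < ε then
    [(J (.inr (E.symm ⟨e, h⟩).src) : ℕ)] else [] with hminus
  have hlt : ∀ n, ∀ e < ε, codeSum n (plus e) < (n + 3) ^ d := by
    intro n e he
    simp only [hplus, dif_pos he]
    exact codeSum_plus_lt n J _
  obtain ⟨prog, T, H⟩ := exists_counter_program q ε d π (J (.inr none)) (J (.inr none)).2 α ρ plus
    minus (fun p => P (f p)) b β hb hlt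
  refine ⟨prog, T, ?_⟩
  intro R _ 𝓕 V hV φ hφ
  have hα' : ∀ e, ∀ t ∈ α e, ∀ j ∈ t.2, j < q := by
    intro e
    simp only [hα]
    split_ifs
    exacts [hPq _, by simp]
  have hρ' : ∀ e j, ∀ t ∈ ρ e j, ∀ j ∈ t.2, j < q := by
    intro e j
    simp only [hρ]
    split_ifs
    exacts [hPq _, by simp]
  -- Only finitely many ring elements, independent of `n`, are involved, so a single size bound
  -- serves them all.
  have ev : ∀ᶠ b in atTop, 𝓕.mem b 0 ∧ 𝓕.mem b 1 ∧
      (∀ e ∈ Finset.range ε, (α e).Good (𝓕.mem b) q V ∧ 𝓕.mem b ((α e).val V)) ∧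
      (∀ e ∈ Finset.range ε, ∀ j ∈ Finset.range d,
        (ρ e j).Good (𝓕.mem b) q V ∧ 𝓕.mem b ((ρ e j).val V)) ∧
      ∀ p ∈ Finset.range π, (P (f p)).Good (𝓕.mem b) q V := by
    refine (by simpa using 𝓕.eventually_int 0 : ∀ᶠ b in atTop, 𝓕.mem b 0).and
      ((by simpa using 𝓕.eventually_int 1 : ∀ᶠ b in atTop, 𝓕.mem b 1).and
      (((eventually_all_finset _).2 fun e _ => ?_).and
      (((eventually_all_finset _).2 fun e _ => (eventually_all_finset _).2 fun j _ => ?_).and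
      ((eventually_all_finset _).2 fun p _ => ?_))))
    · exact (InputPoly.eventually_good 𝓕 hV _ (hα' e)).and
        (InputPoly.eventually_val 𝓕 hV _ (hα' e))
    · exact (InputPoly.eventually_good 𝓕 hV _ (hρ' e j)).and
        (InputPoly.eventually_val 𝓕 hV _ (hρ' e j))
    · exact InputPoly.eventually_good 𝓕 hV _ (hPq _)
  obtain ⟨b₁, h0, h1, hα₁, hρ₁, hf₁⟩ := ev.exists
  -- The first summand is the bound of `SizeFiltration.mem_rate`; the summand `X` covers the
  -- integers up to `n` used for the factorial.
  refine ⟨Polynomial.C b₁ * (Polynomial.C d * (X + 3) + 2) + X, fun n s hs0 hs1 hsV => ?_⟩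
  have hB : (Polynomial.C b₁ * (Polynomial.C d * (X + 3) + 2) + X : ℕ[X]).eval n = b₁ * (d * (n + 3) + 2) + n := by
    simp
  rw [hB]
  have hle : b₁ + n ≤ b₁ * (d * (n + 3) + 2) + n :=
    Nat.add_le_add_right (Nat.le_mul_of_pos_right _ (by omega)) _
  have hgood : ∀ {f : InputPoly}, f.Good (𝓕.mem b₁) q V →
      f.Good (𝓕.mem (b₁ * (d * (n + 3) + 2) + n)) q V := fun hf t ht =>
    ⟨𝓕.mono (by omega) (hf t ht).1, fun j hj =>
      ⟨((hf t ht).2 j hj).1, 𝓕.mono (by omega) ((hf t ht).2 j hj).2⟩⟩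
  subst hsV
  obtain ⟨c, hc, s', hrun, hs'⟩ := H (S := 𝓕.mem (b₁ * (d * (n + 3) + 2) + n)) hs0 hs1
    (𝓕.mono (by omega) h0) (𝓕.mono (by omega) h1)
    (fun i hi => 𝓕.mono (by omega) (𝓕.mem_nat h0 h1 i))
    (fun e he => hgood (hα₁ e (Finset.mem_range.2 he)).1)
    (fun e he j hj => hgood (hρ₁ e (Finset.mem_range.2 he) j (Finset.mem_range.2 hj)).1)
    (fun p hp => hgood (hf₁ p (Finset.mem_range.2 hp)))
    (fun e he i _ => 𝓕.mono (by omega) (𝓕.mem_rate h1 (hα₁ e (Finset.mem_range.2 he)).2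
      (fun j hj => (hρ₁ e (Finset.mem_range.2 he) j (Finset.mem_range.2 hj)).2) i))
  refine ⟨c, hc, s', hrun, ?_⟩
  rw [hs']
  simp only [hPv, ← hφ]
  congr 2
  refine shiftRec_eq_sum_chainSum (fun ν => φ (g ν)) (fun ν c => φ (u ν c))
    (fun ν d x y => φ (r ν d x y)) n J E _ _ _ _ (fun e => ?_) (fun e j => ?_) (fun e => ?_)
    (fun e => ?_) (hlt n)
  · simp only [hα, Fin.is_lt, dif_pos, Fin.eta, Equiv.symm_apply_apply, hPv, ← hφ]
    exact Transition.map_weight φ g u r e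
  · simp only [hρ, Fin.is_lt, and_self, dif_pos, Fin.eta, Equiv.symm_apply_apply, hPv, ← hφ]
    exact Transition.map_factor φ r e j
  · simp only [hplus, Fin.is_lt, dif_pos, Fin.eta, Equiv.symm_apply_apply]
  · simp only [hminus, Fin.is_lt, dif_pos, Fin.eta, Equiv.symm_apply_apply]

end Programs

end WFOMC

namespace WFOMC

open Polynomial Filter

/-! ### From tame programs to domain-liftability -/

section Cost

/-- The filtration with a single step. -/
def SizeFiltration.trivial (R : Type) [CommRing R] : SizeFiltration R where
  mem _ _ := True
  mono _ _ := True.intro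
  add _ _ := True.intro
  mul _ _ := True.intro
  int _ := ⟨0, True.intro⟩

/-- The rationals of absolute value at most `2 ^ b` whose denominator divides `D ^ b`. -/
def SizeFiltration.rat (D : ℕ) : SizeFiltration ℚ where
  mem b x := |x| ≤ 2 ^ b ∧ ∃ z : ℤ, x * D ^ b = z
  mono := by
    rintro b c x hbc ⟨h, z, hz⟩
    refine ⟨h.trans (pow_le_pow_right₀ (by norm_num) hbc), z * D ^ (c - b), ?_⟩
    push_cast
    rw [← hz, mul_assoc, ← pow_add, Nat.add_sub_cancel' hbc]
  add := by
    rintro b x y ⟨hx, z, hz⟩ ⟨hy, z', hz'⟩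
    refine ⟨(abs_add_le x y).trans (by rw [pow_succ]; linarith), (z + z') * D, ?_⟩
    push_cast
    rw [← hz, ← hz', pow_succ]
    ring
  mul := by
    rintro b c x y ⟨hx, z, hz⟩ ⟨hy, z', hz'⟩
    refine ⟨?_, z * z', ?_⟩
    · rw [abs_mul, pow_add]
      exact mul_le_mul hx hy (abs_nonneg _) (by positivity)
    · push_cast
      rw [← hz, ← hz', pow_add]
      ring
  int z := by
    refine ⟨z.natAbs, ?_, z * D ^ z.natAbs, by push_cast; ring⟩
    rw [← Int.cast_abs, Int.abs_eq_natAbs]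
    exact_mod_cast (Nat.lt_two_pow_self (n := z.natAbs)).le

theorem SizeFiltration.exists_mem_rat {D : ℕ} {x : ℚ} (hx : x.den ∣ D) :
    ∃ b, (SizeFiltration.rat D).mem b x := by
  obtain ⟨e, rfl⟩ := hx
  -- The exponent `⌈|x|⌉₊` suffices for the absolute value; the extra one ensures that at least one
  -- factor `D` is present to clear the denominator.
  refine ⟨⌈|x|⌉₊ + 1, ?_, x.num * e * ((x.den * e : ℕ) : ℤ) ^ ⌈|x|⌉₊, ?_⟩
  · refine (Nat.le_ceil _).trans ?_
    exact_mod_cast ((Nat.lt_two_pow_self (n := ⌈|x|⌉₊)).le.trans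
      (Nat.pow_le_pow_right (by norm_num) (Nat.le_succ _)))
  · have h := Rat.mul_den_eq_num x
    push_cast
    rw [← h, pow_succ]
    ring

/-- The denominator divides `D ^ b ≤ 2 ^ (D * b)`, and the numerator is `|x|` times the denominator
in absolute value. With `D` fixed, bit length is linear in the size `b`. -/
theorem ratBits_le {D b : ℕ} (hD : 0 < D) {x : ℚ} (hx : (SizeFiltration.rat D).mem b x) :
    ratBits x ≤ b + 2 * (D * b) + 2 := by
  obtain ⟨h, z, hz⟩ := hx
  have hden : x.den ∣ D ^ b := by
    have hx : x = Rat.divInt z (D ^ b : ℤ) := by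
      rw [Rat.divInt_eq_div, eq_div_iff (by positivity)]
      exact_mod_cast hz
    have := Rat.den_dvd z (D ^ b : ℤ)
    rw [← hx] at this
    exact_mod_cast this
  have hDb : D ^ b ≤ 2 ^ (D * b) := by
    rw [pow_mul]
    exact Nat.pow_le_pow_left (Nat.lt_two_pow_self).le _
  have hden' : x.den ≤ 2 ^ (D * b) := (Nat.le_of_dvd (by positivity) hden).trans hDb
  have hnum : x.num.natAbs ≤ 2 ^ (b + D * b) := by
    have h₁ : ((x.num.natAbs : ℕ) : ℚ) = |x| * x.den := by
      rw [Nat.cast_natAbs, Int.cast_abs, ← Rat.mul_den_eq_num x, abs_mul, Nat.abs_cast]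
    have h₂ : ((x.num.natAbs : ℕ) : ℚ) ≤ (2 ^ (b + D * b) : ℕ) := by
      rw [h₁, pow_add, Nat.cast_mul]
      refine mul_le_mul (by exact_mod_cast h) (by exact_mod_cast hden') (by positivity)
        (by positivity)
    exact_mod_cast h₂
  have s₁ : Nat.size x.den ≤ D * b + 1 := Nat.size_le.2 
    (hden'.trans_lt (Nat.pow_lt_pow_right (by norm_num) (Nat.lt_succ_self _)))
  have s₂ : Nat.size x.num.natAbs ≤ b + D * b + 1 :=
    Nat.size_le.2 (hnum.trans_lt (Nat.pow_lt_pow_right (by norm_num) (Nat.lt_succ_self _)))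
  rw [ratBits]
  omega

end Cost

/-! ### Input layout and transfer to unit and bit cost -/

section Symbols

variable {m k : ℕ}

/-- The position of a symbol in the enumeration of the inputs. -/
def Sym.index : Sym m k → ℕ
  | .user i => i
  | .le => m
  | .pred s => m + 1 + s

theorem Sym.index_lt (p : Sym m k) : p.index < m + 1 + k := by
  cases p <;> simp only [Sym.index] <;> omega

theorem entry_index {R : Type} [CommRing R] (w : Sym m k → R) (p : Sym m k) :
    entry w p.index = w p := by
  cases p with
  | user i => simp [entry, Sym.index]
  | le => simp [entry, Sym.index]
  | pred s => simp [entry, Sym.index, show ¬ m + 1 + (s : ℕ) < m by omega,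
      show m + 1 + (s : ℕ) ≠ m by omega]

theorem entry_eq {R : Type} [CommRing R] (w : Sym m k → R) (j : ℕ) :
    entry w j = 0 ∨ ∃ p, entry w j = w p := by
  rw [entry]
  split_ifs
  exacts [.inr ⟨_, rfl⟩, .inr ⟨_, rfl⟩, .inr ⟨_, rfl⟩, .inl rfl]

theorem exists_mem_input {R : Type} [CommRing R] (𝓕 : SizeFiltration R) {w wbar : Sym m k → R}
    (hw : ∀ p, ∃ b, 𝓕.mem b (w p)) (hwbar : ∀ p, ∃ b, 𝓕.mem b (wbar p)) :
    ∃ b, ∀ n a, 𝓕.mem b ((input n w wbar).num a) := by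
  have h0 : ∀ᶠ b in atTop, 𝓕.mem b 0 := by simpa using 𝓕.eventually_int 0
  have h1 : ∀ᶠ b in atTop, ∀ p, 𝓕.mem b (w p) :=
    eventually_all.2 fun p => (hw p).elim fun _ => 𝓕.eventually
  have h2 : ∀ᶠ b in atTop, ∀ p, 𝓕.mem b (wbar p) :=
    eventually_all.2 fun p => (hwbar p).elim fun _ => 𝓕.eventually
  obtain ⟨b, h0, h1, h2⟩ := (h0.and (h1.and h2)).exists
  refine ⟨b, fun n a => ?_⟩
  simp only [input]
  split_ifs
  · rcases entry_eq w (a / 2) with h | ⟨p, h⟩ <;> rw [h]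
    exacts [h0, h1 p]
  · rcases entry_eq wbar (a / 2) with h | ⟨p, h⟩ <;> rw [h]
    exacts [h0, h2 p]

/-- The step bound `T` precedes the weights, whereas the size bound `B` may depend on them. With the
trivial filtration all costs of data vanish, which gives the unit-cost bound; the filtration with a
common denominator gives the bit-cost bound. -/
theorem domainLiftable_of_program {ar : Fin m → ℕ} {Γ : FO2 (arity k ar)} (prog : Prog) (T : ℕ[X])
    (H : ∀ {R : Type} [CommRing R] (𝓕 : SizeFiltration R) (w wbar : Sym m k → R),
      (∀ p, ∃ b, 𝓕.mem b (w p)) → (∀ p, ∃ b, 𝓕.mem b (wbar p)) →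
      ∃ B : ℕ[X], ∀ n, 1 ≤ n → ∃ c ≤ T.eval n, ∃ s',
        Run (𝓕.mem (B.eval n)) prog (input n w wbar) c s' ∧
          s'.num 0 = wfomc n (WithLinear Γ n) w wbar) :
    DomainLiftable Γ := by
  have hidx : ∀ {R : Type} [CommRing R] (n : ℕ) (w wbar : Sym m k → R) (a : ℕ),
      (input n w wbar).idx a ≤ n + prog.maxConst := by
    intro R _ n w wbar a
    simp only [input]
    split_ifs <;> omega
  refine ⟨prog, ⟨T, fun w wbar n hn => ?_⟩, fun w wbar => ?_⟩
  · obtain ⟨B, hB⟩ := H (SizeFiltration.trivial ℝ) w wbar (fun _ => ⟨0, True.intro⟩)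
      (fun _ => ⟨0, True.intro⟩)
    obtain ⟨c, hc, s', hrun, hs'⟩ := hB n hn
    obtain ⟨c', hc', hex⟩ := hrun.exec (size := fun _ => 0) (nsize := fun _ => 0) (σ := 0)
      (A := n + prog.maxConst) (B := 0) _ (Nat.le_add_left _ _) (hidx n w wbar)
      (fun _ => True.intro) (fun _ _ => le_rfl) (fun _ _ => le_rfl)
    exact ⟨c', s', hex, by omega, hs'⟩
  -- A common multiple of all input denominators.
  · set D : ℕ := (∏ p, (w p).den) * ∏ p, (wbar p).den with hDdef
    have hD : 0 < D := Nat.mul_pos (Finset.prod_pos fun p _ => (w p).pos)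
      (Finset.prod_pos fun p _ => (wbar p).pos)
    have hw : ∀ p, ∃ b, (SizeFiltration.rat D).mem b (w p) := fun p =>
      SizeFiltration.exists_mem_rat
        ((Finset.dvd_prod_of_mem _ (Finset.mem_univ p)).trans (dvd_mul_right _ _))
    have hwbar : ∀ p, ∃ b, (SizeFiltration.rat D).mem b (wbar p) := fun p =>
      SizeFiltration.exists_mem_rat
        ((Finset.dvd_prod_of_mem (fun p => (wbar p).den) (Finset.mem_univ p)).trans
          (dvd_mul_left _ _))
    obtain ⟨B, hB⟩ := H (SizeFiltration.rat D) w wbar hw hwbar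
    obtain ⟨b₀, hb₀⟩ := exists_mem_input (SizeFiltration.rat D) hw hwbar
    -- `β` bounds the size of every number during the run, by `Run.num_mem`; `σ` then bounds all bit
    -- lengths, of indices as well as numbers.
    set β : ℕ[X] := (b₀ : ℕ[X]) + T * (B + 1) with hβ
    set σ : ℕ[X] := X + (prog.maxConst : ℕ[X]) + T + 1 + (β + 2 * ((D : ℕ[X]) * β) + 2) with hσ
    refine ⟨T * (1 + 2 * σ), fun n hn => ?_⟩
    obtain ⟨c, hc, s', hrun, hs'⟩ := hB n hn
    have hσ' : σ.eval n = n + prog.maxConst + T.eval n + 1 +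
        (β.eval n + 2 * (D * β.eval n) + 2) := by simp [hσ]
    have hβ' : β.eval n = b₀ + T.eval n * (B.eval n + 1) := by simp [hβ]
    obtain ⟨c', hc', hex⟩ := hrun.exec (size := Nat.size) (nsize := ratBits) (σ := σ.eval n)
      (A := n + prog.maxConst) (B := b₀) _ (Nat.le_add_left _ _) (hidx n w wbar) (hb₀ n)
      (fun x hx => by
        refine (Nat.size_le (n := n + prog.maxConst + T.eval n + 1).2
          (hx.trans_lt ?_)).trans (by rw [hσ']; omega)
        have h1 : n + prog.maxConst < 2 ^ (n + prog.maxConst) := Nat.lt_two_pow_self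
        have h2 : 2 ^ c ≤ 2 ^ T.eval n := Nat.pow_le_pow_right (by norm_num) hc
        calc (n + prog.maxConst) * 2 ^ c ≤ 2 ^ (n + prog.maxConst) * 2 ^ T.eval n :=
              Nat.mul_le_mul h1.le h2
          _ = 2 ^ (n + prog.maxConst + T.eval n) := (pow_add _ _ _).symm
          _ < _ := Nat.pow_lt_pow_right (by norm_num) (by omega))
      (fun x hx => by
        refine (ratBits_le hD ((SizeFiltration.rat D).mono (c := β.eval n) ?_ hx)).trans
          (by rw [hσ']; omega)
        rw [hβ']
        exact Nat.add_le_add_left (Nat.mul_le_mul_right _ hc) _)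
    refine ⟨c', s', hex, hc'.trans ?_, hs'⟩
    simp only [Polynomial.eval_mul, Polynomial.eval_add, Polynomial.eval_one,
      Polynomial.eval_ofNat]
    exact Nat.mul_le_mul_right _ hc

end Symbols

end WFOMC

namespace WFOMC

/-! ### Local representations of two-variable formulas -/

section Indicator

variable {R : Type} [CommRing R]

open Classical in
/-- The indicator of a proposition. -/
noncomputable def ind (R : Type) [CommRing R] (p : Prop) : R := if p then 1 else 0

theorem ind_of_true {p : Prop} (h : p) : ind R p = 1 := if_pos h

theorem ind_of_false {p : Prop} (h : ¬ p) : ind R p = 0 := if_neg h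

theorem ind_and (p q : Prop) : ind R (p ∧ q) = ind R p * ind R q := by
  by_cases hp : p <;> by_cases hq : q <;> simp [ind, hp, hq]

theorem ind_forall {ι : Type} [Fintype ι] (p : ι → Prop) : ind R (∀ i, p i) = ∏ i, ind R (p i) := by
  by_cases h : ∀ i, p i
  · simp [ind_of_true, h]
  · obtain ⟨i, hi⟩ := not_forall.1 h
    rw [ind_of_false h, Finset.prod_eq_zero (Finset.mem_univ i) (ind_of_false hi)]

theorem map_ind {R' : Type} [CommRing R'] (φ : R →+* R') (p : Prop) : φ (ind R p) = ind R' p := by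
  by_cases hp : p <;> simp [ind, hp]

theorem sum_fun_prod {M : Type} [AddCommMonoid M] {ι A B : Type} [Fintype ι] [DecidableEq ι]
    [Fintype A] [Fintype B] (f : (ι → A × B) → M) :
    ∑ c, f c = ∑ a : ι → A, ∑ b : ι → B, f fun i => (a i, b i) := by
  rw [← (Equiv.arrowProdEquivProdArrow ι (fun _ => A) fun _ => B).symm.sum_comp,
    Fintype.sum_prod_type]
  rfl

end Indicator

/-! ### Eliminating quantifiers by signed labelings -/

section Local

variable {P : Type} {ar : P → ℕ}

open Classical in
/-- The world induced on `Fin q` by a map to the domain. -/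
noncomputable def pull [Fintype P] {q n : ℕ} (v : Fin q → Fin n) (ω : World ar n) : World ar q :=
  Finset.univ.filter fun l => (⟨l.1, fun i => v (l.2 i)⟩ : GroundAtom ar n) ∈ ω

@[simp] theorem mem_pull [Fintype P] {q n : ℕ} {v : Fin q → Fin n} {ω : World ar n}
    {l : GroundAtom ar q} :
    l ∈ pull v ω ↔ (⟨l.1, fun i => v (l.2 i)⟩ : GroundAtom ar n) ∈ ω := by
  simp [pull]

variable [Fintype P]

/-- A family of binary relations on worlds is locally representable if every functional of it is a
signed sum, over labelings of the domain with constraints on pairs, of the functional of a relation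
that only depends on labels and on the induced world of a pair. -/
def LocallyRepresentable (T : ∀ n, World ar n → (Fin 2 → Fin n) → Prop) : Prop :=
  ∃ (L : Type) (_ : Fintype L) (s : L → ℤ) (κ e : World ar 2 → L → L → Prop),
    ∀ (n : ℕ) (ω : World ar n) (F : ((Fin 2 → Fin n) → Prop) → ℤ),
      F (T n ω) = ∑ c : Fin n → L, (∏ a, s (c a)) *
        (ind ℤ (∀ v : Fin 2 → Fin n, κ (pull v ω) (c (v 0)) (c (v 1))) *
          F fun v => e (pull v ω) (c (v 0)) (c (v 1)))

theorem locallyRepresentable_of_pull (e : World ar 2 → Prop) :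
    LocallyRepresentable fun n (ω : World ar n) v => e (pull v ω) :=
  ⟨Unit, inferInstance, fun _ => 1, fun _ _ _ => True, fun τ _ _ => e τ, fun n ω F => by
    simp [ind_of_true]⟩

/-- Because the representation holds for every functional, it can be applied to one argument inside
an arbitrary context and then to the other. Labels pair up, signs multiply and constraints are
conjoined. -/
theorem LocallyRepresentable.map₂ {T T' : ∀ n, World ar n → (Fin 2 → Fin n) → Prop}
    (h : LocallyRepresentable T) (h' : LocallyRepresentable T') (f : Prop → Prop → Prop) :
    LocallyRepresentable fun n ω v => f (T n ω v) (T' n ω v) := by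
  obtain ⟨L, _, s, κ, e, H⟩ := h
  obtain ⟨L', _, s', κ', e', H'⟩ := h'
  refine ⟨L × L', inferInstance, fun c => s c.1 * s' c.2,
    fun τ c c' => κ τ c.1 c'.1 ∧ κ' τ c.2 c'.2, fun τ c c' => f (e τ c.1 c'.1) (e' τ c.2 c'.2),
    fun n ω F => ?_⟩
  refine (H n ω fun φ => F fun v => f (φ v) (T' n ω v)).trans ?_
  rw [sum_fun_prod]
  refine Finset.sum_congr rfl fun c _ => ?_
  rw [H' n ω fun φ => F fun v => f (e (pull v ω) (c (v 0)) (c (v 1))) (φ v), Finset.mul_sum,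
    Finset.mul_sum]
  refine Finset.sum_congr rfl fun c' _ => ?_
  simp only [Finset.prod_mul_distrib, forall_and, ind_and]
  ring

/-- The sign of a pair consisting of a truth value and a flag for a constraint. -/
def flagSign : Bool × Bool → ℤ
  | (true, false) => 1
  | (true, true) => -1
  | (false, true) => 1
  | (false, false) => 0

/-- Fix a guess `h` for the truth value `q`. Summing over the flag gives `1 - [¬ q] = [q]` if the
guess is true and `[¬ q]` if it is false, so exactly the correct guess survives. The constraints
only ever demand `¬ p b`, never `p b`; when `p b` is existential they are universal statements. -/
theorem sum_flagSign {ι : Type} [Fintype ι] [DecidableEq ι] (p : ι → Prop) (Φ : (ι → Prop) → ℤ) :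
    Φ p = ∑ c : ι → Bool × Bool, (∏ b, flagSign (c b)) *
      (ind ℤ (∀ b, (c b).2 = true → ¬ p b) * Φ fun b => (c b).1 = true) := by
  classical
  have key : ∀ (h : Bool) (q : Prop), (∑ f : Bool, flagSign (h, f) * ind ℤ (f = true → ¬ q)) =
      ind ℤ (h = decide q) := by
    intro h q
    by_cases hq : q <;> cases h <;> simp [hq, flagSign, ind]
  rw [sum_fun_prod]
  have H : ∀ h : ι → Bool, (∑ f : ι → Bool, (∏ b, flagSign (h b, f b)) *
      (ind ℤ (∀ b, f b = true → ¬ p b) * Φ fun b => h b = true)) =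
      ind ℤ (∀ b, h b = decide (p b)) * Φ fun b => h b = true := by
    intro h
    simp only [← mul_assoc, ← Finset.sum_mul, ind_forall, ← Finset.prod_mul_distrib]
    rw [← Fintype.prod_sum (fun b (f : Bool) => flagSign (h b, f) * ind ℤ (f = true → ¬ p b))]
    simp only [key]
  rw [Finset.sum_congr rfl fun h _ => H h, Finset.sum_eq_single fun b => decide (p b)]
  · simp [ind_of_true]
  · intro h _ hne
    rw [ind_of_false (fun h' => hne (funext h')), zero_mul]
  · simp

theorem LocallyRepresentable.exists {T : ∀ n, World ar n → (Fin 2 → Fin n) → Prop}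
    (h : LocallyRepresentable T) (x : Fin 2) :
    LocallyRepresentable fun n ω v => ∃ a, T n ω (Function.update v x a) := by
  obtain ⟨L, _, s, κ, e, H⟩ := h
  -- After `x` is quantified, the truth value depends on the other variable `y` alone, so it can be
  -- stored in the label of one element.
  obtain ⟨y, hyx, hy⟩ : ∃ y : Fin 2, y ≠ x ∧ ∀ z, z ≠ x → z = y := by
    fin_cases x
    · exact ⟨1, by decide, by decide⟩
    · exact ⟨0, by decide, by decide⟩
  refine ⟨L × (Bool × Bool), inferInstance, fun c => s c.1 * flagSign c.2,
    fun τ c c' => κ τ c.1 c'.1 ∧ ((![c, c'] y).2.2 = true → ¬ e τ c.1 c'.1),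
    fun τ c c' => (![c, c'] y).2.1 = true, fun n ω F => ?_⟩
  have hup : ∀ (φ : (Fin 2 → Fin n) → Prop) (v : Fin 2 → Fin n),
      (∃ a, φ (Function.update v x a)) ↔ ∃ v', v' y = v y ∧ φ v' := by
    intro φ v
    constructor
    · rintro ⟨a, ha⟩
      exact ⟨_, by rw [Function.update_of_ne hyx], ha⟩
    · rintro ⟨v', hv', h⟩
      refine ⟨v' x, ?_⟩
      convert h using 1
      ext1 z
      by_cases hz : z = x
      · subst hz; simp
      · rw [Function.update_of_ne hz, hy z hz, hv']
  have hsel : ∀ (c : Fin n → L × (Bool × Bool)) (v : Fin 2 → Fin n),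
      ![c (v 0), c (v 1)] y = c (v y) := by
    intro c v
    fin_cases y <;> rfl
  simp only [hup]
  refine (H n ω fun φ => F fun v => ∃ v', v' y = v y ∧ φ v').trans ?_
  rw [sum_fun_prod]
  refine Finset.sum_congr rfl fun c _ => ?_
  rw [sum_flagSign (fun b : Fin n => ∃ v' : Fin 2 → Fin n, v' y = b ∧
    e (pull v' ω) (c (v' 0)) (c (v' 1))) fun p => F fun v => p (v y), Finset.mul_sum,
    Finset.mul_sum]
  refine Finset.sum_congr rfl fun c' _ => ?_
  -- The absence of witnesses at all flagged elements becomes a constraint on every pair, which is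
  -- the form a local representation allows.
  have hiff : (∀ b, (c' b).2 = true → ¬ ∃ v' : Fin 2 → Fin n, v' y = b ∧
      e (pull v' ω) (c (v' 0)) (c (v' 1))) ↔
      ∀ v : Fin 2 → Fin n, (c' (v y)).2 = true → ¬ e (pull v ω) (c (v 0)) (c (v 1)) := by
    constructor
    · exact fun h v hv he => h _ hv ⟨v, rfl, he⟩
    · rintro h b hb ⟨v, rfl, hv⟩
      exact h v hb hv
  simp only [hsel (fun i => (c i, c' i)), Finset.prod_mul_distrib, forall_and, ind_and, hiff]
  ring

theorem locallyRepresentable_holds (α : FO2 ar) :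
    LocallyRepresentable fun n (ω : World ar n) v => α.Holds ω v := by
  induction α with
  | atom p t =>
    simpa [Formula.Holds] using
      locallyRepresentable_of_pull fun τ : World ar 2 => (⟨p, t⟩ : GroundAtom ar 2) ∈ τ
  | and α β hα hβ => exact hα.map₂ hβ And
  | or α β hα hβ => exact hα.map₂ hβ Or
  | not α hα => exact hα.map₂ hα fun p _ => ¬ p
  | imp α β hα hβ => exact hα.map₂ hβ fun p q => p → q
  | iff α β hα hβ => exact hα.map₂ hβ Iff
  | ex x α hα => exact hα.exists x
  | all x α hα =>
    -- A universal quantifier is treated as `¬ ∃ ¬`.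
    have h := ((hα.map₂ hα fun p _ => ¬ p).exists x)
    have h' := h.map₂ h fun p _ => ¬ p
    simpa [Formula.Holds] using h'

/-- The truth of a formula under all assignments as a signed sum over labelings with constraints on
pairs. -/
theorem exists_models_eq_sum (α : FO2 ar) :
    ∃ (L : Type) (_ : Fintype L) (s : L → ℤ) (κ : World ar 2 → L → L → Prop),
      ∀ (n : ℕ) (ω : World ar n), ind ℤ (Models ω α) =
        ∑ c : Fin n → L, (∏ a, s (c a)) *
          ind ℤ (∀ v : Fin 2 → Fin n, κ (pull v ω) (c (v 0)) (c (v 1))) := by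
  obtain ⟨L, i, s, κ, e, H⟩ := locallyRepresentable_holds α
  refine ⟨L, i, s, fun τ c c' => κ τ c c' ∧ e τ c c', fun n ω => ?_⟩
  refine (H n ω fun φ => ind ℤ (∀ v, φ v)).trans (Finset.sum_congr rfl fun c _ => ?_)
  simp only [forall_and, ind_and]

end Local

end WFOMC

namespace WFOMC

/-! ### Fixing the linear order -/

section Pull

variable {P : Type} {ar : P → ℕ} [Fintype P]

theorem pull_pull {q n n' : ℕ} (v : Fin q → Fin n) (v' : Fin n → Fin n') (ω : World ar n') :
    pull v (pull v' ω) = pull (fun i => v' (v i)) ω := by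
  ext l
  simp

theorem pull_id {n : ℕ} (ω : World ar n) : pull (fun i => i) ω = ω := by
  ext l
  simp

/-- Relabeling the domain, as an equivalence of worlds. -/
noncomputable def pullEquiv {n : ℕ} (σ : Equiv.Perm (Fin n)) : World ar n ≃ World ar n where
  toFun := pull σ
  invFun := pull σ.symm
  left_inv ω := by simp [pull_pull, pull_id]
  right_inv ω := by simp [pull_pull, pull_id]

theorem holds_pull {n : ℕ} (σ : Equiv.Perm (Fin n)) (ω : World ar n) (α : FO2 ar)
    (v : Fin 2 → Fin n) : α.Holds (pull σ ω) v ↔ α.Holds ω fun i => σ (v i) := by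
  induction α generalizing v with
  | atom p t => simp [Formula.Holds]
  | and α β hα hβ => simp only [Formula.Holds, hα, hβ]
  | or α β hα hβ => simp only [Formula.Holds, hα, hβ]
  | not α hα => simp only [Formula.Holds, hα]
  | imp α β hα hβ => simp only [Formula.Holds, hα, hβ]
  | iff α β hα hβ => simp only [Formula.Holds, hα, hβ]
  | ex x α hα =>
    simp only [Formula.Holds, hα, Function.apply_update (fun _ => σ)]
    exact σ.exists_congr_left.trans (by simp)
  | all x α hα =>
    simp only [Formula.Holds, hα, Function.apply_update (fun _ => σ)]
    exact σ.forall_congr_left.trans (by simp)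

theorem models_pull {n : ℕ} (σ : Equiv.Perm (Fin n)) (ω : World ar n) (α : FO2 ar) :
    Models (pull σ ω) α ↔ Models ω α := by
  simp only [Models, holds_pull]
  exact ⟨fun h v => by simpa using h fun i => σ.symm (v i), fun h v => h _⟩

open Classical in
theorem worldWeight_eq_prod {R : Type} [CommRing R] {n : ℕ} (w wbar : P → R) (ω : World ar n) :
    worldWeight w wbar ω = ∏ l : GroundAtom ar n, if l ∈ ω then w l.1 else wbar l.1 := by
  rw [worldWeight, Finset.prod_ite]
  congr 1
  · exact Finset.prod_congr (by ext; simp) fun _ _ => rfl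
  · exact Finset.prod_congr (by ext; simp) fun _ _ => rfl

theorem worldWeight_pull {R : Type} [CommRing R] {n : ℕ} (w wbar : P → R) (σ : Equiv.Perm (Fin n))
    (ω : World ar n) : worldWeight w wbar (pull σ ω) = worldWeight w wbar ω := by
  rw [worldWeight_eq_prod, worldWeight_eq_prod]
  refine Fintype.prod_equiv
    (Equiv.sigmaCongrRight fun p => Equiv.arrowCongr (Equiv.refl (Fin (ar p))) σ) _ _ fun l => ?_
  classical
  exact if_congr mem_pull rfl rfl

theorem wfomc_eq_sum_ind {R : Type} [CommRing R] {n : ℕ} (p : World ar n → Prop) (w wbar : P → R) :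
    wfomc n p w wbar = ∑ ω, ind R (p ω) * worldWeight w wbar ω := by
  rw [wfomc, Finset.sum_filter]
  refine Finset.sum_congr rfl fun ω _ => ?_
  by_cases h : p ω <;> simp [ind, h]

end Pull

/-! ### Linear orders and their enumerations -/

section Order

theorem exists_equiv_of_linear {α : Type} [Fintype α] {n : ℕ} (hα : Fintype.card α = n)
    (r : α → α → Prop) (total : ∀ a b, r a b ∨ r b a) (antisymm : ∀ a b, r a b → r b a → a = b)
    (trans : ∀ a b c, r a b → r b c → r a c) :
    ∃ σ : Fin n ≃ α, ∀ a b, r (σ a) (σ b) ↔ a ≤ b := by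
  classical
  let _ : LinearOrder α :=
    { le := r
      le_refl := fun a => (total a a).elim id id
      le_trans := trans
      le_antisymm := antisymm
      le_total := total
      toDecidableLE := Classical.decRel _ }
  exact ⟨(monoEquivOfFin α hα).toEquiv, fun a b => (monoEquivOfFin α hα).le_iff_le⟩

theorem equiv_unique_of_linear {α : Type} {n : ℕ} {r : α → α → Prop} {σ σ' : Fin n ≃ α}
    (h : ∀ a b, r (σ a) (σ b) ↔ a ≤ b) (h' : ∀ a b, r (σ' a) (σ' b) ↔ a ≤ b) : σ = σ' := by
  let e : Fin n ≃o Fin n := ⟨σ.trans σ'.symm, by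
    intro a b
    rw [← h', ← h]
    simp⟩
  have he : e = OrderIso.refl _ := Subsingleton.elim _ _
  ext a
  have : σ'.symm (σ a) = a := congrArg (fun f : Fin n ≃o Fin n => f a) he
  rw [← this, Equiv.apply_symm_apply, this]

theorem isPred_equiv_iff {α : Type} {n : ℕ} {r : α → α → Prop} {σ : Fin n ≃ α}
    (h : ∀ a b, r (σ a) (σ b) ↔ a ≤ b) (a b : Fin n) :
    IsPred r (σ a) (σ b) ↔ (a : ℕ) + 1 = b := by
  rw [IsPred, h, σ.injective.ne_iff, σ.symm.forall_congr_left]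
  simp only [Equiv.symm_symm, h, σ.injective.eq_iff]
  constructor
  · rintro ⟨hab, hne, H⟩
    have hlt : (a : ℕ) < b := lt_of_le_of_ne hab fun h => hne (Fin.ext h)
    have := H ⟨a + 1, by omega⟩ (Fin.le_def.2 (by simp)) (Fin.le_def.2 hlt)
    simp only [Fin.ext_iff] at this
    omega
  · intro hab
    refine ⟨Fin.le_def.2 (by omega), fun h => by rw [h] at hab; omega, fun z hz hz' => ?_⟩
    rw [Fin.le_def] at hz hz'
    rw [Fin.ext_iff, Fin.ext_iff]
    omega

theorem isKthPred_equiv_iff {α : Type} {n : ℕ} {r : α → α → Prop} {σ : Fin n ≃ α}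
    (h : ∀ a b, r (σ a) (σ b) ↔ a ≤ b) (s : ℕ) (a b : Fin n) :
    IsKthPred r s (σ a) (σ b) ↔ (a : ℕ) + s = b := by
  induction s generalizing a with
  | zero => rw [IsKthPred, σ.injective.eq_iff, Fin.ext_iff, add_zero]
  | succ s ih =>
    rw [IsKthPred, σ.symm.exists_congr_left]
    simp only [Equiv.symm_symm, isPred_equiv_iff h, ih]
    constructor
    · rintro ⟨c, hc, hcb⟩; omega
    · intro hab; exact ⟨⟨a + 1, by omega⟩, rfl, by simp only; omega⟩

variable {m k : ℕ} {ar : Fin m → ℕ} {n : ℕ}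

/-- The order and predecessor predicates are those of the natural order of `Fin n`. -/
def StandardLinear (ω : World (arity k ar) n) : Prop :=
  (∀ a b, (⟨.le, ![a, b]⟩ : GroundAtom (arity k ar) n) ∈ ω ↔ a ≤ b) ∧
  ∀ (s : Fin k) (a b : Fin n),
    (⟨.pred s, ![a, b]⟩ : GroundAtom (arity k ar) n) ∈ ω ↔ (a : ℕ) + (s + 1) = b

theorem le_mem_pull {q : ℕ} (v : Fin q → Fin n) (ω : World (arity k ar) n) (a b : Fin q) :
    (⟨.le, ![a, b]⟩ : GroundAtom (arity k ar) q) ∈ pull v ω ↔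
      (⟨.le, ![v a, v b]⟩ : GroundAtom (arity k ar) n) ∈ ω := by
  rw [mem_pull]
  have : (fun i : Fin 2 => v (![a, b] i)) = ![v a, v b] := by
    ext1 i; fin_cases i <;> rfl
  exact Iff.of_eq (congrArg (fun t : Fin 2 → Fin n =>
    (⟨.le, t⟩ : GroundAtom (arity k ar) n) ∈ ω) this)

theorem pred_mem_pull {q : ℕ} (v : Fin q → Fin n) (ω : World (arity k ar) n) (s : Fin k)
    (a b : Fin q) :
    (⟨.pred s, ![a, b]⟩ : GroundAtom (arity k ar) q) ∈ pull v ω ↔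
      (⟨.pred s, ![v a, v b]⟩ : GroundAtom (arity k ar) n) ∈ ω := by
  rw [mem_pull]
  have : (fun i : Fin 2 => v (![a, b] i)) = ![v a, v b] := by
    ext1 i; fin_cases i <;> rfl
  exact Iff.of_eq (congrArg (fun t : Fin 2 → Fin n =>
    (⟨.pred s, t⟩ : GroundAtom (arity k ar) n) ∈ ω) this)

theorem linear_iff_exists (ω : World (arity k ar) n) :
    Linear ω ↔ ∃ σ : Equiv.Perm (Fin n), StandardLinear (pull σ ω) := by
  simp only [StandardLinear, le_mem_pull, pred_mem_pull]
  constructor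
  · rintro ⟨total, antisymm, trans, hpred⟩
    obtain ⟨σ, hσ⟩ := exists_equiv_of_linear (Fintype.card_fin n) _ total antisymm trans
    exact ⟨σ, hσ, fun s a b => by rw [hpred, isKthPred_equiv_iff hσ]⟩
  · rintro ⟨σ, hσ, hpred⟩
    refine ⟨?_, ?_, ?_, ?_⟩
    · rw [σ.symm.forall_congr_left]; intro a
      rw [σ.symm.forall_congr_left]; intro b
      simp only [Equiv.symm_symm, hσ]
      exact le_total a b
    · rw [σ.symm.forall_congr_left]; intro a
      rw [σ.symm.forall_congr_left]; intro b
      simp only [Equiv.symm_symm, hσ, σ.injective.eq_iff]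
      exact le_antisymm
    · rw [σ.symm.forall_congr_left]; intro a
      rw [σ.symm.forall_congr_left]; intro b
      rw [σ.symm.forall_congr_left]; intro c
      simp only [Equiv.symm_symm, hσ]
      exact le_trans
    · intro s
      rw [σ.symm.forall_congr_left]; intro a
      rw [σ.symm.forall_congr_left]; intro b
      simp only [Equiv.symm_symm, hpred]
      exact (isKthPred_equiv_iff hσ _ a b).symm

/-- The increasing enumeration of a finite linear order exists and is unique, so the sum has exactly
one nonzero term if the world is linear and none otherwise. -/
theorem ind_linear {R : Type} [CommRing R] (ω : World (arity k ar) n) :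
    ind R (Linear ω) = ∑ σ : Equiv.Perm (Fin n), ind R (StandardLinear (pull σ ω)) := by
  by_cases h : Linear ω
  · obtain ⟨σ, hσ⟩ := (linear_iff_exists ω).1 h
    rw [ind_of_true h, Finset.sum_eq_single σ, ind_of_true hσ]
    · intro σ' _ hne
      refine ind_of_false fun hσ' => hne ?_
      simp only [StandardLinear, le_mem_pull] at hσ hσ'
      exact equiv_unique_of_linear
        (r := fun a b => (⟨.le, ![a, b]⟩ : GroundAtom (arity k ar) n) ∈ ω) hσ'.1 hσ.1
    · simp
  · rw [ind_of_false h, Finset.sum_eq_zero]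
    exact fun σ _ => ind_of_false fun hσ => h ((linear_iff_exists ω).2 ⟨σ, hσ⟩)

/-- Summing over the `n!` possible enumerations first, each gives the same contribution, because
truth of `Γ` and weights are invariant under relabelling. -/
theorem wfomc_withLinear {R : Type} [CommRing R] (Γ : FO2 (arity k ar)) (w wbar : Sym m k → R) :
    wfomc n (WithLinear Γ n) w wbar = n.factorial * ∑ ω : World (arity k ar) n,
      ind R (StandardLinear ω) * (ind R (Models ω Γ) * worldWeight w wbar ω) := by
  have H : ∀ σ : Equiv.Perm (Fin n), (∑ ω : World (arity k ar) n,
      ind R (StandardLinear (pull σ ω)) * (ind R (Models ω Γ) * worldWeight w wbar ω)) =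
      ∑ ω : World (arity k ar) n,
        ind R (StandardLinear ω) * (ind R (Models ω Γ) * worldWeight w wbar ω) := by
    intro σ
    refine Fintype.sum_equiv (pullEquiv σ) _ _ fun ω => ?_
    simp only [pullEquiv, Equiv.coe_fn_mk, models_pull, worldWeight_pull]
  rw [wfomc_eq_sum_ind]
  have : ∀ ω : World (arity k ar) n, ind R (WithLinear Γ n ω) * worldWeight w wbar ω =
      ∑ σ : Equiv.Perm (Fin n), ind R (StandardLinear (pull σ ω)) *
        (ind R (Models ω Γ) * worldWeight w wbar ω) := by
    intro ω
    rw [WithLinear, ind_and, ind_linear, ← Finset.sum_mul]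
    ring
  simp only [this]
  rw [Finset.sum_comm, Finset.sum_congr rfl fun σ _ => H σ, Finset.sum_const, Finset.card_univ,
    Fintype.card_perm, Fintype.card_fin, nsmul_eq_mul]

end Order

end WFOMC

namespace WFOMC

/-! ### Factorization over pairs of domain elements -/

section Split

variable {P : Type} {ar : P → ℕ}

/-- Predicates of arity zero. -/
abbrev NullaryPred (ar : P → ℕ) : Type := {p : P // ar p = 0}

/-- Predicates of positive arity. -/
abbrev PosPred (ar : P → ℕ) : Type := {p : P // ar p ≠ 0}

/-- Atoms over a two-element domain that mention both elements. -/
abbrev PairAtom (ar : P → ℕ) : Type := {l : GroundAtom ar 2 // Function.Surjective l.2}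

/-- Pairs of distinct domain elements, in increasing order. -/
abbrev OrdPair (n : ℕ) : Type := {x : Fin n × Fin n // x.1 < x.2}

/-- The ground atoms that mention at most two domain elements. -/
def smallAtom (ar : P → ℕ) (n : ℕ) :
    NullaryPred ar ⊕ ((Fin n × PosPred ar) ⊕ (OrdPair n × PairAtom ar)) → GroundAtom ar n
  | .inl z => ⟨z.1, fun i => (Fin.cast z.2 i).elim0⟩
  | .inr (.inl (a, u)) => ⟨u.1, fun _ => a⟩
  | .inr (.inr (x, b)) => ⟨b.1.1, fun i => ![x.1.1, x.1.2] (b.1.2 i)⟩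

theorem PairAtom.arity_ne_zero (b : PairAtom ar) : ar b.1.1 ≠ 0 := by
  obtain ⟨i, -⟩ := b.2 0
  exact fun h => (Fin.cast h i).elim0

/-- The kinds differ in how many elements an atom mentions. For two atoms that mention two elements
each, equality gives the same two-element set, and the increasing order of both pairs then
identifies them. -/
theorem smallAtom_injective (n : ℕ) : Function.Injective (smallAtom ar n) := by
  rintro (⟨z, hz⟩ | ⟨a, u, hu⟩ | ⟨⟨⟨i, j⟩, hij⟩, ⟨⟨p, t⟩, ht⟩⟩)
    (⟨z', hz'⟩ | ⟨a', u', hu'⟩ | ⟨⟨⟨i', j'⟩, hij'⟩, ⟨⟨p', t'⟩, ht'⟩⟩) h <;>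
  simp only [smallAtom, Sigma.mk.injEq] at h <;> obtain ⟨rfl, h⟩ := h
  · rfl
  · exact absurd hz hu'
  · exact absurd hz (PairAtom.arity_ne_zero ⟨_, ht'⟩)
  · exact absurd hz' hu
  · have := congrFun (eq_of_heq h) ⟨0, Nat.pos_of_ne_zero hu⟩
    change a = a' at this
    subst this
    rfl
  · obtain ⟨x, hx⟩ := ht' 0
    obtain ⟨y, hy⟩ := ht' 1
    have h1 := congrFun (eq_of_heq h) x
    have h2 := congrFun (eq_of_heq h) y
    simp only at hx hy
    simp only [hx, hy, Matrix.cons_val_zero, Matrix.cons_val_one] at h1 h2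
    exact absurd hij' (by simp [← h1, ← h2])
  · exact absurd hz' (PairAtom.arity_ne_zero ⟨_, ht⟩)
  · obtain ⟨x, hx⟩ := ht 0
    obtain ⟨y, hy⟩ := ht 1
    have h1 := congrFun (eq_of_heq h) x
    have h2 := congrFun (eq_of_heq h) y
    simp only at hx hy
    simp only [hx, hy, Matrix.cons_val_zero, Matrix.cons_val_one] at h1 h2
    exact absurd hij (by simp [h1, h2])
  · have h := congrFun (eq_of_heq h)
    have hmem : ∀ (k l : Fin n) (c : Fin 2), ![k, l] c = k ∨ ![k, l] c = l := by
      intro k l c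
      fin_cases c <;> simp
    obtain ⟨x, hx⟩ := ht 0
    obtain ⟨y, hy⟩ := ht 1
    have h1 := h x
    have h2 := h y
    simp only at hx hy hij hij' h
    simp only [hx, hy, Matrix.cons_val_zero, Matrix.cons_val_one] at h1 h2
    obtain ⟨x', hx'⟩ := ht' 0
    obtain ⟨y', hy'⟩ := ht' 1
    have h3 := h x'
    have h4 := h y'
    simp only at hx' hy'
    simp only [hx', hy', Matrix.cons_val_zero, Matrix.cons_val_one] at h3 h4
    have e1 := hmem i' j' (t' x)
    have e2 := hmem i' j' (t' y)
    have e3 := hmem i j (t x')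
    have e4 := hmem i j (t y')
    have : i = i' ∧ j = j' := by
      rw [← h1] at e1
      rw [← h2] at e2
      rw [h3] at e3
      rw [h4] at e4
      simp only [Fin.ext_iff, Fin.lt_def] at *
      omega
    obtain ⟨rfl, rfl⟩ := this
    have hinj : Function.Injective ![i, j] := by
      intro c d hcd
      fin_cases c <;> fin_cases d
      exacts [rfl, absurd hcd hij.ne, absurd hcd hij.ne', rfl]
    have : t = t' := funext fun c => hinj (h c)
    subst this
    rfl

theorem smallAtom_two_surjective : Function.Surjective (smallAtom ar 2) := by
  rintro ⟨p, t⟩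
  by_cases hp : ar p = 0
  · refine ⟨.inl ⟨p, hp⟩, ?_⟩
    simp only [smallAtom]
    congr 1
    funext i
    exact (Fin.cast hp i).elim0
  · by_cases ht : Function.Surjective t
    · refine ⟨.inr (.inr (⟨(0, 1), by decide⟩, ⟨⟨p, t⟩, ht⟩)), ?_⟩
      simp only [smallAtom]
      congr 1
      funext i
      generalize t i = c
      fin_cases c <;> rfl
    · obtain ⟨c, hc⟩ := not_forall.1 ht
      rw [not_exists] at hc
      -- An argument tuple that misses `c` is constantly the other element `1 - c` of `Fin 2`.
      refine ⟨.inr (.inl (1 - c, ⟨p, hp⟩)), ?_⟩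
      simp only [smallAtom]
      congr 1
      funext i
      have hd : ∀ c d : Fin 2, ¬ d = c → 1 - c = d := by decide
      exact hd _ _ (hc i)

/-- The ground atoms that mention at least three domain elements. -/
abbrev BigAtom (ar : P → ℕ) (n : ℕ) : Type := ↥(Set.range (smallAtom ar n))ᶜ

/-- The decomposition of the Herbrand base. -/
noncomputable def splitAtoms (ar : P → ℕ) (n : ℕ) :
    (NullaryPred ar ⊕ ((Fin n × PosPred ar) ⊕ (OrdPair n × PairAtom ar))) ⊕ BigAtom ar n ≃
      GroundAtom ar n := by
  classical
  exact ((Equiv.ofInjective _ (smallAtom_injective n)).sumCongr (Equiv.refl _)).trans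
    (Equiv.Set.sumCompl _)

@[simp] theorem splitAtoms_inl (n : ℕ) (x) : splitAtoms ar n (.inl x) = smallAtom ar n x := by
  simp [splitAtoms]

@[simp] theorem splitAtoms_inr (n : ℕ) (x : BigAtom ar n) : splitAtoms ar n (.inr x) = x := by
  simp [splitAtoms]

variable [Fintype P]

/-- The world with given truth values. -/
noncomputable def worldEquiv (n : ℕ) : (GroundAtom ar n → Bool) ≃ World ar n := by
  classical
  exact
  { toFun := fun χ => Finset.univ.filter fun l => χ l = true
    invFun := fun ω l => decide (l ∈ ω)
    left_inv := fun χ => by ext l; simp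
    right_inv := fun ω => by ext l; simp }

@[simp] theorem mem_worldEquiv {n : ℕ} {χ : GroundAtom ar n → Bool} {l : GroundAtom ar n} :
    l ∈ worldEquiv n χ ↔ χ l = true := by
  simp [worldEquiv]

/-- The world assembled from the truth values of the nullary atoms, of the atoms that mention one
element, of those that mention two, and of all others. -/
noncomputable def assemble {n : ℕ} (ν : NullaryPred ar → Bool) (η : Fin n → PosPred ar → Bool)
    (β : OrdPair n → PairAtom ar → Bool) (γ : BigAtom ar n → Bool) : World ar n :=
  worldEquiv n fun l => Sum.elim (Sum.elim ν (Sum.elim (fun x => η x.1 x.2) fun x => β x.1 x.2)) γ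
    ((splitAtoms ar n).symm l)

theorem splitAtoms_mem_assemble {n : ℕ} {ν : NullaryPred ar → Bool}
    {η : Fin n → PosPred ar → Bool} {β : OrdPair n → PairAtom ar → Bool} {γ : BigAtom ar n → Bool}
    {x} : splitAtoms ar n x ∈ assemble ν η β γ ↔
      Sum.elim (Sum.elim ν (Sum.elim (fun x => η x.1 x.2) fun x => β x.1 x.2)) γ x = true := by
  simp [assemble]

theorem smallAtom_mem_assemble {n : ℕ} {ν : NullaryPred ar → Bool}
    {η : Fin n → PosPred ar → Bool} {β : OrdPair n → PairAtom ar → Bool} {γ : BigAtom ar n → Bool}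
    {x} : smallAtom ar n x ∈ assemble ν η β γ ↔
      Sum.elim ν (Sum.elim (fun x => η x.1 x.2) fun x => β x.1 x.2) x = true := by
  rw [← splitAtoms_inl, splitAtoms_mem_assemble, Sum.elim_inl]

open Classical in
theorem sum_world {M : Type} [AddCommMonoid M] {n : ℕ} (F : World ar n → M) :
    ∑ ω, F ω = ∑ ν : NullaryPred ar → Bool, ∑ η : Fin n → PosPred ar → Bool,
      ∑ β : OrdPair n → PairAtom ar → Bool, ∑ γ : BigAtom ar n → Bool, F (assemble ν η β γ) := by
  have := Fintype.ofEquiv _ (splitAtoms ar n).symm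
  rw [← (worldEquiv n).sum_comp,
    ← ((splitAtoms ar n).arrowCongr (Equiv.refl Bool)).sum_comp,
    ← (Equiv.sumArrowEquivProdArrow _ _ Bool).symm.sum_comp, Fintype.sum_prod_type,
    ← (Equiv.sumArrowEquivProdArrow _ _ Bool).symm.sum_comp, Fintype.sum_prod_type]
  refine Finset.sum_congr rfl fun ν _ => ?_
  rw [← (Equiv.sumArrowEquivProdArrow _ _ Bool).symm.sum_comp, Fintype.sum_prod_type,
    ← (Equiv.curry _ _ Bool).symm.sum_comp]
  refine Finset.sum_congr rfl fun η _ => ?_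
  rw [← (Equiv.curry _ _ Bool).symm.sum_comp]
  refine Finset.sum_congr rfl fun β _ => Finset.sum_congr rfl fun γ _ => ?_
  rfl

open Classical in
theorem worldWeight_assemble {R : Type} [CommRing R] {n : ℕ} (w wbar : P → R)
    (ν : NullaryPred ar → Bool) (η : Fin n → PosPred ar → Bool)
    (β : OrdPair n → PairAtom ar → Bool) (γ : BigAtom ar n → Bool) :
    worldWeight w wbar (assemble ν η β γ) =
      (∏ z, cond (ν z) (w z.1) (wbar z.1)) * (∏ a, ∏ u, cond (η a u) (w u.1) (wbar u.1)) *
        (∏ x, ∏ b, cond (β x b) (w b.1.1) (wbar b.1.1)) *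
        ∏ l, cond (γ l) (w l.1.1) (wbar l.1.1) := by
  rw [worldWeight_eq_prod, ← (splitAtoms ar n).prod_comp]
  simp only [splitAtoms_mem_assemble, Fintype.prod_sum_type, Fintype.prod_prod_type, Sum.elim_inl,
    Sum.elim_inr, splitAtoms_inl, splitAtoms_inr, smallAtom, Bool.cond_eq_ite, mul_assoc]
  rfl

/-- The induced world of a pair in terms of the assembled truth values. -/
noncomputable def pairWorld (ν : NullaryPred ar → Bool) (η η' : PosPred ar → Bool)
    (β : PairAtom ar → Bool) : World ar 2 :=
  assemble ν ![η, η'] (fun _ => β) fun _ => false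

/-- Over a two-element domain every atom is small, so the induced world is determined by the nullary
atoms, the two cells and the atoms of this pair; `γ` and all other pairs drop out. -/
theorem pull_pair_assemble {n : ℕ} (ν : NullaryPred ar → Bool) (η : Fin n → PosPred ar → Bool)
    (β : OrdPair n → PairAtom ar → Bool) (γ : BigAtom ar n → Bool) (x : OrdPair n) :
    pull ![x.1.1, x.1.2] (assemble ν η β γ) = pairWorld ν (η x.1.1) (η x.1.2) (β x) := by
  ext l
  obtain ⟨y, rfl⟩ := smallAtom_two_surjective l
  rw [mem_pull, pairWorld, smallAtom_mem_assemble]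
  have key : ∀ y', smallAtom ar n y' = ⟨(smallAtom ar 2 y).1,
      fun i => ![x.1.1, x.1.2] ((smallAtom ar 2 y).2 i)⟩ →
      ((⟨(smallAtom ar 2 y).1, fun i => ![x.1.1, x.1.2] ((smallAtom ar 2 y).2 i)⟩ :
        GroundAtom ar n) ∈ assemble ν η β γ ↔
      Sum.elim ν (Sum.elim (fun x => η x.1 x.2) fun x => β x.1 x.2) y' = true) := by
    intro y' h
    rw [← h, smallAtom_mem_assemble]
  rcases y with z | ⟨a, u⟩ | ⟨⟨⟨i, j⟩, hij⟩, b⟩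
  · refine (key (.inl z) ?_).trans Iff.rfl
    simp only [smallAtom]
    congr 1
    funext i
    exact (Fin.cast z.2 i).elim0
  · refine (key (.inr (.inl (![x.1.1, x.1.2] a, u))) rfl).trans ?_
    fin_cases a <;> rfl
  · obtain ⟨rfl, rfl⟩ : i = 0 ∧ j = 1 := by
      have H : ∀ i j : Fin 2, i < j → i = 0 ∧ j = 1 := by decide
      exact H i j hij
    refine (key (.inr (.inr (x, b))) ?_).trans Iff.rfl
    simp only [smallAtom]
    congr 1
    funext i
    generalize b.1.2 i = c
    fin_cases c <;> rfl

/-- The induced world of a repeated element in terms of the assembled truth values. -/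
noncomputable def diagWorld (ν : NullaryPred ar → Bool) (η : PosPred ar → Bool) : World ar 2 :=
  pull (fun _ => 0) (pairWorld ν η η fun _ => false)

/-- Pulling back along a constant map reads only atoms with all arguments equal, so the pair atoms
filled with `false` in `diagWorld` are never consulted. -/
theorem pull_diag_assemble {n : ℕ} (ν : NullaryPred ar → Bool) (η : Fin n → PosPred ar → Bool)
    (β : OrdPair n → PairAtom ar → Bool) (γ : BigAtom ar n → Bool) (a : Fin n) :
    pull (fun _ => a) (assemble ν η β γ) = diagWorld ν (η a) := by
  ext ⟨p, t⟩
  rw [diagWorld, pairWorld, mem_pull, mem_pull]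
  by_cases hp : ar p = 0
  · have H : ∀ (q : ℕ) (a : Fin q), (⟨p, fun _ => a⟩ : GroundAtom ar q) =
        smallAtom ar q (.inl ⟨p, hp⟩) := by
      intro q a
      simp only [smallAtom]
      congr 1
      funext i
      exact (Fin.cast hp i).elim0
    rw [H, H, smallAtom_mem_assemble, smallAtom_mem_assemble]
    rfl
  · have H : ∀ (q : ℕ) (a : Fin q), (⟨p, fun _ => a⟩ : GroundAtom ar q) =
        smallAtom ar q (.inr (.inl (a, ⟨p, hp⟩))) := fun q a => rfl
    rw [H, H, smallAtom_mem_assemble, smallAtom_mem_assemble]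
    rfl

end Split

end WFOMC

namespace WFOMC

/-! ### The weighted model count as a sum over chains -/

section Factor

theorem prod_ordPair {M : Type} [CommMonoid M] {n : ℕ} (F : Fin n → Fin n → M) :
    ∏ x : OrdPair n, F x.1.1 x.1.2 = ∏ a, ∏ i, if i < a then F i a else 1 := by
  rw [← Fintype.prod_prod_type_right (fun x : Fin n × Fin n => if x.1 < x.2 then F x.1 x.2 else 1),
    ← Finset.prod_filter, Finset.prod_subtype (p := fun x : Fin n × Fin n => x.1 < x.2)]
  simp

theorem card_ordPair (n : ℕ) : Fintype.card (OrdPair n) = ∑ i ∈ Finset.range n, i := by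
  rw [Fintype.card_subtype, Finset.card_filter, Fintype.sum_prod_type_right, Finset.sum_range]
  refine Finset.sum_congr rfl fun a _ => ?_
  rw [← Finset.card_filter]
  simp [Finset.filter_gt_eq_Iio]

variable {P : Type} {ar : P → ℕ} [Fintype P] {R : Type} [CommRing R]

/-- The number of ground atoms of a predicate that mention at least three domain elements. -/
noncomputable def bigCount (ar : P → ℕ) (p : P) (n : ℕ) : ℕ :=
  Nat.card {l : BigAtom ar n // l.1.1 = p}

open Classical in
theorem prod_bigAtom {n : ℕ} (f : P → R) :
    ∏ l : BigAtom ar n, f l.1.1 = ∏ p, f p ^ bigCount ar p n := by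
  rw [← Finset.prod_fiberwise Finset.univ fun l : BigAtom ar n => l.1.1]
  refine Finset.prod_congr rfl fun p _ => ?_
  rw [Finset.prod_congr rfl (g := fun _ => f p) (fun l hl => by rw [(Finset.mem_filter.1 hl).2]),
    Finset.prod_const, bigCount, Nat.card_eq_fintype_card, Fintype.card_subtype]

/-- The `n ^ ar p` atoms of a predicate are sorted by the number of elements they mention. Solved
for `bigCount`, this makes the exponent of a free factor computable with index arithmetic. -/
theorem pow_arity_eq (p : P) (n : ℕ) : n ^ ar p =
    Nat.card {z : NullaryPred ar // z.1 = p} + n * Nat.card {u : PosPred ar // u.1 = p} +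
      (∑ i ∈ Finset.range n, i) * Nat.card {b : PairAtom ar // b.1.1 = p} + bigCount ar p n := by
  classical
  obtain ⟨f, hf⟩ : ∃ f : P → ℕ, ∀ p', f p' = if p' = p then 1 else 0 := ⟨_, fun _ => rfl⟩
  have h : (∑ l : GroundAtom ar n, f l.1) = n ^ ar p := by
    simp only [hf]
    rw [← Finset.card_filter, ← Fintype.card_subtype, Fintype.card_congr (Equiv.sigmaSubtype p)]
    simp
  rw [← h, ← (splitAtoms ar n).sum_comp]
  simp only [Fintype.sum_sum_type, Fintype.sum_prod_type, splitAtoms_inl, splitAtoms_inr, smallAtom,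
    Finset.sum_const, Finset.card_univ, Fintype.card_fin, smul_eq_mul, ← card_ordPair]
  generalize Fintype.card (OrdPair n) = N
  simp only [bigCount, Nat.card_eq_fintype_card, Fintype.card_subtype, Finset.card_filter, hf]
  ring

variable {L : Type} (s : L → ℤ) (Δ : World ar 2 → L → Prop)
  (Ξ : ℕ → World ar 2 → L → L → Prop)

/-- The weight of the nullary atoms. -/
def nullaryWeight (w wbar : P → R) (ν : NullaryPred ar → Bool) : R :=
  ∏ z, cond (ν z) (w z.1) (wbar z.1)

/-- The weight of a labeled cell. -/
noncomputable def cellWeight (w wbar : P → R) (ν : NullaryPred ar → Bool)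
    (c : (PosPred ar → Bool) × L) : R :=
  (∏ u, cond (c.1 u) (w u.1) (wbar u.1)) * ((s c.2 : R) * ind R (Δ (diagWorld ν c.1) c.2))

open Classical in
/-- The weight of a pair of labeled cells. -/
noncomputable def edgeWeight (w wbar : P → R) (ν : NullaryPred ar → Bool) (d : ℕ)
    (c c' : (PosPred ar → Bool) × L) : R :=
  ∑ β : PairAtom ar → Bool, ind R (Ξ d (pairWorld ν c.1 c'.1 β) c.2 c'.2) *
    ∏ b, cond (β b) (w b.1.1) (wbar b.1.1)

theorem map_nullaryWeight {R' : Type} [CommRing R'] (φ : R →+* R') (w wbar : P → R)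
    (ν : NullaryPred ar → Bool) : φ (nullaryWeight w wbar ν) =
      nullaryWeight (fun p => φ (w p)) (fun p => φ (wbar p)) ν := by
  simp only [nullaryWeight, map_prod, Bool.apply_cond]

theorem map_cellWeight {R' : Type} [CommRing R'] (φ : R →+* R') (w wbar : P → R)
    (ν : NullaryPred ar → Bool) (c : (PosPred ar → Bool) × L) : φ (cellWeight s Δ w wbar ν c) =
      cellWeight s Δ (fun p => φ (w p)) (fun p => φ (wbar p)) ν c := by
  simp only [cellWeight, map_mul, map_prod, Bool.apply_cond, map_intCast, map_ind]

theorem map_edgeWeight {R' : Type} [CommRing R'] (φ : R →+* R') (w wbar : P → R)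
    (ν : NullaryPred ar → Bool) (d : ℕ) (c c' : (PosPred ar → Bool) × L) :
    φ (edgeWeight Ξ w wbar ν d c c') =
      edgeWeight Ξ (fun p => φ (w p)) (fun p => φ (wbar p)) ν d c c' := by
  simp only [edgeWeight, map_sum, map_mul, map_prod, Bool.apply_cond, map_ind]

-- With `ν`, the cells and the labels fixed, the constraints and weights of distinct pairs involve
-- disjoint sets of atoms, so the sum over `β` is a product over pairs. The atoms in `γ` are
-- unconstrained and factor out altogether.
open Classical in
theorem sum_labeled_worlds [Fintype L] (K : ℕ) (w wbar : P → R) (n : ℕ) :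
    (∑ ω : World ar n, (∑ c : Fin n → L,
      (∏ a, (s (c a) : R) * ind R (Δ (pull (fun _ => a) ω) (c a))) *
        ∏ x : OrdPair n, ind R (Ξ (min ((x.1.2 : ℕ) - x.1.1) K) (pull ![x.1.1, x.1.2] ω)
          (c x.1.1) (c x.1.2))) * worldWeight w wbar ω) =
    (∑ ν : NullaryPred ar → Bool, nullaryWeight w wbar ν *
      chainSum K (cellWeight s Δ w wbar ν) (edgeWeight Ξ w wbar ν) n) *
      ∏ l : BigAtom ar n, (w l.1.1 + wbar l.1.1) := by
  have hγ : (∑ γ : BigAtom ar n → Bool, ∏ l, cond (γ l) (w l.1.1) (wbar l.1.1)) =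
      ∏ l : BigAtom ar n, (w l.1.1 + wbar l.1.1) := by
    rw [← Fintype.prod_sum fun (l : BigAtom ar n) (b : Bool) => cond b (w l.1.1) (wbar l.1.1)]
    simp
  rw [sum_world, Finset.sum_mul]
  refine Finset.sum_congr rfl fun ν _ => ?_
  simp only [pull_pair_assemble, pull_diag_assemble, worldWeight_assemble]
  rw [chainSum, sum_fun_prod, Finset.mul_sum, Finset.sum_mul]
  refine Finset.sum_congr rfl fun η _ => ?_
  rw [Finset.mul_sum, Finset.sum_mul]
  have hβ : ∀ c : Fin n → L, (∑ β : OrdPair n → PairAtom ar → Bool,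
      (∏ x : OrdPair n, ind R (Ξ (min ((x.1.2 : ℕ) - x.1.1) K)
        (pairWorld ν (η x.1.1) (η x.1.2) (β x)) (c x.1.1) (c x.1.2))) *
        ∏ x, ∏ b, cond (β x b) (w b.1.1) (wbar b.1.1)) =
      ∏ a : Fin n, ∏ i : Fin n, if i < a then
        edgeWeight Ξ w wbar ν (min ((a : ℕ) - i) K) (η i, c i) (η a, c a) else 1 := by
    intro c
    rw [← prod_ordPair fun i a : Fin n =>
      edgeWeight Ξ w wbar ν (min ((a : ℕ) - i) K) (η i, c i) (η a, c a)]
    simp only [← Finset.prod_mul_distrib, edgeWeight]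
    rw [Fintype.prod_sum]
  have hcell : ∀ c : Fin n → L, (∏ a, cellWeight s Δ w wbar ν (η a, c a)) =
      (∏ a, ∏ u, cond (η a u) (w u.1) (wbar u.1)) *
        ∏ a, (s (c a) : R) * ind R (Δ (diagWorld ν (η a)) (c a)) := by
    intro c
    simp only [cellWeight, Finset.prod_mul_distrib]
  simp only [← hβ, ← hγ, hcell]
  simp only [Finset.sum_mul, Finset.mul_sum, nullaryWeight]
  rw [Finset.sum_congr rfl fun β _ => Finset.sum_comm, Finset.sum_comm]
  refine Finset.sum_congr rfl fun c _ => ?_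
  rw [Finset.sum_comm]
  refine Finset.sum_congr rfl fun γ _ => Finset.sum_congr rfl fun β _ => ?_
  ring

end Factor

/-! ### Order and labels as constraints on single elements and pairs -/

section Constraints

variable {m k : ℕ} {ar : Fin m → ℕ} {n : ℕ} {L : Type}
  (κ : World (arity k ar) 2 → L → L → Prop)

/-- The constraint on a repeated element. -/
def DiagOK (τ : World (arity k ar) 2) (c : L) : Prop :=
  κ τ c c ∧ (⟨.le, ![0, 0]⟩ : GroundAtom (arity k ar) 2) ∈ τ ∧
    ∀ s : Fin k, (⟨.pred s, ![0, 0]⟩ : GroundAtom (arity k ar) 2) ∉ τ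

/-- The constraint on two elements at distance `d`, in increasing order. -/
def PairOK (d : ℕ) (τ : World (arity k ar) 2) (c c' : L) : Prop :=
  (κ τ c c' ∧ (⟨.le, ![0, 1]⟩ : GroundAtom (arity k ar) 2) ∈ τ ∧
    ∀ s : Fin k, (⟨.pred s, ![0, 1]⟩ : GroundAtom (arity k ar) 2) ∈ τ ↔ (s : ℕ) + 1 = d) ∧
  κ (pull ![1, 0] τ) c' c ∧ (⟨.le, ![1, 0]⟩ : GroundAtom (arity k ar) 2) ∉ τ ∧
    ∀ s : Fin k, (⟨.pred s, ![1, 0]⟩ : GroundAtom (arity k ar) 2) ∉ τ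

theorem forall_pair_iff (Q : Fin n → Fin n → Prop) :
    (∀ a b, Q a b) ↔ (∀ a, Q a a) ∧ ∀ x : OrdPair n, Q x.1.1 x.1.2 ∧ Q x.1.2 x.1.1 := by
  refine ⟨fun h => ⟨fun a => h a a, fun x => ⟨h _ _, h _ _⟩⟩, fun h a b => ?_⟩
  rcases lt_trichotomy a b with hab | rfl | hab
  · exact (h.2 ⟨(a, b), hab⟩).1
  · exact h.1 a
  · exact (h.2 ⟨(b, a), hab⟩).2

/-- All conditions concern ordered pairs `(a, b)`. Equal entries give `DiagOK`; the two orientations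
of an increasing pair are bundled in `PairOK`, the reversed one being read through `pull ![1, 0]`.
-/
theorem constraints_iff (ω : World (arity k ar) n) (c : Fin n → L) :
    (StandardLinear ω ∧ ∀ v : Fin 2 → Fin n, κ (pull v ω) (c (v 0)) (c (v 1))) ↔
      (∀ a, DiagOK κ (pull (fun _ => a) ω) (c a)) ∧
        ∀ x : OrdPair n, PairOK κ (min ((x.1.2 : ℕ) - x.1.1) (k + 1)) (pull ![x.1.1, x.1.2] ω)
          (c x.1.1) (c x.1.2) := by
  have h1 : (StandardLinear ω ∧ ∀ v : Fin 2 → Fin n, κ (pull v ω) (c (v 0)) (c (v 1))) ↔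
      ∀ a b : Fin n, κ (pull ![a, b] ω) (c a) (c b) ∧
        ((⟨.le, ![a, b]⟩ : GroundAtom (arity k ar) n) ∈ ω ↔ a ≤ b) ∧
        ∀ s : Fin k, (⟨.pred s, ![a, b]⟩ : GroundAtom (arity k ar) n) ∈ ω ↔
          (a : ℕ) + (s + 1) = b := by
    constructor
    · rintro ⟨⟨hle, hpred⟩, h⟩ a b
      exact ⟨h ![a, b], hle a b, fun s => hpred s a b⟩
    · intro h
      refine ⟨⟨fun a b => (h a b).2.1, fun s a b => (h a b).2.2 s⟩, fun v => ?_⟩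
      have hv : v = ![v 0, v 1] := by
        ext1 i
        fin_cases i <;> rfl
      have := (h (v 0) (v 1)).1
      rwa [← hv] at this
  rw [h1, forall_pair_iff]
  refine and_congr (forall_congr' fun a => ?_) (forall_congr' fun x => ?_)
  · have ha : (![a, a] : Fin 2 → Fin n) = fun _ => a := by
      ext1 i
      fin_cases i <;> rfl
    rw [DiagOK, ha]
    simp only [le_mem_pull, pred_mem_pull, ha]
    refine and_congr Iff.rfl (and_congr (by simp) (forall_congr' fun s => ?_))
    exact ⟨fun h h' => by have := h.1 h'; omega,
      fun h => ⟨fun h' => absurd h' h, fun h' => by omega⟩⟩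
  · obtain ⟨⟨a, b⟩, hab⟩ := x
    have hs : (fun i => (![a, b] : Fin 2 → Fin n) ((![1, 0] : Fin 2 → Fin 2) i)) = ![b, a] := by
      ext1 i
      fin_cases i <;> rfl
    simp only at hab ⊢
    rw [PairOK, pull_pull, hs]
    simp only [le_mem_pull, pred_mem_pull, Matrix.cons_val_zero, Matrix.cons_val_one]
    rw [Fin.lt_def] at hab
    refine and_congr (and_congr Iff.rfl (and_congr ?_ (forall_congr' fun s => ?_)))
      (and_congr Iff.rfl (and_congr ?_ (forall_congr' fun s => ?_)))
    · exact iff_true_right (Fin.le_def.2 hab.le)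
    -- Since `s < k`, the cap `k + 1` is never of the form `s + 1`, so capping the distance does not
    -- affect the predecessor predicates.
    · have := s.2
      refine iff_congr Iff.rfl ?_
      omega
    · exact iff_false_right (by rw [Fin.le_def]; omega)
    · exact iff_false_right (by omega)

theorem exists_wfomc_eq (Γ : FO2 (arity k ar)) :
    ∃ (L : Type) (_ : Fintype L) (s : L → ℤ) (Δ : World (arity k ar) 2 → L → Prop)
      (Ξ : ℕ → World (arity k ar) 2 → L → L → Prop),
      ∀ {R : Type} [CommRing R] (w wbar : Sym m k → R) (n : ℕ),
        wfomc n (WithLinear Γ n) w wbar = n.factorial *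
          ((∑ ν : NullaryPred (arity k ar) → Bool, nullaryWeight w wbar ν *
            chainSum (k + 1) (cellWeight s Δ w wbar ν) (edgeWeight Ξ w wbar ν) n) *
            ∏ p, (w p + wbar p) ^ bigCount (arity k ar) p n) := by
  classical
  obtain ⟨L, _, s, κ, hκ⟩ := exists_models_eq_sum Γ
  refine ⟨L, inferInstance, s, DiagOK κ, PairOK κ, fun {R} _ w wbar n => ?_⟩
  rw [wfomc_withLinear, ← prod_bigAtom fun p => w p + wbar p]
  congr 1
  refine Eq.trans (Finset.sum_congr rfl fun ω _ => ?_)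
    ((sum_labeled_worlds s (DiagOK κ) (PairOK κ) (k + 1) w wbar n).trans ?_)
  · rw [← mul_assoc]
    congr 1
    -- The signed sum for `Γ` lives over the integers and is transported to `R` by the canonical
    -- map.
    rw [← map_ind (Int.castRingHom R) (Models ω Γ), hκ, map_sum, Finset.mul_sum]
    refine Finset.sum_congr rfl fun c _ => ?_
    rw [map_mul, map_prod, map_ind, mul_left_comm, ← ind_and, constraints_iff, ind_and,
      ind_forall, ind_forall, ← mul_assoc, ← Finset.prod_mul_distrib]
    simp
  · congr!

end Constraints

end WFOMC

namespace WFOMC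

open Polynomial Filter

/-! ### Domain-liftability -/

section Assembly

variable {m k : ℕ} {ar : Fin m → ℕ}

theorem Sym.card_eq : Fintype.card (Sym m k) = m + 1 + k := by
  have e : Sym m k ≃ (Fin m ⊕ Unit) ⊕ Fin k :=
    { toFun := fun
        | .user i => .inl (.inl i)
        | .le => .inl (.inr ())
        | .pred s => .inr s
      invFun := fun
        | .inl (.inl i) => .user i
        | .inl (.inr _) => .le
        | .inr s => .pred s
      left_inv := by rintro (_ | _ | _) <;> rfl
      right_inv := by rintro ((_ | _) | _) <;> rfl }
  simp [Fintype.card_congr e]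

/-- The number of ground atoms of a predicate that mention at least three domain elements, as an
index expression. -/
noncomputable def bigCountExpr {P : Type} (ar : P → ℕ) (p : P) : IExpr :=
  .sub (.pow .size (ar p)) (.add (.const (Nat.card {z : NullaryPred ar // z.1 = p}))
    (.add (.mul .size (.const (Nat.card {u : PosPred ar // u.1 = p})))
      (.mul (.tri .size) (.const (Nat.card {b : PairAtom ar // b.1.1 = p})))))

theorem eval_bigCountExpr {P : Type} [Fintype P] (ar : P → ℕ) (p : P) (n x : ℕ) :
    (bigCountExpr ar p).eval n x = bigCount ar p n := by
  simp only [bigCountExpr, IExpr.eval, IExpr.eval_pow, pow_arity_eq p n]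
  omega

theorem domainLiftable (Γ : FO2 (arity k ar)) : DomainLiftable Γ := by
  classical
  obtain ⟨L, _, s, Δ, Ξ, H⟩ := exists_wfomc_eq Γ
  let e : Sym m k ≃ Fin (m + 1 + k) := Fintype.equivFinOfCardEq Sym.card_eq
  -- Generic weights, one variable per input register; evaluation at actual weights is a ring
  -- homomorphism, with which the cell and edge weights commute.
  let W : Sym m k → MvPolynomial (Fin (2 * (m + 1 + k))) ℤ := fun p =>
    MvPolynomial.X ⟨2 * p.index, by have := p.index_lt; omega⟩
  let Wbar : Sym m k → MvPolynomial (Fin (2 * (m + 1 + k))) ℤ := fun p =>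
    MvPolynomial.X ⟨2 * p.index + 1, by have := p.index_lt; omega⟩
  -- Outside the range the symbol `.le` is an arbitrary default.
  have hex : ∀ j, ∃ p : Sym m k, ∀ h : j < m + 1 + k, p = e.symm ⟨j, h⟩ := fun j => by
    by_cases h : j < m + 1 + k
    · exact ⟨e.symm ⟨j, h⟩, fun _ => rfl⟩
    · exact ⟨.le, fun h' => absurd h' h⟩
  choose sym hsym using hex
  obtain ⟨prog, T, hprog⟩ := exists_chain_program (2 * (m + 1 + k)) k (m + 1 + k)
    (nullaryWeight W Wbar) (cellWeight s Δ W Wbar) (edgeWeight Ξ W Wbar)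
    (fun j => W (sym j) + Wbar (sym j)) (fun j => bigCountExpr (arity k ar) (sym j))
    (fun j => bigCount (arity k ar) (sym j)) fun j _ n x => eval_bigCountExpr _ _ n x
  refine domainLiftable_of_program prog T fun {R} _ 𝓕 w wbar hw hwbar => ?_
  obtain ⟨b₀, hb₀⟩ := exists_mem_input 𝓕 hw hwbar
  -- The number memory of the input does not depend on the domain size, so `0` stands for any size
  -- here.
  let V : ℕ → R := (input 0 w wbar).num
  let φ : MvPolynomial (Fin (2 * (m + 1 + k))) ℤ →+* R :=
    (MvPolynomial.aeval fun j : Fin (2 * (m + 1 + k)) => V j).toRingHom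
  obtain ⟨B, hB⟩ := hprog 𝓕 V (fun j _ => ⟨b₀, hb₀ 0 j⟩) φ fun p => rfl
  have hφ : (fun p => φ (W p)) = w := by
    funext p
    refine (MvPolynomial.aeval_X _ _).trans ?_
    change (if 2 * p.index % 2 = 0 then entry w (2 * p.index / 2) else _) = _
    rw [if_pos (by omega), Nat.mul_div_cancel_left _ two_pos, entry_index]
  have hφbar : (fun p => φ (Wbar p)) = wbar := by
    funext p
    refine (MvPolynomial.aeval_X _ _).trans ?_
    change (if (2 * p.index + 1) % 2 = 0 then _ else entry wbar ((2 * p.index + 1) / 2)) = _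
    rw [if_neg (by omega), show (2 * p.index + 1) / 2 = p.index by omega, entry_index]
  refine ⟨B, fun n _ => ?_⟩
  obtain ⟨c, hc, s', hrun, hs'⟩ := hB n (input n w wbar) rfl rfl rfl
  refine ⟨c, hc, s', hrun, ?_⟩
  have hprod : (∏ j ∈ Finset.range (m + 1 + k),
      φ (W (sym j) + Wbar (sym j)) ^ bigCount (arity k ar) (sym j) n) =
      ∏ p, (w p + wbar p) ^ bigCount (arity k ar) p n := by
    rw [Finset.prod_range, ← e.symm.prod_comp]
    refine Finset.prod_congr rfl fun j _ => ?_
    rw [hsym j j.2, map_add, ← congrFun hφ, ← congrFun hφbar]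
  rw [hs', H, hprod]
  simp only [map_nullaryWeight, map_cellWeight, map_edgeWeight, hφ, hφbar]
  rw [← mul_assoc, mul_comm (n.factorial : R)]

end Assembly

end WFOMC

theorem theorem1 (m k : ℕ) (ar : Fin m → ℕ) (Γ : WFOMC.FO2 (WFOMC.arity k ar))
    (hΓ : Γ.IsSentence) : WFOMC.DomainLiftable Γ := by
  exact WFOMC.domainLiftable Γ
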